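/- Let $q,n,d$ be positive integers and let $\Sigma$ be a set of $q$ symbols. For a word $u\in\Sigma^n$ and $\sigma\in\Sigma$, let $w_\sigma(u)=|\{i\in\{1,\dots,n\}: u_i=\sigma\}|$. A word $u$ has *equitable symbol weight* if $w_\sigma(u)\in\{\lfloor n/q\rfloor,\lceil n/q\rceil\}$ for every $\sigma\in\Sigma$. A $q$-ary *equitable symbol weight code* of length $n$ and minimum distance $d$ is a set $\mathcal C\subseteq\Sigma^n$ all of whose elements have equitable symbol weight and for which the minimum Hamming distance between two distinct elements of $\mathcal C$ equals $d$. Let $A_q^{ESW}(n,d)$ be the maximum size of such a code. Then $$A_2^{ESW}(3,2)=3,\quad A_2^{ESW}(5,3)=4,\quad A_2^{ESW}(7,4)=7,$$ $$A_3^{ESW}(3,2)=6,\quad A_3^{ESW}(4,3)=6,\quad A_3^{ESW}(11,8)=11,$$ $$A_4^{ESW}(5,4)=12,\quad A_5^{ESW}(7,6)=14,\quad A_6^{ESW}(9,8)=14.$$ -/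

import Mathlib

namespace ESW

/-- The frequency `w_σ(u)` of the symbol `σ` in the word `u` of length `n` over `q` symbols. -/
def freq {q n : ℕ} (σ : Fin q) (u : Fin n → Fin q) : ℕ :=
  (Finset.univ.filter fun i => u i = σ).card

/-- `u` has equitable symbol weight: every symbol of the alphabet (also one that does not occur)
has frequency `⌊n/q⌋` or `⌈n/q⌉`. -/
def HasEquitableSymbolWeight {q n : ℕ} (u : Fin n → Fin q) : Prop :=
  ∀ σ : Fin q, freq σ u = n / q ∨ freq σ u = n ⌈/⌉ q

/-- The minimum Hamming distance between two distinct codewords of `C` is (exactly) `d`. -/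
def HasMinDist {q n : ℕ} (C : Finset (Fin n → Fin q)) (d : ℕ) : Prop :=
  IsLeast {e : ℕ | ∃ u ∈ C, ∃ v ∈ C, u ≠ v ∧ hammingDist u v = e} d

/-- `C` is a `q`-ary equitable symbol weight code of length `n` and minimum distance `d`. -/
structure IsESWC (q n d : ℕ) (C : Finset (Fin n → Fin q)) : Prop where
  equitable : ∀ u ∈ C, HasEquitableSymbolWeight u
  minDist : HasMinDist C d

/-- The set of sizes of `q`-ary equitable symbol weight codes of length `n` and minimum
distance `d`. -/
def sizes (q n d : ℕ) : Set ℕ :=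
  {M : ℕ | ∃ C : Finset (Fin n → Fin q), IsESWC q n d C ∧ C.card = M}

theorem bddAbove_sizes (q n d : ℕ) : BddAbove (sizes q n d) := by
  refine ⟨Fintype.card (Fin n → Fin q), ?_⟩
  rintro M ⟨C, -, rfl⟩
  exact Finset.card_le_univ C

/-- The maximum size of a `q`-ary equitable symbol weight code of length `n` and minimum
distance `d`. The set of sizes is bounded, so the supremum is a maximum whenever such a code
exists; it is `0` otherwise. -/
noncomputable def A (q n d : ℕ) : ℕ := sSup (sizes q n d)

end ESW

/-! Lower bounds come from explicit codes, checked by evaluation. For the upper bounds, a code of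
size greater than `M` contains `M + 1` equitable words pairwise agreeing in at most `l = n - d`
positions (`IsFamily`), and for each parameter set such a family is excluded.

The basic tool is the Plotkin count: summing agreements over all ordered pairs of words gives the
sum of the squared column counts. Over 6 symbols with length 9, rounding the column counts to
integers already violates it. When the bound is attained, `tight_family` gives balanced columns and
constant agreements. For binary words the parity of the weights adds a contradiction at lengths 3, 5
and 7. For length `q + 1` and distance `q`, one column block of `q` words forces its symbol to occur
twice in each of them, and counting that symbol bounds the size by `q(q - 1)`. Length 3 over three
symbols only concerns the six permutations.

For `A 3 11 8` twelve words would be tight: every column is balanced and any two words agree three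
times. Each symbol has a group of four words in which it occurs three times. Among all pairs inside
a group choose one with the largest invariant `wt`; after renaming symbols and permuting positions
the group belongs to symbol 2 and the pair is one of eight explicit ones. The third word of the
group is sorted inside the cells of the pair, and the fourth has no smaller key. A verified
exhaustive search (`checkPair`) finds no completion in any of the eight cases.

For `A 5 7 6` fifteen words would form a Kirkman triple system: in each position the words split
into five triples, and any two words share exactly one triple. Even subsets of the words map to
parity vectors of the triples, and the image is totally singular for seven copies of an elliptic
quadratic form of dimension 4 over the field with two elements. The dimension is too large for the
map to be injective (a Gauss sum has the wrong sign), so some nonempty even set meets every triple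
evenly. Its complement is a Fano plane of seven words. Fixing this plane, a second search
(`checkSeven`) rules out the other eight words together with the five constant words, which encode
the equitable weight condition. -/

namespace ESW

open Finset

/-! ### Agreement counts and the Plotkin bound. -/

/-- The number of positions in which two words agree. -/
def agree {q n : ℕ} (u v : Fin n → Fin q) : ℕ := (univ.filter fun i => u i = v i).card

/-- The number of words of the family `c` that have the symbol `σ` in position `i`. -/
def colCount {M n q : ℕ} (c : Fin M → Fin n → Fin q) (i : Fin n) (σ : Fin q) : ℕ :=
  (univ.filter fun k => c k i = σ).card

theorem agree_add_hammingDist {q n : ℕ} (u v : Fin n → Fin q) :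
    agree u v + hammingDist u v = n := by
  have := card_filter_add_card_filter_not (s := (univ : Finset (Fin n))) (fun i => u i = v i)
  simpa [agree, hammingDist] using this

theorem agree_self {q n : ℕ} (u : Fin n → Fin q) : agree u u = n := by simp [agree]

theorem agree_eq_sum {q n : ℕ} (u v : Fin n → Fin q) :
    agree u v = ∑ i, if u i = v i then 1 else 0 := by
  simp [agree]

theorem freq_eq_sum {q n : ℕ} (σ : Fin q) (u : Fin n → Fin q) :
    freq σ u = ∑ i, if u i = σ then 1 else 0 := by
  simp [freq]

theorem colCount_eq_sum {M n q : ℕ} (c : Fin M → Fin n → Fin q) (i : Fin n) (σ : Fin q) :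
    colCount c i σ = ∑ k, if c k i = σ then 1 else 0 := by
  simp [colCount]

theorem sum_freq {q n : ℕ} (u : Fin n → Fin q) : ∑ σ, freq σ u = n := by
  simp only [freq_eq_sum]
  rw [sum_comm]
  simp

theorem sum_colCount {M n q : ℕ} (c : Fin M → Fin n → Fin q) (i : Fin n) :
    ∑ σ, colCount c i σ = M := by
  simp only [colCount_eq_sum]
  rw [sum_comm]
  simp

theorem sum_freq_eq_sum_colCount {M n q : ℕ} (c : Fin M → Fin n → Fin q) (σ : Fin q) :
    ∑ k, freq σ (c k) = ∑ i, colCount c i σ := by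
  simp only [freq_eq_sum, colCount_eq_sum]
  exact sum_comm

/-- Double counting of the agreements of a family of words. -/
theorem sum_sum_agree {M n q : ℕ} (c : Fin M → Fin n → Fin q) :
    ∑ j, ∑ k, agree (c j) (c k) = ∑ i, ∑ σ, colCount c i σ ^ 2 := by
  have h1 : ∀ i : Fin n, ∀ σ : Fin q, colCount c i σ ^ 2 =
      ∑ j, ∑ k, if c j i = σ ∧ c k i = σ then 1 else 0 := by
    intro i σ
    rw [sq, colCount_eq_sum, sum_mul_sum]
    refine sum_congr rfl fun j _ => sum_congr rfl fun k _ => ?_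
    by_cases h : c j i = σ <;> by_cases h' : c k i = σ <;> simp [h, h']
  have h2 : ∀ j k : Fin M, agree (c j) (c k) =
      ∑ i, ∑ σ, if c j i = σ ∧ c k i = σ then 1 else 0 := by
    intro j k
    rw [agree_eq_sum]
    refine sum_congr rfl fun i _ => ?_
    by_cases h : c j i = c k i
    · simp [h]
    · rw [if_neg h]
      symm
      refine sum_eq_zero fun σ _ => if_neg ?_
      rintro ⟨rfl, h'⟩
      exact h h'.symm
  simp only [h1, h2]
  calc _ = ∑ j, ∑ i, ∑ k, ∑ σ, (if c j i = σ ∧ c k i = σ then 1 else 0) :=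
        sum_congr rfl fun j _ => sum_comm
    _ = ∑ i, ∑ j, ∑ k, ∑ σ, (if c j i = σ ∧ c k i = σ then 1 else 0) := sum_comm
    _ = ∑ i, ∑ j, ∑ σ, ∑ k, (if c j i = σ ∧ c k i = σ then 1 else 0) :=
        sum_congr rfl fun i _ => sum_congr rfl fun j _ => sum_comm
    _ = _ := sum_congr rfl fun i _ => sum_comm

/-- A family of equitable words that pairwise agree in at most `l` positions. -/
structure IsFamily {M n q : ℕ} (l : ℕ) (c : Fin M → Fin n → Fin q) : Prop where
  equitable : ∀ k, HasEquitableSymbolWeight (c k)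
  agree_le : ∀ j k, j ≠ k → agree (c j) (c k) ≤ l

/-- Only the lower bound on distances matters here, and it passes to subsets, so it suffices to
exclude families of exactly `M + 1` words. -/
theorem card_le_of_no_family {q n d M : ℕ} (hd : d ≤ n)
    (h : ∀ c : Fin (M + 1) → Fin n → Fin q, ¬ IsFamily (n - d) c)
    (C : Finset (Fin n → Fin q)) (hC : IsESWC q n d C) : C.card ≤ M := by
  by_contra! hlt
  obtain ⟨D, hDC, hD⟩ := exists_subset_card_eq (show M + 1 ≤ C.card from hlt)
  let e : Fin (M + 1) ≃ D := (finCongr hD.symm).trans D.equivFin.symm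
  refine h (fun k => (e k : Fin n → Fin q)) ⟨fun k => hC.equitable _ (hDC (e k).2), ?_⟩
  intro j k hjk
  have hne : (e j : Fin n → Fin q) ≠ e k := fun h => hjk (e.injective (Subtype.ext h))
  have h1 : d ≤ hammingDist (e j : Fin n → Fin q) (e k) :=
    hC.minDist.2 ⟨_, hDC (e j).2, _, hDC (e k).2, hne, rfl⟩
  have h2 := agree_add_hammingDist (e j : Fin n → Fin q) (e k)
  omega

theorem A_eq_of {q n d M : ℕ} (hd : d ≤ n)
    (h : ∀ c : Fin (M + 1) → Fin n → Fin q, ¬ IsFamily (n - d) c)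
    (C : Finset (Fin n → Fin q)) (hC : IsESWC q n d C) (hM : C.card = M) : A q n d = M := by
  refine le_antisymm (csSup_le ⟨M, C, hC, hM⟩ ?_) (le_csSup (bddAbove_sizes q n d) ⟨C, hC, hM⟩)
  rintro _ ⟨D, hD, rfl⟩
  exact card_le_of_no_family hd h D hD

theorem IsFamily.sum_agree_le {M n q l : ℕ} {c : Fin M → Fin n → Fin q} (hc : IsFamily l c)
    (j : Fin M) : ∑ k, agree (c j) (c k) ≤ n + (M - 1) * l := by
  rw [← add_sum_erase univ _ (mem_univ j), agree_self]
  refine Nat.add_le_add_left ?_ n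
  calc _ ≤ ∑ k ∈ univ.erase j, l :=
        sum_le_sum fun k hk => hc.agree_le j k (ne_of_mem_erase hk).symm
    _ = _ := by simp

theorem sum_sum_agree_le {M n q l : ℕ} {c : Fin M → Fin n → Fin q} (hc : IsFamily l c) :
    ∑ j, ∑ k, agree (c j) (c k) ≤ M * (n + (M - 1) * l) := by
  calc _ ≤ ∑ _j : Fin M, (n + (M - 1) * l) := sum_le_sum fun j _ => hc.sum_agree_le j
    _ = _ := by simp

/-- When the Plotkin bound is attained, all columns are balanced and all distances are equal. -/
theorem tight_family {n q l m : ℕ} {c : Fin (q * m) → Fin n → Fin q} (hc : IsFamily l c)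
    (hn : q * m * (n + (q * m - 1) * l) = n * (q * m ^ 2)) :
    (∀ i σ, colCount c i σ = m) ∧ ∀ j k, j ≠ k → agree (c j) (c k) = l := by
  -- The counts in a column have mean `m`, so the excess of the sum of squares over its minimum is
  -- the sum of squared deviations.
  have hcol : ∀ i, (∑ σ, (colCount c i σ : ℤ) ^ 2) =
      q * (m : ℤ) ^ 2 + ∑ σ, ((colCount c i σ : ℤ) - m) ^ 2 := by
    intro i
    have h1 : (∑ σ, (colCount c i σ : ℤ)) = q * m := by
      exact_mod_cast sum_colCount c i
    have h2 : ∀ σ, ((colCount c i σ : ℤ) - m) ^ 2 =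
        (colCount c i σ : ℤ) ^ 2 - 2 * m * colCount c i σ + m ^ 2 := fun σ => by ring
    simp only [h2, sum_add_distrib, sum_sub_distrib, ← mul_sum, h1]
    simp
    ring
  have hsum : (∑ j, ∑ k, (agree (c j) (c k) : ℤ)) =
      n * (q * m ^ 2) + ∑ i, ∑ σ, ((colCount c i σ : ℤ) - m) ^ 2 := by
    have := sum_sum_agree c
    zify at this
    rw [this]
    simp only [hcol, sum_add_distrib]
    simp
  have hle := sum_sum_agree_le hc
  rw [hn] at hle
  zify at hle
  have hz : ∑ i, ∑ σ, ((colCount c i σ : ℤ) - m) ^ 2 = 0 :=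
    le_antisymm (by linarith) (sum_nonneg fun i _ => sum_nonneg fun σ _ => sq_nonneg _)
  constructor
  · intro i σ
    have h1 := (sum_eq_zero_iff_of_nonneg
      (fun i _ => sum_nonneg fun σ _ => sq_nonneg _)).1 hz i (mem_univ i)
    have h2 := (sum_eq_zero_iff_of_nonneg (fun σ _ => sq_nonneg _)).1 h1 σ (mem_univ σ)
    have h3 : (colCount c i σ : ℤ) - m = 0 := by simpa using h2
    omega
  · by_contra! hne
    obtain ⟨j, k, hjk, hne⟩ := hne
    -- One pair with fewer than `l` agreements would push the double sum below the value forced by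
    -- the balanced columns.
    have hlt : ∑ j, ∑ k, agree (c j) (c k) < q * m * (n + (q * m - 1) * l) := by
      have h' : ∑ k, agree (c j) (c k) < n + (q * m - 1) * l := by
        rw [← add_sum_erase univ _ (mem_univ j), agree_self]
        refine Nat.add_lt_add_left ?_ n
        calc _ < ∑ k ∈ univ.erase j, l :=
              sum_lt_sum (fun k hk => hc.agree_le j k (ne_of_mem_erase hk).symm)
                ⟨k, mem_erase.2 ⟨hjk.symm, mem_univ k⟩, lt_of_le_of_ne (hc.agree_le j k hjk) hne⟩
          _ = _ := by simp
      calc _ < ∑ _j : Fin (q * m), (n + (q * m - 1) * l) :=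
            sum_lt_sum (fun j _ => hc.sum_agree_le j) ⟨j, mem_univ j, h'⟩
        _ = _ := by simp
    rw [hn] at hlt
    zify at hlt
    rw [hz, add_zero] at hsum
    linarith

/-! ### Binary words: parity of the weights. -/

theorem agree_add_freq_mod_two {n : ℕ} (u v : Fin n → Fin 2) :
    (agree u v + freq 1 u + freq 1 v + n) % 2 = 0 := by
  have : agree u v + freq 1 u + freq 1 v + n = ∑ i, ((if u i = v i then 1 else 0) +
      (if u i = 1 then 1 else 0) + (if v i = 1 then 1 else 0) + 1) := by
    simp [sum_add_distrib, agree_eq_sum, freq_eq_sum]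
  rw [this, sum_nat_mod]
  have : ∀ i, ((if u i = v i then 1 else 0) +
      (if u i = 1 then 1 else 0) + (if v i = 1 then 1 else 0) + 1) % 2 = 0 := by
    intro i
    generalize u i = a
    generalize v i = b
    revert a b
    decide
  simp [this]

/-- There is no family of `2 m` binary words attaining the Plotkin bound with even distances
when the length is odd. -/
theorem no_binary_family {n l m : ℕ} (hodd : n % 2 = 1) (hl : l % 2 = 1)
    (hn : 2 * m * (n + (2 * m - 1) * l) = n * (2 * m ^ 2)) (hm : 0 < m)
    (c : Fin (2 * m) → Fin n → Fin 2) : ¬ IsFamily l c := by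
  intro hc
  obtain ⟨hcol, hag⟩ := tight_family hc hn
  have h0 : 0 < 2 * m := by omega
  -- Agreements and length are both odd, so any two weights have the same parity; they are taken
  -- from two consecutive integers and hence coincide.
  have hfreq : ∀ k, freq 1 (c k) = freq 1 (c ⟨0, h0⟩) := by
    intro k
    by_cases hk : k = ⟨0, h0⟩
    · rw [hk]
    have h1 := agree_add_freq_mod_two (c k) (c ⟨0, h0⟩)
    rw [hag _ _ hk] at h1
    have h2 := hc.equitable k 1
    have h3 := hc.equitable ⟨0, h0⟩ 1
    rw [Nat.ceilDiv_eq_add_pred_div] at h2 h3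
    omega
  have h1 := sum_freq_eq_sum_colCount c 1
  simp only [hcol, hfreq] at h1
  simp only [sum_const, card_univ, Fintype.card_fin, smul_eq_mul] at h1
  -- Counting the ones by rows and by columns makes the odd number `n` even.
  have h2 : 2 * freq 1 (c ⟨0, h0⟩) = n := by
    have : m * (2 * freq 1 (c ⟨0, h0⟩)) = m * n := by linarith
    exact Nat.eq_of_mul_eq_mul_left hm this
  omega

/-- In every position, some two of three binary words agree. -/
theorem le_sum_agree_binary {n : ℕ} (u v w : Fin n → Fin 2) :
    n ≤ agree u v + agree u w + agree v w := by
  calc n = ∑ _i : Fin n, 1 := by simp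
    _ ≤ ∑ i, ((if u i = v i then 1 else 0) + (if u i = w i then 1 else 0) +
        (if v i = w i then 1 else 0)) := by
      refine sum_le_sum fun i _ => ?_
      generalize u i = a
      generalize v i = b
      generalize w i = c
      revert a b c
      decide
    _ = _ := by simp [sum_add_distrib, agree_eq_sum]

/-- Three of the five words have weights of equal parity. The length is odd, so their mutual
agreements are odd, hence at most 1, and add up to at most 3; but three binary words of length 5
have at least 5 agreements in total. -/
theorem no_family_two_five (c : Fin 5 → Fin 5 → Fin 2) : ¬ IsFamily 2 c := by
  intro hc
  obtain ⟨p, hp⟩ := Fintype.exists_lt_card_fiber_of_mul_lt_card (n := 2)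
    (fun k => (⟨freq 1 (c k) % 2, Nat.mod_lt _ two_pos⟩ : Fin 2)) (by simp)
  obtain ⟨x, hx, y, hy, z, hz, hxy, hxz, hyz⟩ := two_lt_card.1 hp
  simp only [mem_filter, mem_univ, true_and, Fin.ext_iff] at hx hy hz
  have h1 := agree_add_freq_mod_two (c x) (c y)
  have h2 := agree_add_freq_mod_two (c x) (c z)
  have h3 := agree_add_freq_mod_two (c y) (c z)
  have h4 := hc.agree_le x y hxy
  have h5 := hc.agree_le x z hxz
  have h6 := hc.agree_le y z hyz
  have h7 := le_sum_agree_binary (c x) (c y) (c z)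
  omega

/-- Integrality sharpens the Plotkin bound: `x² ≥ 5x - 6` for integers, with equality at 2 and 3, so
each column contributes at least `5·15 - 6·6 = 39`. Then `9·39 = 351` exceeds `15·(9 + 14) = 345`.
-/
theorem no_family_six_nine (c : Fin 15 → Fin 9 → Fin 6) : ¬ IsFamily 1 c := by
  intro hc
  have h1 := sum_sum_agree_le hc
  rw [sum_sum_agree] at h1
  have h2 : ∀ i, 39 ≤ ∑ σ, colCount c i σ ^ 2 := by
    intro i
    have h3 : ∀ σ, 5 * (colCount c i σ : ℤ) - 6 ≤ (colCount c i σ : ℤ) ^ 2 := by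
      intro σ
      rcases le_or_gt (colCount c i σ : ℤ) 2 with h | h
      · nlinarith
      · nlinarith [show (3 : ℤ) ≤ colCount c i σ by omega]
    have h4 := sum_le_sum fun σ (_ : σ ∈ univ) => h3 σ
    have h5 : (∑ σ, (colCount c i σ : ℤ)) = 15 := by exact_mod_cast sum_colCount c i
    simp only [sum_sub_distrib, ← mul_sum, h5] at h4
    simp at h4
    zify
    linarith
  have h3 := sum_le_sum fun i (_ : i ∈ univ) => h2 i
  simp at h3
  omega

/-! ### Length `q + 1` and distance `q`. -/

section SuccLength

variable {q M : ℕ} {c : Fin M → Fin (q + 1) → Fin q}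

theorem two_le_agree {n q : ℕ} {u v : Fin n → Fin q} {i j : Fin n} (hij : i ≠ j) (hi : u i = v i)
    (hj : u j = v j) : 2 ≤ agree u v := by
  have : ({i, j} : Finset (Fin n)) ⊆ univ.filter fun i => u i = v i := by
    intro k hk
    simp only [mem_insert, mem_singleton] at hk
    rcases hk with rfl | rfl <;> simp [hi, hj]
  have := card_le_card this
  rwa [card_pair hij] at this

/-- Words sharing `σ` in column `i` have used up their only agreement. -/
theorem IsFamily.injOn_column {n q M : ℕ} {c : Fin M → Fin n → Fin q} (hc : IsFamily 1 c)
    {i j : Fin n} (hij : i ≠ j) (σ : Fin q) :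
    Set.InjOn (fun k => c k j) (univ.filter fun k => c k i = σ : Finset (Fin M)) := by
  intro a ha b hb hab
  simp only [coe_filter, mem_univ, true_and, Set.mem_ofPred_eq] at ha hb
  by_contra hne
  have := two_le_agree (u := c a) (v := c b) hij (by rw [ha, hb]) hab
  have := hc.agree_le a b hne
  omega

theorem IsFamily.colCount_le (hc : IsFamily 1 c) (hq : 0 < q) (i : Fin (q + 1)) (σ : Fin q) :
    colCount c i σ ≤ q := by
  have : NeZero q := ⟨hq.ne'⟩
  obtain ⟨j, hj⟩ := exists_ne i
  have := card_le_card_of_injOn (t := univ) (fun k => c k j) (by simp)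
    (hc.injOn_column hj.symm σ)
  simpa [colCount] using this

theorem freq_bounds {q : ℕ} (hq : 2 ≤ q) {u : Fin (q + 1) → Fin q}
    (hu : HasEquitableSymbolWeight u) (σ : Fin q) : freq σ u = 1 ∨ freq σ u = 2 := by
  have h := hu σ
  have h1 : (q + 1) / q = 1 := by
    rw [Nat.div_eq_iff (by omega)]
    omega
  have h2 : (q + 1) ⌈/⌉ q = 2 := by
    rw [Nat.ceilDiv_eq_add_pred_div, Nat.div_eq_iff (by omega)]
    omega
  rwa [h1, h2] at h

/-- If `σ` occurs `q` times in a column, then every word with `σ` in that column contains `σ`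
twice. -/
theorem IsFamily.freq_eq_two (hc : IsFamily 1 c) (hq : 2 ≤ q) {i : Fin (q + 1)} {σ : Fin q}
    (hfull : colCount c i σ = q) {k : Fin M} (hk : c k i = σ) : freq σ (c k) = 2 := by
  set B := univ.filter fun k => c k i = σ with hB
  have hBc : B.card = q := hfull
  -- Over the block, every other column runs through all `q` symbols once. Thus `σ` occurs `q + q`
  -- times in the `q` words of the block, at most twice in each, so exactly twice in each.
  have h1 : ∀ j, j ≠ i → ∑ k ∈ B, (if c k j = σ then 1 else 0) = 1 := by
    intro j hj
    have himg : B.image (fun k => c k j) = univ := by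
      refine eq_univ_of_card _ ?_
      rw [card_image_of_injOn (hc.injOn_column hj.symm σ), hBc, Fintype.card_fin]
    have hs : σ ∈ B.image (fun k => c k j) := by rw [himg]; exact mem_univ σ
    obtain ⟨a, ha, hasig⟩ := mem_image.1 hs
    rw [sum_eq_single_of_mem a ha, if_pos hasig]
    intro b hb hba
    refine if_neg fun hbs => hba ?_
    exact hc.injOn_column hj.symm σ hb ha (hbs.trans hasig.symm)
  have h2 : ∑ k ∈ B, freq σ (c k) = 2 * q := by
    simp only [freq_eq_sum]
    rw [sum_comm, ← add_sum_erase univ _ (mem_univ i)]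
    have h3 : ∑ k ∈ B, (if c k i = σ then 1 else 0) = q := by
      calc _ = ∑ k ∈ B, 1 := sum_congr rfl fun k hk => if_pos (mem_filter.1 hk).2
        _ = q := by simp [hBc]
    have h4 : ∑ j ∈ univ.erase i, ∑ k ∈ B, (if c k j = σ then 1 else 0) = q := by
      rw [sum_congr rfl fun j hj => h1 j (ne_of_mem_erase hj)]
      simp
    rw [h3, h4]
    ring
  have hle : ∀ k ∈ B, freq σ (c k) ≤ 2 := by
    intro k _
    rcases freq_bounds hq (hc.equitable k) σ with h | h <;> omega
  have h5 : ∑ k ∈ B, freq σ (c k) = ∑ k ∈ B, 2 := by rw [h2]; simp [hBc, mul_comm]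
  exact (sum_eq_sum_iff_of_le hle).1 h5 k (by simp [hB, hk])

/-- With more than `q(q - 1)` words, every column has a symbol occurring `q` times. There are more
columns than symbols, so one symbol `σ` does so in two columns; counting all occurrences of `σ` then
leaves no slack. -/
theorem no_family_succ_length (hq : 3 ≤ q) (hM : M = q * (q - 1) + 1) : ¬ IsFamily 1 c := by
  intro hc
  obtain ⟨p, rfl⟩ : ∃ p, q = p + 3 := ⟨q - 3, by omega⟩
  have hM' : M = (p + 3) * (p + 2) + 1 := hM
  have hfull : ∀ i, ∃ σ, colCount c i σ = p + 3 := by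
    intro i
    by_contra! hne
    have : ∀ σ ∈ univ, colCount c i σ ≤ p + 2 := by
      intro σ _
      have h1 := hc.colCount_le (by omega) i σ
      have h2 := hne σ
      omega
    have h := sum_le_sum this
    rw [sum_colCount] at h
    simp at h
    omega
  choose s hs using hfull
  obtain ⟨i, j, hij, hsij⟩ := Fintype.exists_ne_map_eq_of_card_lt s (by simp)
  set σ := s i with hσ
  have hi : colCount c i σ = p + 3 := hs i
  have hj : colCount c j σ = p + 3 := by rw [hsij]; exact hs j
  set R := univ.filter fun k => freq σ (c k) = 2 with hR
  have hRcard : 2 * (p + 3) ≤ R.card + 1 := by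
    have hsub : (univ.filter fun k => c k i = σ) ∪ (univ.filter fun k => c k j = σ) ⊆ R := by
      intro k hk
      simp only [mem_union, mem_filter, mem_univ, true_and] at hk
      simp only [hR, mem_filter, mem_univ, true_and]
      rcases hk with hk | hk
      · exact hc.freq_eq_two (by omega) hi hk
      · exact hc.freq_eq_two (by omega) hj hk
    have hinter : ((univ.filter fun k => c k i = σ) ∩
        (univ.filter fun k => c k j = σ)).card ≤ 1 := by
      refine card_le_one.2 fun a ha b hb => ?_
      simp only [mem_inter, mem_filter, mem_univ, true_and] at ha hb
      by_contra hne
      have h1 := two_le_agree (u := c a) (v := c b) hij (by rw [ha.1, hb.1]) (by rw [ha.2, hb.2])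
      have h2 := hc.agree_le a b hne
      omega
    have h1 := card_union_add_card_inter (univ.filter fun k => c k i = σ)
      (univ.filter fun k => c k j = σ)
    have h2 := card_le_card hsub
    have h3 : (univ.filter fun k => c k i = σ).card = p + 3 := hi
    have h4 : (univ.filter fun k => c k j = σ).card = p + 3 := hj
    omega
  have hT : ∑ k, freq σ (c k) = M + R.card := by
    have : ∀ k, freq σ (c k) = 1 + if freq σ (c k) = 2 then 1 else 0 := by
      intro k
      rcases freq_bounds (by omega) (hc.equitable k) σ with h | h <;> simp [h]
    rw [sum_congr rfl fun k _ => this k, sum_add_distrib]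
    simp [hR]
  rw [sum_freq_eq_sum_colCount] at hT
  have hle : ∀ a ∈ univ, colCount c a σ ≤ p + 3 := fun a _ => hc.colCount_le (by omega) a σ
  have hle' := sum_le_sum hle
  simp only [sum_const, card_univ, Fintype.card_fin, smul_eq_mul] at hle'
  -- The two blocks share at most one word, so at least `2q - 1` words contain `σ` twice. The total
  -- is therefore at least `q(q - 1) + 1 + 2q - 1 = q(q + 1)`, which is also the largest value that
  -- the columns allow.
  have heq : ∑ a, colCount c a σ = ∑ _a : Fin (p + 3 + 1), (p + 3) := by
    simp only [sum_const, card_univ, Fintype.card_fin, smul_eq_mul]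
    nlinarith
  have hall := (sum_eq_sum_iff_of_le hle).1 heq
  have hRM : R.card = M := by
    have : R = univ := by
      rw [eq_univ_iff_forall]
      intro k
      have hpos : 0 < freq σ (c k) := by
        rcases freq_bounds (by omega) (hc.equitable k) σ with h | h <;> omega
      obtain ⟨a, ha⟩ := card_pos.1 hpos
      simp only [mem_filter, mem_univ, true_and] at ha
      simp only [hR, mem_filter, mem_univ, true_and]
      exact hc.freq_eq_two (by omega) (hall a (mem_univ a)) ha
    rw [this]
    simp
  simp only [sum_const, card_univ, Fintype.card_fin, smul_eq_mul] at heq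
  -- Now every word contains `σ` twice, so `2(q(q - 1) + 1) = q(q + 1)`, that is `(q - 1)(q - 2) =
  -- 0`, impossible for `q ≥ 3`.
  nlinarith

end SuccLength

/-- For `n = q` both allowed frequencies are 1, so the words are permutations, and there are only
six. -/
theorem no_family_three_three (c : Fin 7 → Fin 3 → Fin 3) : ¬ IsFamily 1 c := by
  intro hc
  have hcard : (univ.filter fun u : Fin 3 → Fin 3 => ∀ σ, freq σ u = 1).card = 6 := by decide
  have hmem : ∀ k, c k ∈ univ.filter fun u : Fin 3 → Fin 3 => ∀ σ, freq σ u = 1 := by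
    intro k
    simp only [mem_filter, mem_univ, true_and]
    intro σ
    have h := hc.equitable k σ
    rw [Nat.ceilDiv_eq_add_pred_div] at h
    simpa using h
  obtain ⟨j, -, k, -, hjk, h⟩ := exists_ne_map_eq_of_card_lt_of_maps_to
    (s := univ) (f := c) (by rw [hcard]; simp) (fun k _ => hmem k)
  have h1 := hc.agree_le j k hjk
  rw [h, agree_self] at h1
  omega

/-! ### Explicit codes for the lower bounds, and the values they settle. -/

/-- The word of length `n` over `Fin q` with the given list of entries. -/
def toWord (n q : ℕ) [NeZero q] (l : List ℕ) : Fin n → Fin q :=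
  fun i => Fin.ofNat q (l.getD i 0)

theorem card_filter_fin (n : ℕ) (p : ℕ → Prop) [DecidablePred p] :
    (univ.filter fun i : Fin n => p i).card = Nat.count p n := by
  rw [Nat.count_eq_card_filter_range, card_filter, card_filter]
  exact Fin.sum_univ_eq_sum_range (fun i => if p i then 1 else 0) n

theorem hammingDist_toWord {n q : ℕ} [NeZero q] (l l' : List ℕ) :
    hammingDist (toWord n q l) (toWord n q l') =
      Nat.count (fun i => l.getD i 0 % q ≠ l'.getD i 0 % q) n := by
  rw [← card_filter_fin, hammingDist]
  congr 1
  ext i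
  simp [toWord, Fin.ext_iff]

theorem freq_toWord {n q : ℕ} [NeZero q] (l : List ℕ) (σ : Fin q) :
    freq σ (toWord n q l) = Nat.count (fun i => l.getD i 0 % q = σ) n := by
  rw [← card_filter_fin, freq]
  congr 1
  ext i
  simp [toWord, Fin.ext_iff]

/-- A verification of equitable symbol weight codes by evaluation. -/
theorem isESWC_of_list {q n d a b : ℕ} [NeZero q] (ha : n / q = a) (hb : n ⌈/⌉ q = b)
    (L : List (List ℕ))
    (hL : ∀ l ∈ L, ∀ σ < q, Nat.count (fun i => l.getD i 0 % q = σ) n = a ∨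
      Nat.count (fun i => l.getD i 0 % q = σ) n = b)
    (hd : L.Pairwise fun l l' =>
      d ≤ Nat.count (fun i => l.getD i 0 % q ≠ l'.getD i 0 % q) n) (hpos : 0 < d)
    (hex : ∃ l ∈ L, ∃ l' ∈ L,
      Nat.count (fun i => l.getD i 0 % q ≠ l'.getD i 0 % q) n = d) :
    IsESWC q n d (L.map (toWord n q)).toFinset ∧
      (L.map (toWord n q)).toFinset.card = L.length := by
  have hd' : (L.map (toWord n q)).Pairwise fun u v => d ≤ hammingDist u v := by
    rw [List.pairwise_map]
    simpa only [hammingDist_toWord] using hd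
  -- Positive distances make the words distinct, so passing to a finset does not lose any.
  have hnd : (L.map (toWord n q)).Nodup := hd'.imp fun h => by
    rw [← hammingDist_pos]
    omega
  refine ⟨⟨fun u hu σ => ?_, ?_, ?_⟩, by rw [List.toFinset_card_of_nodup hnd, List.length_map]⟩
  · rw [ha, hb]
    obtain ⟨l, hl, rfl⟩ := List.mem_map.1 (List.mem_toFinset.1 hu)
    rw [freq_toWord]
    exact hL l hl σ σ.2
  · obtain ⟨l, hl, l', hl', h⟩ := hex
    rw [← hammingDist_toWord] at h
    refine ⟨_, List.mem_toFinset.2 (List.mem_map_of_mem hl), _,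
      List.mem_toFinset.2 (List.mem_map_of_mem hl'), ?_, h⟩
    rw [← hammingDist_pos]
    omega
  · rintro e ⟨u, hu, v, hv, hne, rfl⟩
    have : Std.Symm fun u v : Fin n → Fin q => d ≤ hammingDist u v :=
      ⟨fun u v h => by rwa [hammingDist_comm]⟩
    exact hd'.forall (List.mem_toFinset.1 hu) (List.mem_toFinset.1 hv) hne

def code_two_three : List (List ℕ) :=
  [[0, 0, 1], [0, 1, 0], [1, 0, 0]]

theorem isESWC_code_two_three : IsESWC 2 3 2 (code_two_three.map (toWord 3 2)).toFinset ∧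
    (code_two_three.map (toWord 3 2)).toFinset.card = 3 :=
  isESWC_of_list (a := 1) (b := 2) rfl
    (by rw [Nat.ceilDiv_eq_add_pred_div]) code_two_three (by decide +kernel) (by decide +kernel)
    (by norm_num) (by decide +kernel)

theorem A_two_three : A 2 3 2 = 3 :=
  A_eq_of (by norm_num) (no_binary_family (m := 2) (l := 1) rfl rfl rfl two_pos) _ isESWC_code_two_three.1
    isESWC_code_two_three.2

def code_two_five : List (List ℕ) :=
  [[0, 0, 0, 1, 1], [0, 1, 1, 0, 0], [1, 1, 0, 1, 0], [1, 0, 1, 0, 1]]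

theorem isESWC_code_two_five : IsESWC 2 5 3 (code_two_five.map (toWord 5 2)).toFinset ∧
    (code_two_five.map (toWord 5 2)).toFinset.card = 4 :=
  isESWC_of_list (a := 2) (b := 3) rfl
    (by rw [Nat.ceilDiv_eq_add_pred_div]) code_two_five (by decide +kernel) (by decide +kernel)
    (by norm_num) (by decide +kernel)

theorem A_two_five : A 2 5 3 = 4 :=
  A_eq_of (by norm_num) (no_family_two_five) _ isESWC_code_two_five.1
    isESWC_code_two_five.2

def code_two_seven : List (List ℕ) :=
  [[0, 0, 0, 0, 1, 1, 1], [0, 0, 1, 1, 1, 0, 0], [1, 0, 0, 1, 0, 1, 0], [0, 1, 1, 0, 0, 1, 0],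
   [1, 0, 1, 0, 0, 0, 1], [0, 1, 0, 1, 0, 0, 1], [1, 1, 0, 0, 1, 0, 0]]

theorem isESWC_code_two_seven : IsESWC 2 7 4 (code_two_seven.map (toWord 7 2)).toFinset ∧
    (code_two_seven.map (toWord 7 2)).toFinset.card = 7 :=
  isESWC_of_list (a := 3) (b := 4) rfl
    (by rw [Nat.ceilDiv_eq_add_pred_div]) code_two_seven (by decide +kernel) (by decide +kernel)
    (by norm_num) (by decide +kernel)

theorem A_two_seven : A 2 7 4 = 7 :=
  A_eq_of (by norm_num) (no_binary_family (m := 4) (l := 3) rfl rfl rfl four_pos) _ isESWC_code_two_seven.1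
    isESWC_code_two_seven.2

def code_three_three : List (List ℕ) :=
  [[0, 1, 2], [0, 2, 1], [1, 0, 2], [1, 2, 0], [2, 0, 1], [2, 1, 0]]

theorem isESWC_code_three_three : IsESWC 3 3 2 (code_three_three.map (toWord 3 3)).toFinset ∧
    (code_three_three.map (toWord 3 3)).toFinset.card = 6 :=
  isESWC_of_list (a := 1) (b := 1) rfl
    (by rw [Nat.ceilDiv_eq_add_pred_div]) code_three_three (by decide +kernel) (by decide +kernel)
    (by norm_num) (by decide +kernel)

theorem A_three_three : A 3 3 2 = 6 :=
  A_eq_of (by norm_num) (no_family_three_three) _ isESWC_code_three_three.1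
    isESWC_code_three_three.2

def code_three_four : List (List ℕ) :=
  [[0, 0, 1, 2], [2, 1, 2, 0], [0, 2, 0, 1], [1, 0, 2, 1], [1, 1, 0, 2], [1, 2, 1, 0]]

theorem isESWC_code_three_four : IsESWC 3 4 3 (code_three_four.map (toWord 4 3)).toFinset ∧
    (code_three_four.map (toWord 4 3)).toFinset.card = 6 :=
  isESWC_of_list (a := 1) (b := 2) rfl
    (by rw [Nat.ceilDiv_eq_add_pred_div]) code_three_four (by decide +kernel) (by decide +kernel)
    (by norm_num) (by decide +kernel)

theorem A_three_four : A 3 4 3 = 6 :=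
  A_eq_of (by norm_num) (fun _ => no_family_succ_length le_rfl rfl) _ isESWC_code_three_four.1
    isESWC_code_three_four.2

def code_four_five : List (List ℕ) :=
  [[0, 0, 1, 2, 3], [2, 2, 0, 1, 3], [3, 0, 3, 1, 2], [2, 0, 2, 3, 1], [2, 3, 1, 0, 2],
   [0, 3, 2, 1, 0], [1, 2, 1, 3, 0], [1, 3, 0, 2, 1], [0, 2, 3, 0, 1], [1, 1, 2, 0, 3],
   [0, 1, 0, 3, 2], [2, 1, 3, 2, 0]]

theorem isESWC_code_four_five : IsESWC 4 5 4 (code_four_five.map (toWord 5 4)).toFinset ∧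
    (code_four_five.map (toWord 5 4)).toFinset.card = 12 :=
  isESWC_of_list (a := 1) (b := 2) rfl
    (by rw [Nat.ceilDiv_eq_add_pred_div]) code_four_five (by decide +kernel) (by decide +kernel)
    (by norm_num) (by decide +kernel)

theorem A_four_five : A 4 5 4 = 12 :=
  A_eq_of (by norm_num) (fun _ => no_family_succ_length (by norm_num) rfl) _ isESWC_code_four_five.1
    isESWC_code_four_five.2

def code_six_nine : List (List ℕ) :=
  [[4, 1, 4, 1, 3, 5, 0, 2, 2], [5, 5, 2, 3, 2, 4, 0, 1, 0], [0, 3, 3, 5, 4, 0, 1, 1, 2],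
   [3, 5, 0, 0, 1, 1, 2, 4, 2], [1, 4, 3, 2, 1, 2, 0, 0, 5], [4, 2, 5, 0, 0, 2, 3, 1, 1],
   [2, 4, 4, 0, 2, 3, 1, 5, 3], [5, 0, 5, 4, 1, 0, 4, 2, 3], [3, 3, 1, 1, 5, 2, 4, 5, 0],
   [2, 3, 2, 4, 3, 1, 5, 0, 1], [0, 0, 4, 2, 5, 4, 2, 3, 1], [5, 1, 1, 5, 0, 3, 2, 0, 4],
   [1, 2, 0, 1, 2, 0, 5, 3, 4], [2, 0, 1, 3, 4, 5, 3, 4, 5]]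

theorem isESWC_code_six_nine : IsESWC 6 9 8 (code_six_nine.map (toWord 9 6)).toFinset ∧
    (code_six_nine.map (toWord 9 6)).toFinset.card = 14 :=
  isESWC_of_list (a := 1) (b := 2) rfl
    (by rw [Nat.ceilDiv_eq_add_pred_div]) code_six_nine (by decide +kernel) (by decide +kernel)
    (by norm_num) (by decide +kernel)

theorem A_six_nine : A 6 9 8 = 14 :=
  A_eq_of (by norm_num) (no_family_six_nine) _ isESWC_code_six_nine.1
    isESWC_code_six_nine.2

def code_three_eleven : List (List ℕ) :=
  [[0, 0, 0, 0, 1, 1, 1, 1, 2, 2, 2], [1, 1, 2, 0, 0, 0, 2, 1, 1, 2, 0],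
   [2, 1, 0, 2, 1, 0, 2, 0, 2, 1, 1], [2, 0, 1, 1, 0, 0, 1, 2, 0, 2, 1],
   [0, 1, 1, 2, 0, 2, 0, 1, 0, 1, 2], [1, 0, 2, 1, 1, 2, 2, 0, 0, 0, 2],
   [1, 0, 0, 2, 2, 2, 1, 2, 1, 1, 0], [2, 2, 2, 0, 1, 1, 0, 2, 0, 1, 0],
   [0, 1, 1, 1, 2, 1, 2, 2, 2, 0, 0], [2, 2, 0, 1, 2, 0, 0, 1, 1, 0, 2],
   [0, 2, 2, 2, 0, 1, 1, 0, 1, 0, 1]]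

theorem isESWC_code_three_eleven : IsESWC 3 11 8 (code_three_eleven.map (toWord 11 3)).toFinset ∧
    (code_three_eleven.map (toWord 11 3)).toFinset.card = 11 :=
  isESWC_of_list (a := 3) (b := 4) rfl
    (by rw [Nat.ceilDiv_eq_add_pred_div]) code_three_eleven (by decide +kernel) (by decide +kernel)
    (by norm_num) (by decide +kernel)

def code_five_seven : List (List ℕ) :=
  [[2, 3, 0, 4, 1, 0, 1], [2, 0, 1, 1, 4, 3, 2], [2, 1, 4, 0, 3, 1, 4], [4, 0, 3, 0, 1, 2, 3],
   [1, 2, 4, 3, 1, 3, 0], [3, 4, 2, 0, 0, 3, 1], [0, 3, 1, 3, 0, 2, 4], [0, 2, 2, 4, 4, 1, 3],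
   [4, 3, 2, 1, 3, 4, 0], [4, 4, 0, 3, 2, 1, 2], [1, 1, 3, 4, 0, 4, 2], [1, 4, 1, 2, 3, 0, 3],
   [3, 1, 0, 2, 4, 2, 0], [3, 2, 3, 1, 2, 0, 4]]

theorem isESWC_code_five_seven : IsESWC 5 7 6 (code_five_seven.map (toWord 7 5)).toFinset ∧
    (code_five_seven.map (toWord 7 5)).toFinset.card = 14 :=
  isESWC_of_list (a := 1) (b := 2) rfl
    (by rw [Nat.ceilDiv_eq_add_pred_div]) code_five_seven (by decide +kernel) (by decide +kernel)
    (by norm_num) (by decide +kernel)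

/-! ### Ternary words of length 11 as hexadecimal numbers. -/

section Codes

theorem testBit_sum_two_pow (s : Finset ℕ) (j : ℕ) :
    (∑ i ∈ s, 2 ^ i).testBit j = true ↔ j ∈ s := by
  rw [← Nat.mem_bitIndices, ← List.mem_toFinset, Finset.toFinset_bitIndices_sum_two_pow]

theorem land_sum_two_pow (s t : Finset ℕ) :
    (∑ i ∈ s, 2 ^ i) &&& (∑ i ∈ t, 2 ^ i) = ∑ i ∈ s ∩ t, 2 ^ i := by
  refine Nat.eq_of_testBit_eq fun j => ?_
  rw [Nat.testBit_land, Bool.eq_iff_iff, Bool.and_eq_true]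
  simp only [testBit_sum_two_pow, mem_inter]

/-- The code of the partial word `f` on the set `S` of positions: the symbol `s` in position `i`
is represented by the hexadecimal digit number `11 s + i`. -/
def pcode (S : Finset ℕ) (f : ℕ → ℕ) : ℕ := ∑ i ∈ S, 16 ^ (11 * f i + i)

variable {S T : Finset ℕ} {f g : ℕ → ℕ}

theorem pcode_congr (h : ∀ i ∈ S, f i = g i) : pcode S f = pcode S g :=
  sum_congr rfl fun i hi => by rw [h i hi]

theorem pcode_eq_sum_two_pow (hS : S ⊆ range 11) :
    pcode S f = ∑ e ∈ S.image (fun i => 4 * (11 * f i + i)), 2 ^ e := by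
  rw [sum_image, pcode]
  · refine sum_congr rfl fun i _ => ?_
    rw [pow_mul]
    norm_num
  · intro i hi j hj hij
    have h1 := mem_range.1 (hS hi)
    have h2 := mem_range.1 (hS hj)
    simp only at hij
    omega

/-- Because positions are below 11, the digit number `11 s + i` determines both symbol and position,
and all digits are 0 or 1. Bitwise conjunction therefore keeps exactly the common entries. -/
theorem land_pcode (hS : S ⊆ range 11) (hT : T ⊆ range 11) :
    pcode S f &&& pcode T g = pcode ((S ∩ T).filter fun i => f i = g i) f := by
  rw [pcode_eq_sum_two_pow hS, pcode_eq_sum_two_pow hT, land_sum_two_pow, pcode_eq_sum_two_pow]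
  · refine sum_congr ?_ fun _ _ => rfl
    ext e
    simp only [mem_inter, mem_image, mem_filter]
    constructor
    · rintro ⟨⟨i, hi, rfl⟩, j, hj, hij⟩
      have h1 := mem_range.1 (hS hi)
      have h2 := mem_range.1 (hT hj)
      obtain rfl : j = i := by omega
      exact ⟨j, ⟨⟨hi, hj⟩, by omega⟩, rfl⟩
    · rintro ⟨i, ⟨⟨hi, hj⟩, hij⟩, rfl⟩
      exact ⟨⟨i, hi, rfl⟩, i, hj, by rw [hij]⟩
  · exact fun i hi => hS (mem_inter.1 (mem_filter.1 hi).1).1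

/-- Since `16 ≡ 1` modulo 15, the residue is the digit sum. Together with `land_pcode` this counts
agreements by a single conjunction and remainder. -/
theorem pcode_mod_fifteen (hS : S.card < 15) : pcode S f % 15 = S.card := by
  have : pcode S f ≡ S.card [MOD 15] := by
    rw [pcode, card_eq_sum_ones]
    have : ∀ T : Finset ℕ, ∑ i ∈ T, 16 ^ (11 * f i + i) ≡ ∑ i ∈ T, 1 [MOD 15] := by
      intro T
      induction T using Finset.induction_on with
      | empty => rfl
      | insert a T ha ih =>
        rw [sum_insert ha, sum_insert ha]
        refine Nat.ModEq.add ?_ ih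
        have h16 : 16 ≡ 1 [MOD 15] := rfl
        simpa using h16.pow (11 * f a + a)
    exact this S
  have h := this
  rw [Nat.ModEq, Nat.mod_eq_of_lt hS] at h
  exact h

theorem pcode_mul (t : ℕ) : pcode S f * 16 ^ (11 * t) = pcode S fun i => f i + t := by
  rw [pcode, pcode, sum_mul]
  exact sum_congr rfl fun i _ => by rw [← pow_add]; ring_nf

theorem pcode_shift : pcode S f * 16 = pcode (S.image (· + 1)) fun i => f (i - 1) := by
  rw [pcode, pcode, sum_mul, sum_image (fun i _ j _ hij => by simpa using hij)]
  exact sum_congr rfl fun i _ => by rw [← pow_succ, add_assoc]; simp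

theorem pcode_range_succ (n : ℕ) :
    pcode (range (n + 1)) f = pcode (range n) f + 16 ^ n * 16 ^ (11 * f n) := by
  rw [pcode, pcode, sum_range_succ, ← pow_add, add_comm n]

/-- The digits of a number. -/
theorem digit_sum (n : ℕ → ℕ) (hn : ∀ e, n e < 16) {e N : ℕ} (he : e < N) :
    (∑ k ∈ range N, n k * 16 ^ k) / 16 ^ e % 16 = n e := by
  have hlt : ∀ e, ∑ k ∈ range e, n k * 16 ^ k < 16 ^ e := by
    intro e
    induction e with
    | zero => simp
    | succ e ih =>
      rw [sum_range_succ, pow_succ]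
      have := Nat.mul_le_mul_right (16 ^ e) (Nat.le_of_lt_succ (hn e))
      omega
  obtain ⟨d, rfl⟩ : ∃ d, N = e + 1 + d := ⟨N - (e + 1), by omega⟩
  rw [sum_range_add, sum_range_succ]
  have h2 : ∑ k ∈ range d, n (e + 1 + k) * 16 ^ (e + 1 + k) =
      16 ^ e * (16 * ∑ k ∈ range d, n (e + 1 + k) * 16 ^ k) := by
    rw [mul_sum, mul_sum]
    refine sum_congr rfl fun k _ => ?_
    rw [pow_add, pow_succ]
    ring
  have h3 : ∑ k ∈ range e, n k * 16 ^ k + n e * 16 ^ e +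
      ∑ k ∈ range d, n (e + 1 + k) * 16 ^ (e + 1 + k) = ∑ k ∈ range e, n k * 16 ^ k +
      16 ^ e * (n e + 16 * ∑ k ∈ range d, n (e + 1 + k) * 16 ^ k) := by
    rw [h2]
    ring
  rw [h3, Nat.add_mul_div_left _ _ (by positivity), Nat.div_eq_of_lt (hlt e), zero_add,
    Nat.add_mul_mod_self_left, Nat.mod_eq_of_lt (hn e)]

theorem pcode_eq_sum_range (hf : ∀ i, f i < 3) : pcode (range 11) f =
    ∑ e ∈ range 33, (if f (e % 11) = e / 11 then 1 else 0) * 16 ^ e := by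
  have h : (range 33).filter (fun e => f (e % 11) = e / 11) =
      (range 11).image fun i => 11 * f i + i := by
    ext e
    simp only [mem_filter, mem_range, mem_image]
    constructor
    · rintro ⟨h1, h2⟩
      exact ⟨e % 11, by omega, by omega⟩
    · rintro ⟨i, hi, rfl⟩
      have := hf i
      rw [show (11 * f i + i) % 11 = i by omega]
      omega
  simp only [ite_mul, one_mul, zero_mul]
  rw [← sum_filter, h, sum_image, pcode]
  intro i hi j hj hij
  simp only [coe_range, Set.mem_Iio] at hi hj
  simp only at hij
  omega

/-- With fewer than 16 words there are no carries, so the digits of the sum of the codes are the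
column counts. -/
theorem digit_sum_pcode {ι : Type*} (A : Finset ι) (hA : A.card < 16) (w : ι → ℕ → ℕ)
    (hw : ∀ k i, w k i < 3) {i s : ℕ} (hi : i < 11) (hs : s < 3) :
    (∑ k ∈ A, pcode (range 11) (w k)) / 16 ^ (11 * s + i) % 16 =
      (A.filter fun k => w k i = s).card := by
  simp only [pcode_eq_sum_range (hw _)]
  rw [sum_comm]
  simp only [← sum_mul]
  rw [digit_sum _ _ (show 11 * s + i < 33 by omega)]
  · rw [card_filter, show (11 * s + i) / 11 = s by omega, show (11 * s + i) % 11 = i by omega]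
  · intro e
    rw [← card_filter]
    exact lt_of_le_of_lt (card_filter_le _ _) hA

end Codes

/-! ### Exhaustive completion of a partial family. -/

section Search

theorem beq_iff {a b : ℕ} : Nat.beq a b = true ↔ a = b := Nat.beq_eq.to_iff

theorem ble_iff {a b : ℕ} : Nat.ble a b = true ↔ a ≤ b := Nat.ble_eq.to_iff

/-- The identity function. It keeps the evaluation of long recursions from nesting too deeply. -/
def delay {α : Type} (a : α) : α := a

/-- `List.filter`, as a plain recursion. -/
noncomputable def sift (p : ℕ → Bool) (l : List ℕ) : List ℕ :=
  List.rec (motive := fun _ => List ℕ) []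
    (fun y _ ih => Bool.rec (delay ih) (y :: ih) (p y)) l

theorem sift_eq_filter (p : ℕ → Bool) (l : List ℕ) : sift p l = l.filter p := by
  induction l with
  | nil => rfl
  | cons y l ih =>
    have : sift p (y :: l) = Bool.rec (sift p l) (y :: sift p l) (p y) := rfl
    rw [this, ih, List.filter_cons]
    cases p y <;> rfl

theorem mem_sift {p : ℕ → Bool} {l : List ℕ} {y : ℕ} : y ∈ sift p l ↔ y ∈ l ∧ p y = true := by
  rw [sift_eq_filter, List.mem_filter]

/-- The number of agreements of two words, given by their codes. -/
def agr (x y : ℕ) : ℕ := Nat.mod (Nat.land x y) (nat_lit 15)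

/-- The codes in `l` of words that agree with the word with code `x` in three positions. -/
noncomputable def keep (x : ℕ) (l : List ℕ) : List ℕ :=
  List.rec (motive := fun _ => List ℕ) [] (fun y _ ih => Bool.rec (delay ih) (y :: ih)
    (Nat.beq (Nat.mod (Nat.land x y) (nat_lit 15)) (nat_lit 3))) l

theorem mem_keep {x y : ℕ} {l : List ℕ} : y ∈ keep x l ↔ y ∈ l ∧ agr x y = 3 := by
  have : keep x l = sift (fun y => Nat.beq (agr x y) 3) l := rfl
  rw [this, mem_sift, beq_iff]

noncomputable def keepAll (cs l : List ℕ) : List ℕ :=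
  List.rec (motive := fun _ => List ℕ) l (fun x _ ih => keep x ih) cs

theorem mem_keepAll {cs l : List ℕ} {y : ℕ} (hy : y ∈ l) (h : ∀ x ∈ cs, agr x y = 3) :
    y ∈ keepAll cs l := by
  induction cs with
  | nil => exact hy
  | cons x cs ih =>
    exact mem_keep.2 ⟨ih fun z hz => h z (List.mem_cons_of_mem _ hz), h x List.mem_cons_self⟩

/-- Tries all ways to add `n` codes from the third argument to the chosen ones. -/
noncomputable def addWords (k : List ℕ → ℕ → Bool) (n : ℕ) : List ℕ → List ℕ → ℕ → Bool :=
  Nat.rec (motive := fun _ => List ℕ → List ℕ → ℕ → Bool)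
    (fun _ cs acc => k cs acc)
    (fun _ f ins cs acc => List.rec (motive := fun _ => Bool) true
      (fun y tl ih => Bool.rec false (delay ih)
        (f (keep y tl) (y :: cs) (Nat.add acc y))) ins) n

/-- Refutes the existence of a completion of a partial family: `B` lists the digits that have to
occur four times with the candidates for them, `cs` are the codes chosen so far, and `acc` is the
sum of all codes. -/
noncomputable def refute (B : List (ℕ × List ℕ)) : List ℕ → ℕ → Bool :=
  List.rec (motive := fun _ => List ℕ → ℕ → Bool) (fun _ _ => false)
    (fun mb _ ih cs acc =>
      Bool.rec true
       (addWords ih (Nat.sub (nat_lit 4) (Nat.mod (Nat.div acc mb.1) (nat_lit 16)))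
         (keepAll cs mb.2) cs acc)
       (Nat.ble (Nat.mod (Nat.div acc mb.1) (nat_lit 16)) (nat_lit 4))) B

noncomputable def buckets (bs : List ℕ) : List ℕ → List (ℕ × List ℕ) :=
  List.rec (motive := fun _ => List ℕ → List (ℕ × List ℕ)) (fun _ => [])
    (fun m _ ih C => (m, sift (fun y => Bool.not (Nat.beq (Nat.land y m) (nat_lit 0))) C) ::
      ih (sift (fun y => Nat.beq (Nat.land y m) (nat_lit 0)) C)) bs

variable {M : ℕ} {x : Fin M → ℕ}

/-- The value `true` means that all choices were refuted by `k`, in particular the choice of the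
actual words `D`. Follow that branch: take a list entry if it is the code of a word of `D`, and skip
it otherwise. -/
theorem addWords_spec (hx : ∀ j k, agr (x j) (x k) = 3 ↔ j ≠ k) {k : List ℕ → ℕ → Bool} :
    ∀ {n : ℕ} {ins cs : List ℕ} {acc : ℕ} (D : Finset (Fin M)), D.card = n →
      (∀ d ∈ D, x d ∈ ins) → addWords k n ins cs acc = true →
      ∃ cs', (∀ y ∈ cs', y ∈ cs ∨ ∃ d ∈ D, y = x d) ∧ k cs' (acc + ∑ d ∈ D, x d) = true := by
  intro n
  induction n with
  | zero =>
    intro ins cs acc D hD _ h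
    rw [card_eq_zero] at hD
    subst hD
    exact ⟨cs, fun y hy => Or.inl hy, by rw [sum_empty, add_zero]; exact h⟩
  | succ n ih =>
    intro ins
    induction ins with
    | nil =>
      intro cs acc D hD hmem _
      obtain ⟨d, hd⟩ := card_pos.1 (lt_of_lt_of_eq n.succ_pos hD.symm)
      simpa using hmem d hd
    | cons y tl ihl =>
      intro cs acc D hD hmem h
      have heq : addWords k (n + 1) (y :: tl) cs acc = Bool.rec false
          (addWords k (n + 1) tl cs acc) (addWords k n
            (keep y tl) (y :: cs) (acc + y)) := rfl
      rw [heq] at h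
      have h1 : addWords k n
          (keep y tl) (y :: cs) (acc + y) = true := by
        revert h
        cases addWords k n
          (keep y tl) (y :: cs) (acc + y)
        · intro h
          exact h
        · intro _
          rfl
      rw [h1] at h
      change addWords k (n + 1) tl cs acc = true at h
      by_cases hy : ∃ d ∈ D, x d = y
      · obtain ⟨d, hd, rfl⟩ := hy
        obtain ⟨cs', hcs', hk⟩ := ih (D.erase d) (by rw [card_erase_of_mem hd, hD]; rfl) (by
          intro e he
          have hne := ne_of_mem_erase he
          refine mem_keep.2 ⟨?_, (hx d e).2 hne.symm⟩
          -- By `hx` no word agrees with itself three times, so different words have different codes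
          -- and the remaining ones lie in the tail.
          rcases List.mem_cons.1 (hmem e (mem_of_mem_erase he)) with h' | h'
          · exfalso
            have h3 := (hx d e).2 hne.symm
            rw [h'] at h3
            exact (hx d d).1 h3 rfl
          · exact h') h1
        refine ⟨cs', ?_, ?_⟩
        · intro z hz
          rcases hcs' z hz with h' | ⟨e, he, rfl⟩
          · rcases List.mem_cons.1 h' with rfl | h'
            · exact Or.inr ⟨d, hd, rfl⟩
            · exact Or.inl h'
          · exact Or.inr ⟨e, mem_of_mem_erase he, rfl⟩
        · rw [← add_sum_erase D _ hd, ← add_assoc]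
          exact hk
      · push Not at hy
        refine ihl D hD (fun d hd => ?_) h
        rcases List.mem_cons.1 (hmem d hd) with h' | h'
        · exact absurd h' (hy d hd)
        · exact h'

/-- The codes of the words in `R` occur among the candidates in `B`. -/
def Covers (x : Fin M → ℕ) : List (ℕ × List ℕ) → Finset (Fin M) → Prop
  | [], _ => True
  | mb :: B, R => (∀ k ∈ R, Nat.land (x k) mb.1 ≠ 0 → x k ∈ mb.2) ∧
      Covers x B (R.filter fun k => Nat.land (x k) mb.1 = 0)

theorem covers_buckets (bs : List ℕ) : ∀ (C : List ℕ) (R : Finset (Fin M)),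
    (∀ k ∈ R, x k ∈ C) → Covers x (buckets bs C) R := by
  induction bs with
  | nil => exact fun _ _ _ => trivial
  | cons m bs ih =>
    intro C R h
    refine ⟨fun k hk hm => mem_sift.2 ⟨h k hk, ?_⟩, ih _ _ fun k hk => mem_sift.2 ⟨?_, ?_⟩⟩
    · have : Nat.beq (Nat.land (x k) m) 0 = false := by
        rw [← Bool.not_eq_true, beq_iff]
        exact hm
      rw [this]
      rfl
    · exact h k (mem_filter.1 hk).1
    · exact beq_iff.2 (mem_filter.1 hk).2

/-- Soundness of the search. `R` holds the words not yet chosen. By the balance hypothesis, the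
number of them containing the current digit is 4 minus that digit of the accumulated sum, which is
exactly the number of words that the search adds; so an existing family survives every stage. -/
theorem refute_spec (hx : ∀ j k, agr (x j) (x k) = 3 ↔ j ≠ k) :
    ∀ (B : List (ℕ × List ℕ)),
      (∀ mb ∈ B, ∀ A : Finset (Fin M), (∑ k ∈ A, x k) / mb.1 % 16 +
        (Aᶜ.filter fun k => Nat.land (x k) mb.1 ≠ 0).card = 4) →
      ∀ (R : Finset (Fin M)) (cs : List ℕ), Covers x B R →
      (∀ k ∈ R, ∀ y ∈ cs, agr y (x k) = 3) → refute B cs (∑ k ∈ Rᶜ, x k) = false := by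
  intro B
  induction B with
  | nil => exact fun _ _ _ _ _ => rfl
  | cons mb B ih =>
    intro hB R cs hR hcs
    set acc := ∑ k ∈ Rᶜ, x k with hacc
    set D := R.filter fun k => Nat.land (x k) mb.1 ≠ 0 with hD
    have heq : refute (mb :: B) cs acc = Bool.rec true
       (addWords (refute B) (4 - (acc / mb.1) % 16) (keepAll cs mb.2) cs acc)
       (Nat.ble ((acc / mb.1) % 16) 4) := rfl
    have h4 := hB mb List.mem_cons_self Rᶜ
    rw [compl_compl, ← hacc] at h4
    have hble : Nat.ble ((acc / mb.1) % 16) 4 = true := ble_iff.2 (by omega)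
    rw [heq, hble]
    change addWords (refute B) (4 - (acc / mb.1) % 16) (keepAll cs mb.2) cs acc = false
    rw [← Bool.not_eq_true]
    intro h
    obtain ⟨cs', hcs', hk⟩ := addWords_spec hx D (by rw [hD]; omega) (fun d hd => by
      have hd' := mem_filter.1 hd
      exact mem_keepAll (hR.1 d hd'.1 hd'.2) (hcs d hd'.1)) h
    have hsum : acc + ∑ d ∈ D, x d =
        ∑ k ∈ (R.filter fun k => Nat.land (x k) mb.1 = 0)ᶜ, x k := by
      rw [hacc, hD, ← sum_union]
      · refine sum_congr ?_ fun _ _ => rfl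
        ext k
        simp only [mem_union, mem_compl, mem_filter, not_and]
        tauto
      · rw [Finset.disjoint_left]
        intro k hk hk'
        exact (mem_compl.1 hk) (mem_filter.1 hk').1
    rw [hsum, ih (fun mb' h => hB mb' (List.mem_cons_of_mem _ h)) _ cs' hR.2] at hk
    · exact absurd hk Bool.false_ne_true
    · intro k hk y hy
      have hk' := mem_filter.1 hk
      rcases hcs' y hy with h' | ⟨d, hd, rfl⟩
      · exact hcs k hk'.1 y h'
      · refine (hx d k).2 ?_
        rintro rfl
        exact (mem_filter.1 hd).2 hk'.2

end Search

/-! ### The search for a given pair of words of length 11. -/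

section TypeCheck

/-- Evaluates the number `n` before passing it on. -/
noncomputable def force (n : ℕ) (k : ℕ → Bool) : Bool :=
  Nat.rec (motive := fun _ => Bool) (k (nat_lit 0)) (fun m _ => k m) (Nat.add n (nat_lit 1))

theorem force_eq (n : ℕ) (k : ℕ → Bool) : force n k = k n := (rfl)

/-- Written with a continuation so that `z` is evaluated to a numeral before it is tested and
stored. -/
noncomputable def push (ok : ℕ → Bool) (z : ℕ) (acc : List ℕ) (k : List ℕ → Bool) : Bool :=
  force z fun z => Bool.rec (k acc) (k (z :: acc)) (ok z)

noncomputable def extend (ok : ℕ → Bool) (a : ℕ) (L : List ℕ) :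
    List ℕ → (List ℕ → Bool) → Bool :=
  List.rec (motive := fun _ => List ℕ → (List ℕ → Bool) → Bool) (fun acc k => k acc)
    (fun y _ ih acc k => push ok (Nat.add y a) acc fun acc =>
      -- The factors are `16 ^ 11` and `16 ^ 22`; they move the digit of symbol 0 to those of
      -- symbols 1 and 2.
      push ok (Nat.add y (Nat.mul a (nat_lit 17592186044416))) acc fun acc =>
        push ok (Nat.add y (Nat.mul a (nat_lit 309485009821345068724781056))) acc fun acc => ih acc k) L

/-- Extends the partial words with codes in `L` by further positions, as long as they satisfy
`ok`. -/
noncomputable def generate (ok : ℕ → Bool) (cols : List ℕ) :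
    List ℕ → (List ℕ → Bool) → Bool :=
  List.rec (motive := fun _ => List ℕ → (List ℕ → Bool) → Bool) (fun L k => k L)
    (fun a _ ih L k => extend ok a L [] fun L' => ih L' k) cols

theorem push_spec (ok : ℕ → Bool) (z : ℕ) (acc : List ℕ) : ∃ L',
    (∀ k, push ok z acc k = k L') ∧ (∀ y ∈ acc, y ∈ L') ∧ (ok z = true → z ∈ L') := by
  by_cases h : ok z = true
  · refine ⟨z :: acc, fun k => ?_, fun y hy => List.mem_cons_of_mem _ hy,
      fun _ => List.mem_cons_self⟩
    rw [push, force_eq, h]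
  · refine ⟨acc, fun k => ?_, fun y hy => hy, fun h' => absurd h' h⟩
    rw [push, force_eq, Bool.eq_false_iff.2 h]

theorem extend_spec (ok : ℕ → Bool) (a : ℕ) (L : List ℕ) : ∀ acc : List ℕ, ∃ L',
    (∀ k, extend ok a L acc k = k L') ∧ (∀ y ∈ acc, y ∈ L') ∧
      ∀ y ∈ L, ∀ s < 3, ok (y + a * 16 ^ (11 * s)) = true → y + a * 16 ^ (11 * s) ∈ L' := by
  induction L with
  | nil => exact fun acc => ⟨acc, fun _ => rfl, fun _ h => h, by simp⟩
  | cons x L ih =>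
    intro acc
    obtain ⟨L1, h1, h1', h1''⟩ := push_spec ok (x + a) acc
    obtain ⟨L2, h2, h2', h2''⟩ := push_spec ok (x + a * 17592186044416) L1
    obtain ⟨L3, h3, h3', h3''⟩ := push_spec ok (x + a * 309485009821345068724781056) L2
    obtain ⟨L', h4, h4', h4''⟩ := ih L3
    refine ⟨L', fun k => ?_, fun y hy => h4' y (h3' y (h2' y (h1' y hy))), ?_⟩
    · have : extend ok a (x :: L) acc k = push ok (x + a) acc fun acc =>
        push ok (x + a * 17592186044416) acc fun acc =>
          push ok (x + a * 309485009821345068724781056) acc fun acc => extend ok a L acc k := rfl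
      rw [this, h1, h2, h3, h4]
    · intro y hy s hs hok
      rcases List.mem_cons.1 hy with rfl | hy
      · interval_cases s
        · simp only [mul_zero, pow_zero, mul_one] at hok ⊢
          exact h4' _ (h3' _ (h2' _ (h1'' hok)))
        · exact h4' _ (h3' _ (h2'' hok))
        · exact h4' _ (h3'' hok)
      · exact h4'' y hy s hs hok

/-- The continuation receives one list, independent of it, which contains every word that starts in
`L` and whose prefixes all pass `ok`. -/
theorem generate_spec (ok : ℕ → Bool) (n : ℕ) : ∀ (j : ℕ) (L : List ℕ), ∃ L',
    (∀ k, generate ok ((List.range' j n).map fun i => 16 ^ i) L k = k L') ∧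
      ∀ f : ℕ → ℕ, (∀ i, f i < 3) → (∀ i ≤ j + n, ok (pcode (range i) f) = true) →
        pcode (range j) f ∈ L → pcode (range (j + n)) f ∈ L' := by
  induction n with
  | zero => exact fun j L => ⟨L, fun _ => rfl, fun f _ _ h => h⟩
  | succ n ih =>
    intro j L
    obtain ⟨L1, h1, -, h1'⟩ := extend_spec ok (16 ^ j) L []
    obtain ⟨L', h2, h2'⟩ := ih (j + 1) L1
    refine ⟨L', fun k => ?_, fun f hf hok hL => ?_⟩
    · have : generate ok ((List.range' j (n + 1)).map fun i => 16 ^ i) L k =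
        extend ok (16 ^ j) L [] fun L' =>
          generate ok ((List.range' (j + 1) n).map fun i => 16 ^ i) L' k := rfl
      rw [this, h1, h2]
    · have h3 := h1' _ hL (f j) (hf j)
      rw [← pcode_range_succ] at h3
      have h4 := h2' f hf (fun i hi => hok i (by omega)) (h3 (hok _ (by omega)))
      rwa [add_right_comm, add_assoc] at h4

noncomputable def cnt (x y : ℕ) : ℕ := Nat.mod (Nat.land x y) (nat_lit 15)

/-- The mask selects the eleven digits of symbol 0, and the factor `16 ^ 22` moves them to the
digits of symbol 2. `ind1` and `ind2` use the same target digits, so that position sets of different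
symbols can be intersected. -/
noncomputable def ind0 (x : ℕ) : ℕ :=
  Nat.mul (Nat.land x (nat_lit 1172812402961)) (nat_lit 309485009821345068724781056)

noncomputable def ind1 (x : ℕ) : ℕ :=
  Nat.mul (Nat.land x (nat_lit 20632333988088498435915776)) (nat_lit 17592186044416)

noncomputable def ind2 (x : ℕ) : ℕ :=
  Nat.land x (nat_lit 362967858048980395360278158255971106816)

noncomputable def sqcnt (x y : ℕ) : ℕ := Nat.pow (cnt x y) (nat_lit 2)

/-- The sum of the squares of the numbers of positions in which the words with codes `x` and `y`
have two given symbols. -/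
noncomputable def weight (x y : ℕ) : ℕ :=
  Nat.add (Nat.add (Nat.add (sqcnt (ind0 x) (ind0 y))
    (Nat.add (sqcnt (ind0 x) (ind1 y)) (sqcnt (ind0 x) (ind2 y))))
    (Nat.add (sqcnt (ind1 x) (ind0 y))
      (Nat.add (sqcnt (ind1 x) (ind1 y)) (sqcnt (ind1 x) (ind2 y)))))
    (Nat.add (sqcnt (ind2 x) (ind0 y))
      (Nat.add (sqcnt (ind2 x) (ind1 y)) (sqcnt (ind2 x) (ind2 y))))

/-- Packs the numbers of symbols 0 and 1 of `x` in each cell. It does not depend on the order of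
positions inside a cell and serves to order the third and fourth word of a group. -/
noncomputable def key (cl : List ℕ) (x : ℕ) : ℕ :=
  List.rec (motive := fun _ => ℕ) (nat_lit 0) (fun c _ ih => Nat.add (Nat.mul ih (nat_lit 256))
    (Nat.add (Nat.mul (cnt c (ind0 x)) (nat_lit 16)) (cnt c (ind1 x)))) cl

/-- Multiplication by 16 moves position `i` to `i + 1`: no neighbours `i`, `i + 1` of the cell `c`
may have `i` in `x` and `i + 1` in `y`. -/
noncomputable def sortedIn (c x y : ℕ) : Bool :=
  Nat.beq (Nat.land (Nat.land (Nat.mul x (nat_lit 16)) y)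
    (Nat.land (Nat.mul c (nat_lit 16)) c)) (nat_lit 0)

/-- Whether the word with code `x` is monotone on the cells in `cl`. -/
noncomputable def sorted (cl : List ℕ) (x : ℕ) : Bool :=
  List.rec (motive := fun _ => Bool) true
    (fun c _ ih => sortedIn c (ind1 x) (ind0 x) && (sortedIn c (ind2 x) (ind0 x) &&
      (sortedIn c (ind2 x) (ind1 x) && ih))) cl

def digitPowers : List ℕ :=
  [nat_lit 1, nat_lit 16, nat_lit 256, nat_lit 4096, nat_lit 65536, nat_lit 1048576,
   nat_lit 16777216, nat_lit 268435456, nat_lit 4294967296, nat_lit 68719476736,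
   nat_lit 1099511627776, nat_lit 17592186044416, nat_lit 281474976710656,
   nat_lit 4503599627370496, nat_lit 72057594037927936, nat_lit 1152921504606846976,
   nat_lit 18446744073709551616, nat_lit 295147905179352825856, nat_lit 4722366482869645213696,
   nat_lit 75557863725914323419136, nat_lit 1208925819614629174706176,
   nat_lit 19342813113834066795298816, nat_lit 309485009821345068724781056,
   nat_lit 4951760157141521099596496896, nat_lit 79228162514264337593543950336,
   nat_lit 1267650600228229401496703205376, nat_lit 20282409603651670423947251286016,
   nat_lit 324518553658426726783156020576256, nat_lit 5192296858534827628530496329220096,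
   nat_lit 83076749736557242056487941267521536, nat_lit 1329227995784915872903807060280344576,
   nat_lit 21267647932558653966460912964485513216,
   nat_lit 340282366920938463463374607431768211456]

theorem digitPowers_eq : digitPowers = (List.range 33).map fun e => 16 ^ e := by decide +kernel

/-- Digits that occur most often among the three words summed in `acc` come first, since they need
the fewest further words. The order matters only for the size of the search. -/
noncomputable def blockOrder (acc : ℕ) : List ℕ :=
  let occ (n m : ℕ) : Bool := Nat.beq (Nat.mod (Nat.div acc m) (nat_lit 16)) n
  sift (occ (nat_lit 3)) digitPowers ++ (sift (occ (nat_lit 2)) digitPowers ++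
    (sift (occ (nat_lit 1)) digitPowers ++ sift (occ (nat_lit 0)) digitPowers))

/-- At most three agreements with `u` and with `v`, and at most four occurrences of each symbol:
conditions that every prefix of an admissible word inherits. -/
noncomputable def okPartial (u v z : ℕ) : Bool :=
  Bool.rec false (Bool.rec false (Bool.rec false (Bool.rec false
    (Nat.ble (Nat.mod (Nat.land z (nat_lit 362967858048980395360278158255971106816))
      (nat_lit 15)) (nat_lit 4))
    (Nat.ble (Nat.mod (Nat.land z (nat_lit 20632333988088498435915776)) (nat_lit 15)) (nat_lit 4)))
    (Nat.ble (Nat.mod (Nat.land z (nat_lit 1172812402961)) (nat_lit 15)) (nat_lit 4)))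
    (Nat.ble (Nat.mod (Nat.land v z) (nat_lit 15)) (nat_lit 3)))
    (Nat.ble (Nat.mod (Nat.land u z) (nat_lit 15)) (nat_lit 3))

def columnPowers : List ℕ :=
  [nat_lit 1, nat_lit 16, nat_lit 256, nat_lit 4096, nat_lit 65536, nat_lit 1048576,
   nat_lit 16777216, nat_lit 268435456, nat_lit 4294967296, nat_lit 68719476736,
   nat_lit 1099511627776]

theorem columnPowers_eq : columnPowers = (List.range' 0 11).map fun i => 16 ^ i := by
  decide +kernel

/-- The words in which the symbol `2` occurs three times. -/
noncomputable def inGroup (z : ℕ) : Bool :=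
  Nat.beq (Nat.mod (Nat.land z (nat_lit 362967858048980395360278158255971106816)) (nat_lit 15))
    (nat_lit 3)

noncomputable def outside (u v z : ℕ) : Bool :=
  Bool.rec (Bool.rec false (Nat.beq (agr v z) (nat_lit 3)) (Nat.beq (agr u z) (nat_lit 3))) false
    (inGroup z)

noncomputable def inside (u v W z : ℕ) : Bool :=
  Bool.rec false (Bool.rec false (Bool.rec false (Bool.rec false
    (Nat.ble (weight v z) W) (Nat.ble (weight u z) W)) (Nat.beq (agr v z) (nat_lit 3)))
    (Nat.beq (agr u z) (nat_lit 3))) (inGroup z)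

noncomputable def candidate (cl : List ℕ) (W x kx y : ℕ) : Bool :=
  Bool.rec false (Bool.rec false (Nat.ble (weight x y) W) (Nat.ble kx (key cl y)))
    (Nat.beq (agr x y) (nat_lit 3))

noncomputable def checkList (p : ℕ → Bool) (U : List ℕ) : Bool :=
  List.rec (motive := fun _ => Bool) true (fun x _ ih => Bool.rec false (delay ih) (p x)) U

/-- `x` is the third word of the group, needed only in sorted form, and `y` the fourth. All other
words lie outside the group and come from `O`. -/
noncomputable def checkWord (cl : List ℕ) (W uv : ℕ) (I O : List ℕ) (x : ℕ) : Bool :=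
  Bool.rec true
    (force (Nat.add uv x) fun acc => force (key cl x) fun kx =>
      checkList (fun y => refute (buckets (blockOrder acc) (keep x O)) [y] (Nat.add acc y))
        (sift (candidate cl W x kx) I)) (sorted cl x)

noncomputable def checkAll (cl : List ℕ) (W uv : ℕ) (I O : List ℕ) : Bool :=
  checkList (checkWord cl W uv I O) I

/-- The codes of the sets of positions in which the words with codes `u` and `v` have two given
symbols. -/
noncomputable def cellCodes (u v : ℕ) : List ℕ :=
  [Nat.land (ind0 u) (ind0 v), Nat.land (ind0 u) (ind1 v), Nat.land (ind0 u) (ind2 v),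
    Nat.land (ind1 u) (ind0 v), Nat.land (ind1 u) (ind1 v), Nat.land (ind1 u) (ind2 v),
    Nat.land (ind2 u) (ind0 v), Nat.land (ind2 u) (ind1 v), Nat.land (ind2 u) (ind2 v)]

/-- Refutes the existence of a family containing the words with codes `u` and `v` and two further
words of the same group. -/
noncomputable def checkPair (u v W : ℕ) : Bool :=
  force (Nat.land (ind0 u) (ind0 v)) fun c00 =>
  force (Nat.land (ind0 u) (ind1 v)) fun c01 =>
  force (Nat.land (ind0 u) (ind2 v)) fun c02 =>
  force (Nat.land (ind1 u) (ind0 v)) fun c10 =>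
  force (Nat.land (ind1 u) (ind1 v)) fun c11 =>
  force (Nat.land (ind1 u) (ind2 v)) fun c12 =>
  force (Nat.land (ind2 u) (ind0 v)) fun c20 =>
  force (Nat.land (ind2 u) (ind1 v)) fun c21 =>
  force (Nat.land (ind2 u) (ind2 v)) fun c22 =>
  generate (okPartial u v) columnPowers [nat_lit 0] fun L =>
    checkAll [c00, c01, c02, c10, c11, c12, c20, c21, c22] W (Nat.add u v) (sift (inside u v W) L)
      (sift (outside u v) L)

theorem checkPair_eq (u v W : ℕ) : checkPair u v W =
    generate (okPartial u v) columnPowers [nat_lit 0] fun L => checkAll (cellCodes u v) W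
      (Nat.add u v) (sift (inside u v W) L) (sift (outside u v) L) := by
  rw [checkPair, force_eq, force_eq, force_eq, force_eq, force_eq, force_eq, force_eq, force_eq,
    force_eq, cellCodes]

end TypeCheck

/-! ### Soundness of the search for length 11. -/

section Soundness

theorem agr_pcode {S T : Finset ℕ} {f g : ℕ → ℕ} (hS : S ⊆ range 11) (hT : T ⊆ range 11) :
    agr (pcode S f) (pcode T g) = ((S ∩ T).filter fun i => f i = g i).card := by
  have h : agr (pcode S f) (pcode T g) = (pcode S f &&& pcode T g) % 15 := rfl
  rw [h, land_pcode hS hT, pcode_mod_fifteen]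
  have h1 : (S ∩ T).filter (fun i => f i = g i) ⊆ range 11 :=
    (filter_subset _ _).trans (inter_subset_left.trans hS)
  have h2 := card_le_card h1
  rw [card_range] at h2
  omega

theorem pcode_const_zero : pcode (range 11) (fun _ => 0) = 1172812402961 := by decide +kernel

theorem pcode_const_one : pcode (range 11) (fun _ => 1) = 20632333988088498435915776 := by
  decide +kernel

theorem pcode_const_two :
    pcode (range 11) (fun _ => 2) = 362967858048980395360278158255971106816 := by decide +kernel

theorem okPartial_pcode {f g h : ℕ → ℕ} {n : ℕ} (hn : n ≤ 11)
    (hg : ((range 11).filter fun i => g i = f i).card ≤ 3)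
    (hh : ((range 11).filter fun i => h i = f i).card ≤ 3)
    (hf : ∀ s < 3, ((range 11).filter fun i => f i = s).card ≤ 4) :
    okPartial (pcode (range 11) g) (pcode (range 11) h) (pcode (range n) f) = true := by
  have hsub : range n ⊆ range 11 := range_subset_range.2 hn
  have key : ∀ g' : ℕ → ℕ, ∀ m, ((range 11).filter fun i => g' i = f i).card ≤ m →
      Nat.ble (agr (pcode (range 11) g') (pcode (range n) f)) m = true := by
    intro g' m hm
    rw [ble_iff, agr_pcode (Subset.refl _) hsub]
    exact (card_le_card (filter_subset_filter _ inter_subset_left)).trans hm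
  have key' : ∀ s < 3, Nat.ble (agr (pcode (range n) f) (pcode (range 11) fun _ => s)) 4 =
      true := by
    intro s hs
    rw [ble_iff, agr_pcode hsub (Subset.refl _)]
    exact (card_le_card (filter_subset_filter _ inter_subset_right)).trans (hf s hs)
  have h0 := key' 0 (by norm_num)
  have h1 := key' 1 (by norm_num)
  have h2 := key' 2 (by norm_num)
  rw [pcode_const_zero] at h0
  rw [pcode_const_one] at h1
  rw [pcode_const_two] at h2
  have h3 := key g 3 hg
  have h4 := key h 3 hh
  unfold agr at h0 h1 h2 h3 h4
  unfold okPartial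
  rw [h0, h1, h2, h3, h4]

theorem checkList_mem {p : ℕ → Bool} {U : List ℕ} (h : checkList p U = true) :
    ∀ x ∈ U, p x = true := by
  induction U with
  | nil => simp
  | cons y U ih =>
    have heq : checkList p (y :: U) = Bool.rec false (checkList p U) (p y) := rfl
    rw [heq] at h
    intro x hx
    cases hy : p y with
    | false =>
      rw [hy] at h
      exact absurd h Bool.false_ne_true
    | true =>
      rw [hy] at h
      rcases List.mem_cons.1 hx with rfl | hx
      · exact hy
      · exact ih h x hx

theorem mem_blockOrder {acc m : ℕ} (hm : m ∈ blockOrder acc) :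
    ∃ i < 11, ∃ s < 3, m = 16 ^ (11 * s + i) := by
  have h1 : m ∈ digitPowers := by
    unfold blockOrder at hm
    simp only [List.mem_append, mem_sift] at hm
    tauto
  rw [digitPowers_eq] at h1
  obtain ⟨e, he, rfl⟩ := List.mem_map.1 h1
  rw [List.mem_range] at he
  exact ⟨e % 11, by omega, e / 11, by omega, by rw [Nat.div_add_mod]⟩

theorem mem_buckets {bs : List ℕ} : ∀ {C : List ℕ}, ∀ mb ∈ buckets bs C, mb.1 ∈ bs := by
  induction bs with
  | nil => intro C mb h; exact absurd h List.not_mem_nil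
  | cons m bs ih =>
    intro C mb h
    rcases List.mem_cons.1 h with rfl | h
    · exact List.mem_cons_self
    · exact List.mem_cons_of_mem _ (ih mb h)

theorem land_pow_ne_zero {f : ℕ → ℕ} {i s : ℕ} (hi : i < 11) :
    Nat.land (pcode (range 11) f) (16 ^ (11 * s + i)) ≠ 0 ↔ f i = s := by
  have h1 : 16 ^ (11 * s + i) = pcode {i} fun _ => s := by simp [pcode]
  have h2 : Nat.land (pcode (range 11) f) (16 ^ (11 * s + i)) =
      pcode (range 11) f &&& pcode {i} fun _ => s := by rw [h1]; rfl
  rw [h2, land_pcode (Subset.refl _) (by simpa using hi)]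
  have h3 : range 11 ∩ {i} = {i} := inter_singleton_of_mem (mem_range.2 hi)
  rw [h3, filter_singleton]
  split
  · next h => simp [pcode, h]
  · next h => simp [pcode, h]

theorem inGroup_pcode {f : ℕ → ℕ} :
    inGroup (pcode (range 11) f) = true ↔ ((range 11).filter fun i => f i = 2).card = 3 := by
  have h : inGroup (pcode (range 11) f) =
      Nat.beq (agr (pcode (range 11) f) (pcode (range 11) fun _ => 2)) 3 := by
    rw [pcode_const_two]
    rfl
  rw [h, beq_iff, agr_pcode (Subset.refl _) (Subset.refl _), inter_self]

theorem mem_checkAll {cl : List ℕ} {W uv : ℕ} {I O : List ℕ} (h : checkAll cl W uv I O = true)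
    {x : ℕ} (hx : x ∈ I) (hs : sorted cl x = true) {y : ℕ} (hy : y ∈ I)
    (hc : candidate cl W x (key cl x) y = true) :
    refute (buckets (blockOrder (Nat.add uv x)) (keep x O)) [y] (Nat.add (Nat.add uv x) y) =
      true := by
  unfold checkAll at h
  have h1 := checkList_mem h x hx
  unfold checkWord at h1
  rw [hs, force_eq, force_eq] at h1
  exact checkList_mem h1 y (mem_sift.2 ⟨hy, hc⟩)

/-- A normalized tight family passes every filter: `c` and `d` are among the words inside the group,
the other eight among those outside. The search thus reaches the branch with the group `a, b, c, d`,
which by `refute_spec` it cannot refute. -/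
theorem generate_checkAll_eq_false {w : Fin 12 → ℕ → ℕ} {x : Fin 12 → ℕ}
    (hxw : ∀ k, x k = pcode (range 11) (w k)) (hw : ∀ k i, w k i < 3)
    (hcol : ∀ i < 11, ∀ s < 3, (univ.filter fun k => w k i = s).card = 4)
    (hrow : ∀ k, ∀ s < 3, ((range 11).filter fun i => w k i = s).card ≤ 4)
    (hagr : ∀ j k, j ≠ k → ((range 11).filter fun i => w j i = w k i).card = 3)
    {a b c d : Fin 12} (hab : a ≠ b) (hac : a ≠ c) (had : a ≠ d) (hbc : b ≠ c) (hbd : b ≠ d)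
    (hcd : c ≠ d)
    (hG : ∀ k, ((range 11).filter fun i => w k i = 2).card = 3 ↔ k = a ∨ k = b ∨ k = c ∨ k = d)
    {W : ℕ} (hW : ∀ j k, j ≠ k → ((range 11).filter fun i => w j i = 2).card = 3 →
      ((range 11).filter fun i => w k i = 2).card = 3 →
      weight (x j) (x k) ≤ W)
    {cl : List ℕ} (hkey : key cl (x c) ≤ key cl (x d)) (hsorted : sorted cl (x c) = true) :
    (generate (okPartial (x a) (x b)) columnPowers [nat_lit 0] fun L => checkAll cl W
      (Nat.add (x a) (x b)) (sift (inside (x a) (x b) W) L) (sift (outside (x a) (x b)) L)) =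
      false := by
  have hx : ∀ j k, agr (x j) (x k) = 3 ↔ j ≠ k := by
    intro j k
    rw [hxw, hxw, agr_pcode (Subset.refl _) (Subset.refl _), inter_self]
    constructor
    · rintro h rfl
      simp at h
    · exact hagr j k
  have hin : ∀ k, inGroup (x k) = true ↔ k = a ∨ k = b ∨ k = c ∨ k = d := fun k => by
    rw [hxw, inGroup_pcode, hG]
  rw [← Bool.not_eq_true]
  intro hcheck
  obtain ⟨L, hL, hmem⟩ := generate_spec (okPartial (x a) (x b)) 11 0 [nat_lit 0]
  rw [columnPowers_eq, hL] at hcheck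
  have hgen : ∀ k, k ≠ a → k ≠ b → x k ∈ L := by
    intro k hka hkb
    rw [hxw k]
    refine hmem (w k) (hw k) (fun i hi => ?_) (List.mem_singleton.2 rfl)
    rw [hxw a, hxw b]
    exact okPartial_pcode (by omega) (hagr a k hka.symm).le (hagr b k hkb.symm).le (hrow k)
  have hinside : ∀ k, k = c ∨ k = d → x k ∈ sift (inside (x a) (x b) W) L := by
    intro k hk
    have hka : k ≠ a := by rcases hk with rfl | rfl <;> [exact hac.symm; exact had.symm]
    have hkb : k ≠ b := by rcases hk with rfl | rfl <;> [exact hbc.symm; exact hbd.symm]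
    refine mem_sift.2 ⟨hgen k hka hkb, ?_⟩
    have hk' := (hin k).2 (Or.inr (Or.inr hk))
    have hGk := (hG k).2 (Or.inr (Or.inr hk))
    have h1 : Nat.beq (agr (x a) (x k)) (nat_lit 3) = true := beq_iff.2 ((hx a k).2 hka.symm)
    have h2 : Nat.beq (agr (x b) (x k)) (nat_lit 3) = true := beq_iff.2 ((hx b k).2 hkb.symm)
    have h3 : Nat.ble (weight (x a) (x k)) W = true :=
      ble_iff.2 (hW a k hka.symm ((hG a).2 (Or.inl rfl)) hGk)
    have h4 : Nat.ble (weight (x b) (x k)) W = true :=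
      ble_iff.2 (hW b k hkb.symm ((hG b).2 (Or.inr (Or.inl rfl))) hGk)
    unfold inside
    rw [h1, h2, h3, h4, hk']
  set R : Finset (Fin 12) := ({a, b, c, d} : Finset (Fin 12))ᶜ with hR
  have hRmem : ∀ k ∈ R, k ≠ a ∧ k ≠ b ∧ k ≠ c ∧ k ≠ d := by
    intro k hk
    simpa [hR] using hk
  have houtside : ∀ k ∈ R, x k ∈ sift (outside (x a) (x b)) L := by
    intro k hk
    obtain ⟨hka, hkb, hkc, hkd⟩ := hRmem k hk
    refine mem_sift.2 ⟨hgen k hka hkb, ?_⟩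
    have hk' : inGroup (x k) = false := by
      rw [← Bool.not_eq_true, hin]
      rintro (h | h | h | h)
      exacts [hka h, hkb h, hkc h, hkd h]
    have h1 : Nat.beq (agr (x a) (x k)) (nat_lit 3) = true := beq_iff.2 ((hx a k).2 hka.symm)
    have h2 : Nat.beq (agr (x b) (x k)) (nat_lit 3) = true := beq_iff.2 ((hx b k).2 hkb.symm)
    unfold outside
    rw [h1, h2, hk']
  have hcand : candidate cl W (x c) (key cl (x c)) (x d) = true := by
    have h1 : Nat.beq (agr (x c) (x d)) (nat_lit 3) = true := beq_iff.2 ((hx c d).2 hcd)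
    have h2 : Nat.ble (weight (x c) (x d)) W = true :=
      ble_iff.2 (hW c d hcd ((hG c).2 (Or.inr (Or.inr (Or.inl rfl))))
        ((hG d).2 (Or.inr (Or.inr (Or.inr rfl)))))
    have h3 : Nat.ble (key cl (x c)) (key cl (x d)) = true := ble_iff.2 hkey
    unfold candidate
    rw [h1, h2, h3]
  have hfinal := mem_checkAll hcheck (hinside c (Or.inl rfl)) hsorted (hinside d (Or.inr rfl)) hcand
  have hspec := refute_spec hx (buckets (blockOrder (Nat.add (Nat.add (x a) (x b)) (x c)))
        (keep (x c) (sift (outside (x a) (x b)) L))) (by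
    intro mb hmb A
    obtain ⟨i, hi, s, hs, hm⟩ := mem_blockOrder (mem_buckets mb hmb)
    simp only [hm, hxw]
    rw [digit_sum_pcode A (lt_of_le_of_lt (card_le_univ A) (by simp)) w hw hi hs]
    simp only [land_pow_ne_zero hi]
    rw [← hcol i hi s hs, ← card_union_of_disjoint]
    · congr 1
      rw [← filter_union, union_compl]
    · exact disjoint_filter_filter disjoint_compl_right) R [x d]
    (covers_buckets _ _ _ fun k hk => mem_keep.2 ⟨houtside k hk,
      (hx c k).2 (hRmem k hk).2.2.1.symm⟩) (by
    intro k hk y hy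
    rw [List.mem_singleton.1 hy]
    exact (hx d k).2 (hRmem k hk).2.2.2.symm)
  have hsum : Nat.add (Nat.add (Nat.add (x a) (x b)) (x c)) (x d) = ∑ k ∈ Rᶜ, x k := by
    rw [hR, compl_compl, sum_insert (by simp [hab, hac, had]), sum_insert (by simp [hbc, hbd]),
      sum_insert (by simp [hcd]), sum_singleton]
    simp only [Nat.add_eq]
    ring
  rw [hsum, hspec] at hfinal
  exact Bool.false_ne_true hfinal

theorem checkPair_eq_false {w : Fin 12 → ℕ → ℕ} {x : Fin 12 → ℕ}
    (hxw : ∀ k, x k = pcode (range 11) (w k)) (hw : ∀ k i, w k i < 3)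
    (hcol : ∀ i < 11, ∀ s < 3, (univ.filter fun k => w k i = s).card = 4)
    (hrow : ∀ k, ∀ s < 3, ((range 11).filter fun i => w k i = s).card ≤ 4)
    (hagr : ∀ j k, j ≠ k → ((range 11).filter fun i => w j i = w k i).card = 3)
    {a b c d : Fin 12} (hab : a ≠ b) (hac : a ≠ c) (had : a ≠ d) (hbc : b ≠ c) (hbd : b ≠ d)
    (hcd : c ≠ d)
    (hG : ∀ k, ((range 11).filter fun i => w k i = 2).card = 3 ↔ k = a ∨ k = b ∨ k = c ∨ k = d)
    {W : ℕ} (hW : ∀ j k, j ≠ k → ((range 11).filter fun i => w j i = 2).card = 3 →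
      ((range 11).filter fun i => w k i = 2).card = 3 →
      weight (x j) (x k) ≤ W)
    (hkey : key (cellCodes (x a) (x b)) (x c) ≤ key (cellCodes (x a) (x b)) (x d))
    (hsorted : sorted (cellCodes (x a) (x b)) (x c) = true) :
    checkPair (x a) (x b) W = false := by
  rw [checkPair_eq]
  exact generate_checkAll_eq_false hxw hw hcol hrow hagr hab hac had hbc hbd hcd hG hW hkey hsorted

end Soundness

/-! ### Codes of words and the invariants read off from them. -/

section Normalization

/-- The number of positions in which `u` and `v` have the symbols `a` and `b`. -/
def tab (u v : Fin 11 → Fin 3) (a b : Fin 3) : ℕ := (univ.filter fun i => u i = a ∧ v i = b).card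

def tri (u v x : Fin 11 → Fin 3) (a b s : Fin 3) : ℕ :=
  (univ.filter fun i => (u i = a ∧ v i = b) ∧ x i = s).card

/-- Invariant under permuting positions and renaming symbols, so it can be maximized before
normalizing. -/
def wt (u v : Fin 11 → Fin 3) : ℕ := ∑ a, ∑ b, tab u v a b ^ 2

def keyOf (u v x : Fin 11 → Fin 3) : ℕ :=
  [(0, 0), (0, 1), (0, 2), (1, 0), (1, 1), (1, 2), (2, 0), (2, 1), (2, 2)].foldr
    (fun p k => k * 256 + (tri u v x p.1 p.2 0 * 16 + tri u v x p.1 p.2 1)) 0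

def natWord (u : Fin 11 → Fin 3) (i : ℕ) : ℕ := if h : i < 11 then u ⟨i, h⟩ else 0

def code (u : Fin 11 → Fin 3) : ℕ := pcode (range 11) (natWord u)

theorem natWord_lt (u : Fin 11 → Fin 3) (i : ℕ) : natWord u i < 3 := by
  unfold natWord
  split
  · exact Fin.is_lt _
  · norm_num

theorem natWord_coe (u : Fin 11 → Fin 3) (i : Fin 11) : natWord u i = u i := by
  simp [natWord]

theorem card_range_filter (p : ℕ → Prop) [DecidablePred p] :
    ((range 11).filter p).card = (univ.filter fun i : Fin 11 => p i).card := by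
  rw [card_filter_fin, Nat.count_eq_card_filter_range]

/-- The code of a set of positions. -/
def setCode (S : Finset ℕ) : ℕ := pcode S fun _ => 2

theorem land_setCode (S T : Finset ℕ) : Nat.land (setCode S) (setCode T) = setCode (S ∩ T) := by
  have h : ∀ S : Finset ℕ, setCode S = ∑ e ∈ S.image (fun i => 4 * (22 + i)), 2 ^ e := by
    intro S
    rw [sum_image (fun i _ j _ hij => by simpa using hij)]
    refine sum_congr rfl fun i _ => ?_
    rw [pow_mul]
    norm_num
  change setCode S &&& setCode T = _
  rw [h, h, h, land_sum_two_pow, image_inter _ _ fun i j hij => by simpa using hij]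

theorem cnt_setCode {S T : Finset ℕ} (hS : S ⊆ range 11) :
    cnt (setCode S) (setCode T) = (S ∩ T).card := by
  have : cnt (setCode S) (setCode T) = Nat.land (setCode S) (setCode T) % 15 := rfl
  rw [this, land_setCode, setCode, pcode_mod_fifteen]
  have := card_le_card (inter_subset_left.trans hS : S ∩ T ⊆ range 11)
  rw [card_range] at this
  omega

def positions (u : Fin 11 → Fin 3) (a : ℕ) : Finset ℕ := (range 11).filter fun i => natWord u i = a

theorem land_code_mul (u : Fin 11 → Fin 3) (a t : ℕ) (hat : a + t = 2) :
    (pcode (range 11) (natWord u) &&& pcode (range 11) fun _ => a) * 16 ^ (11 * t) =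
      setCode (positions u a) := by
  rw [land_pcode (Subset.refl _) (Subset.refl _), inter_self, pcode_mul]
  refine pcode_congr fun i hi => ?_
  rw [(mem_filter.1 hi).2, hat]

theorem ind0_code (u : Fin 11 → Fin 3) : ind0 (code u) = setCode (positions u 0) := by
  rw [← land_code_mul u 0 2 rfl, pcode_const_zero]
  rfl

theorem ind1_code (u : Fin 11 → Fin 3) : ind1 (code u) = setCode (positions u 1) := by
  rw [← land_code_mul u 1 1 rfl, pcode_const_one]
  rfl

theorem ind2_code (u : Fin 11 → Fin 3) : ind2 (code u) = setCode (positions u 2) := by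
  rw [← land_code_mul u 2 0 rfl, pcode_const_two, mul_zero, pow_zero, mul_one]
  rfl

theorem positions_subset (u : Fin 11 → Fin 3) (a : ℕ) : positions u a ⊆ range 11 :=
  filter_subset _ _

theorem card_positions_inter (u v : Fin 11 → Fin 3) (a b : Fin 3) :
    (positions u a ∩ positions v b).card = tab u v a b := by
  rw [positions, positions, ← filter_and, card_range_filter, tab]
  simp only [natWord_coe, Fin.val_inj]

theorem card_positions_inter_inter (u v x : Fin 11 → Fin 3) (a b s : Fin 3) :
    (positions u a ∩ positions v b ∩ positions x s).card = tri u v x a b s := by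
  rw [positions, positions, positions, ← filter_and, ← filter_and, card_range_filter, tri]
  simp only [natWord_coe, Fin.val_inj]

theorem weight_code (u v : Fin 11 → Fin 3) : weight (code u) (code v) = wt u v := by
  have h : ∀ a b : Fin 3, sqcnt (setCode (positions u a)) (setCode (positions v b)) =
      tab u v a b ^ 2 := by
    intro a b
    rw [← card_positions_inter, ← cnt_setCode (positions_subset u a)]
    rfl
  have h00 := h 0 0
  have h01 := h 0 1
  have h02 := h 0 2
  have h10 := h 1 0
  have h11 := h 1 1
  have h12 := h 1 2
  have h20 := h 2 0
  have h21 := h 2 1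
  have h22 := h 2 2
  simp only [Fin.val_zero, Fin.val_one, Fin.val_two] at h00 h01 h02 h10 h11 h12 h20 h21 h22
  rw [weight, ind0_code, ind1_code, ind2_code, ind0_code, ind1_code, ind2_code, h00, h01, h02, h10,
    h11, h12, h20, h21, h22, wt, Fin.sum_univ_three, Fin.sum_univ_three, Fin.sum_univ_three,
    Fin.sum_univ_three]
  simp only [Nat.add_eq]
  ring

theorem key_code (u v x : Fin 11 → Fin 3) :
    key (cellCodes (code u) (code v)) (code x) = keyOf u v x := by
  have h : ∀ a b s : Fin 3, cnt (Nat.land (setCode (positions u a)) (setCode (positions v b)))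
      (setCode (positions x s)) = tri u v x a b s := by
    intro a b s
    rw [land_setCode, cnt_setCode (inter_subset_left.trans (positions_subset u a)),
      card_positions_inter_inter]
  have hstep : ∀ (c : ℕ) (cl : List ℕ), key (c :: cl) (code x) = key cl (code x) * 256 +
      (cnt c (setCode (positions x 0)) * 16 + cnt c (setCode (positions x 1))) := by
    intro c cl
    rw [← ind0_code, ← ind1_code]
    rfl
  have hnil : key [] (code x) = 0 := rfl
  have h' : ∀ a b : Fin 3,
      (cnt (Nat.land (setCode (positions u a)) (setCode (positions v b)))
        (setCode (positions x 0)) = tri u v x a b 0) ∧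
      (cnt (Nat.land (setCode (positions u a)) (setCode (positions v b)))
        (setCode (positions x 1)) = tri u v x a b 1) := fun a b => ⟨h a b 0, h a b 1⟩
  have h00 := h' 0 0
  have h01 := h' 0 1
  have h02 := h' 0 2
  have h10 := h' 1 0
  have h11 := h' 1 1
  have h12 := h' 1 2
  have h20 := h' 2 0
  have h21 := h' 2 1
  have h22 := h' 2 2
  simp only [Fin.val_zero, Fin.val_one, Fin.val_two] at h00 h01 h02 h10 h11 h12 h20 h21 h22
  rw [cellCodes, ind0_code, ind1_code, ind2_code, ind0_code, ind1_code, ind2_code]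
  simp only [hstep, hnil, h00, h01, h02, h10, h11, h12, h20, h21, h22]
  rfl

theorem setCode_mul (S : Finset ℕ) : setCode S * 16 = setCode (S.image (· + 1)) := pcode_shift

theorem sortedIn_setCode {c x y : Finset ℕ}
    (h : ∀ i, i ∈ c → i + 1 ∈ c → i ∈ x → i + 1 ∈ y → False) :
    sortedIn (setCode c) (setCode x) (setCode y) = true := by
  have heq : sortedIn (setCode c) (setCode x) (setCode y) =
      Nat.beq (Nat.land (Nat.land (setCode x * 16) (setCode y))
        (Nat.land (setCode c * 16) (setCode c))) 0 := rfl
  rw [heq, beq_iff, setCode_mul, setCode_mul, land_setCode, land_setCode, land_setCode]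
  have : image (· + 1) x ∩ y ∩ (image (· + 1) c ∩ c) = ∅ := by
    rw [eq_empty_iff_forall_notMem]
    intro j hj
    simp only [mem_inter, mem_image] at hj
    obtain ⟨⟨⟨i, hi, rfl⟩, hy⟩, ⟨i', hi', hii⟩, hc⟩ := hj
    obtain rfl : i' = i := by omega
    exact h _ hi' hc hi hy
  rw [this]
  rfl

/-- Inside a cell `u` and `v` are constant, so the monotone combination reduces to `x`. -/
theorem sorted_code {u v x : Fin 11 → Fin 3}
    (hmono : Monotone fun i => 9 * (u i : ℕ) + 3 * (v i : ℕ) + (x i : ℕ)) :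
    sorted (cellCodes (code u) (code v)) (code x) = true := by
  have h : ∀ a b s t : ℕ, t < s → sortedIn (setCode (positions u a ∩ positions v b))
      (setCode (positions x s)) (setCode (positions x t)) = true := by
    intro a b s t hst
    refine sortedIn_setCode fun i h1 h2 h3 h4 => ?_
    simp only [positions, mem_inter, mem_filter, mem_range] at h1 h2 h3 h4
    obtain ⟨⟨hi, h1⟩, -, h1'⟩ := h1
    obtain ⟨⟨hi', h2⟩, -, h2'⟩ := h2
    have h := hmono (show (⟨i, hi⟩ : Fin 11) ≤ ⟨i + 1, hi'⟩ from by simp [Fin.le_def])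
    simp only [natWord, hi, hi', dif_pos] at h1 h1' h2 h2' h3 h4 h
    omega
  have hstep : ∀ (c : ℕ) (cl : List ℕ), sorted (c :: cl) (code x) =
      (sortedIn c (setCode (positions x 1)) (setCode (positions x 0)) &&
        (sortedIn c (setCode (positions x 2)) (setCode (positions x 0)) &&
        (sortedIn c (setCode (positions x 2)) (setCode (positions x 1)) &&
          sorted cl (code x)))) := by
    intro c cl
    rw [← ind0_code, ← ind1_code, ← ind2_code]
    rfl
  have hnil : sorted [] (code x) = true := rfl
  rw [cellCodes, ind0_code, ind1_code, ind2_code, ind0_code, ind1_code, ind2_code]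
  simp only [hstep, hnil, land_setCode, h _ _ 1 0 (by norm_num), h _ _ 2 0 (by norm_num),
    h _ _ 2 1 (by norm_num), Bool.and_self]

end Normalization

/-! ### Twelve ternary words of length 11: reduction to eight pairs. -/

section ThreeEleven

/-- A family of `12` ternary words of length `11` attaining the Plotkin bound. -/
structure IsTight (c : Fin 12 → Fin 11 → Fin 3) : Prop where
  freq_eq : ∀ k σ, freq σ (c k) = 3 ∨ freq σ (c k) = 4
  colCount_eq : ∀ i σ, colCount c i σ = 4
  agree_eq : ∀ j k, j ≠ k → agree (c j) (c k) = 3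

theorem IsFamily.isTight {c : Fin 12 → Fin 11 → Fin 3} (hc : IsFamily 3 c) : IsTight c := by
  obtain ⟨h1, h2⟩ := tight_family (q := 3) (m := 4) hc (by norm_num)
  refine ⟨fun k σ => ?_, h1, h2⟩
  have := hc.equitable k σ
  rwa [Nat.ceilDiv_eq_add_pred_div] at this

/-- The symbol occurs `11·4 = 44` times in twelve words, three or four times in each, so four words
fall short of 4. -/
theorem IsTight.card_group {c : Fin 12 → Fin 11 → Fin 3} (hc : IsTight c) (σ : Fin 3) :
    (univ.filter fun k => freq σ (c k) = 3).card = 4 := by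
  have h1 := sum_freq_eq_sum_colCount c σ
  simp only [hc.colCount_eq, sum_const, card_univ, Fintype.card_fin, smul_eq_mul] at h1
  have h2 : ∑ k, (freq σ (c k) + if freq σ (c k) = 3 then 1 else 0) = ∑ _k : Fin 12, 4 := by
    refine sum_congr rfl fun k _ => ?_
    rcases hc.freq_eq k σ with h | h <;> rw [h] <;> rfl
  rw [sum_add_distrib, h1, ← card_filter] at h2
  simp only [sum_const, card_univ, Fintype.card_fin, smul_eq_mul] at h2
  omega

/-- Relabelling of the symbols and permutation of the positions. -/
def relabel (π : Equiv.Perm (Fin 3)) (e : Equiv.Perm (Fin 11)) (u : Fin 11 → Fin 3) :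
    Fin 11 → Fin 3 := fun i => π (u (e i))

variable (π : Equiv.Perm (Fin 3)) (e : Equiv.Perm (Fin 11)) (u v x : Fin 11 → Fin 3)

theorem card_filter_comp_perm {n : ℕ} (e : Equiv.Perm (Fin n)) (p : Fin n → Prop)
    [DecidablePred p] : (univ.filter fun i => p (e i)).card = (univ.filter p).card := by
  rw [← card_map e.toEmbedding]
  congr 1
  ext i
  simp only [mem_map, mem_filter, mem_univ, true_and, Equiv.coe_toEmbedding]
  exact ⟨fun ⟨j, hj, hji⟩ => hji ▸ hj, fun hi => ⟨e.symm i, by simpa using hi, by simp⟩⟩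

theorem freq_relabel (σ : Fin 3) : freq σ (relabel π e u) = freq (π.symm σ) u := by
  rw [freq, freq, ← card_filter_comp_perm e fun i => u i = π.symm σ]
  refine congrArg card (filter_congr fun i _ => ?_)
  simp only [relabel, Equiv.eq_symm_apply]

theorem agree_relabel : agree (relabel π e u) (relabel π e v) = agree u v := by
  rw [agree, agree, ← card_filter_comp_perm e fun i => u i = v i]
  simp only [relabel, EmbeddingLike.apply_eq_iff_eq]

theorem tab_relabel (a b : Fin 3) :
    tab (relabel π e u) (relabel π e v) a b = tab u v (π.symm a) (π.symm b) := by
  rw [tab, tab, ← card_filter_comp_perm e fun i => u i = π.symm a ∧ v i = π.symm b]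
  refine congrArg card (filter_congr fun i _ => ?_)
  simp only [relabel, Equiv.eq_symm_apply]

theorem wt_relabel : wt (relabel π e u) (relabel π e v) = wt u v := by
  simp only [wt, tab_relabel]
  rw [Equiv.sum_comp π.symm fun a => ∑ b, tab u v a (π.symm b) ^ 2]
  exact sum_congr rfl fun a _ => Equiv.sum_comp π.symm fun b => tab u v a b ^ 2

theorem tri_relabel (a b s : Fin 3) :
    tri (relabel 1 e u) (relabel 1 e v) (relabel 1 e x) a b s = tri u v x a b s := by
  rw [tri, tri, ← card_filter_comp_perm e fun i => (u i = a ∧ v i = b) ∧ x i = s]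
  rfl

theorem keyOf_relabel :
    keyOf (relabel 1 e u) (relabel 1 e v) (relabel 1 e x) = keyOf u v x := by
  simp only [keyOf, tri_relabel]

variable {u v x} {c : Fin 12 → Fin 11 → Fin 3}

theorem IsTight.relabel (hc : IsTight c) : IsTight fun k => ESW.relabel π e (c k) := by
  refine ⟨fun k σ => ?_, fun i σ => ?_, fun j k hjk => ?_⟩
  · simpa only [freq_relabel] using hc.freq_eq k _
  · rw [← hc.colCount_eq (e i) (π.symm σ)]
    unfold colCount
    refine congrArg card (filter_congr fun k _ => ?_)
    simp only [ESW.relabel, Equiv.eq_symm_apply]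
  · simpa only [agree_relabel] using hc.agree_eq j k hjk

theorem tab_swap (a b : Fin 3) : tab v u a b = tab u v b a := by
  simp only [tab, and_comm]

theorem wt_swap : wt v u = wt u v := by
  simp only [wt]
  rw [sum_comm]
  simp only [tab_swap (u := u) (v := v)]

theorem sum_tab (a : Fin 3) : tab u v a 0 + tab u v a 1 + tab u v a 2 = freq a u := by
  simp only [tab, freq, card_filter, ← sum_add_distrib]
  refine sum_congr rfl fun i _ => ?_
  generalize u i = y, v i = z
  revert a y z
  decide

theorem sum_tab_diag : tab u v 0 0 + tab u v 1 1 + tab u v 2 2 = agree u v := by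
  simp only [tab, agree, card_filter, ← sum_add_distrib]
  refine sum_congr rfl fun i _ => ?_
  generalize u i = y, v i = z
  revert y z
  decide

/-- The first word of the normalized pairs. -/
def firstWord : Fin 11 → Fin 3 := ![0, 0, 0, 0, 1, 1, 1, 1, 2, 2, 2]

/-- The second words of the normalized pairs. -/
def secondWord : Fin 8 → Fin 11 → Fin 3 :=
  ![![1, 1, 1, 1, 0, 0, 0, 0, 2, 2, 2], ![0, 0, 0, 1, 0, 2, 2, 2, 1, 1, 1],
    ![0, 1, 1, 1, 0, 0, 0, 2, 1, 2, 2], ![0, 0, 1, 1, 1, 2, 2, 2, 0, 0, 1],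
    ![0, 1, 1, 1, 0, 1, 2, 2, 0, 0, 2], ![0, 0, 1, 1, 0, 0, 2, 2, 1, 1, 2],
    ![0, 0, 1, 2, 0, 1, 2, 2, 0, 1, 1], ![0, 1, 1, 2, 0, 0, 1, 2, 0, 1, 2]]

/-- The relations satisfied by `tab u v` for two words of the same group. -/
structure IsTable (T : Fin 3 → Fin 3 → ℕ) : Prop where
  row : ∀ a, T a 0 + T a 1 + T a 2 = if a = 2 then 3 else 4
  col : ∀ b, T 0 b + T 1 b + T 2 b = if b = 2 then 3 else 4
  diag : T 0 0 + T 1 1 + T 2 2 = 3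

/-- The prescribed margins determine the last row and column from the upper left corner of size 2.
-/
theorem IsTable.ext {T T' : Fin 3 → Fin 3 → ℕ} (hT : IsTable T) (hT' : IsTable T')
    (h00 : T 0 0 = T' 0 0) (h01 : T 0 1 = T' 0 1) (h10 : T 1 0 = T' 1 0) (h11 : T 1 1 = T' 1 1)
    (a b : Fin 3) : T a b = T' a b := by
  have h0 := hT.row 0
  have h1 := hT.row 1
  have h2 := hT.col 0
  have h3 := hT.col 1
  have h4 := hT.col 2
  have h0' := hT'.row 0
  have h1' := hT'.row 1
  have h2' := hT'.col 0
  have h3' := hT'.col 1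
  have h4' := hT'.col 2
  simp only [Fin.isValue, Fin.reduceEq, if_false, if_true] at h0 h1 h2 h3 h4 h0' h1' h2' h3' h4'
  fin_cases a <;> fin_cases b <;> 
    simp only [Fin.reduceFinMk, Fin.isValue, Fin.zero_eta, Fin.mk_one] <;> omega

theorem isTable_tab (hu0 : freq 0 u = 4) (hu1 : freq 1 u = 4) (hu2 : freq 2 u = 3)
    (hv0 : freq 0 v = 4) (hv1 : freq 1 v = 4) (hv2 : freq 2 v = 3) (huv : agree u v = 3) :
    IsTable (tab u v) := by
  refine ⟨fun a => ?_, fun b => ?_, sum_tab_diag.trans huv⟩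
  · rw [sum_tab]
    fin_cases a
    exacts [hu0, hu1, hu2]
  · rw [tab_swap 0 b, tab_swap 1 b, tab_swap 2 b, sum_tab]
    fin_cases b
    exacts [hv0, hv1, hv2]

theorem IsTable.transpose {T : Fin 3 → Fin 3 → ℕ} (hT : IsTable T) :
    IsTable fun a b => T b a :=
  ⟨hT.col, hT.row, hT.diag⟩

theorem IsTable.swap {T : Fin 3 → Fin 3 → ℕ} (hT : IsTable T) :
    IsTable fun a b => T (Equiv.swap 0 1 a) (Equiv.swap 0 1 b) := by
  have e0 : Equiv.swap (0 : Fin 3) 1 0 = 1 := by decide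
  have e1 : Equiv.swap (0 : Fin 3) 1 1 = 0 := by decide
  have e2 : Equiv.swap (0 : Fin 3) 1 2 = 2 := by decide
  refine ⟨fun a => ?_, fun b => ?_, ?_⟩
  · have h := hT.row (Equiv.swap 0 1 a)
    have h' : (Equiv.swap 0 1 a = 2) = (a = 2) := by clear h; revert a; decide
    simp only [h'] at h
    simp only [e0, e1, e2]
    omega
  · have h := hT.col (Equiv.swap 0 1 b)
    have h' : (Equiv.swap 0 1 b = 2) = (b = 2) := by clear h; revert b; decide
    simp only [h'] at h
    simp only [e0, e1, e2]
    omega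
  · have h := hT.diag
    simp only [e0, e1, e2]
    omega

theorem isTable_secondWord (q : Fin 8) : IsTable (tab firstWord (secondWord q)) := by
  refine isTable_tab ?_ ?_ ?_ ?_ ?_ ?_ ?_ <;> revert q <;> decide

/-- The inequalities say that the entries completing the corner are nonnegative, the last being `a +
b + c + d - 5`; the equation is the diagonal sum. The alternatives are the orbit under exchanging
the symbols 0 and 1 and transposing. -/
theorem exists_corner (a b c d : Fin 5)
    (h : (a + b : ℕ) ≤ 4 ∧ (c + d : ℕ) ≤ 4 ∧ (a + c : ℕ) ≤ 4 ∧ (b + d : ℕ) ≤ 4 ∧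
      5 ≤ (a + b + c + d : ℕ) ∧ (2 * a + 2 * d + b + c : ℕ) = 8) :
    ∃ k ∈ [[0, 4, 4, 0], [3, 1, 1, 0], [1, 3, 3, 0], [2, 2, 0, 1], [1, 3, 1, 1], [2, 2, 2, 0], [2, 1, 1, 1],
      [1, 2, 2, 1]], [a, b, c, d] = k ∨ [d, c, b, a] = k ∨ [a, c, b, d] = k ∨ [d, b, c, a] = k := by
  revert a b c d
  decide +kernel

theorem corner_secondWord (k : List (Fin 5)) (hk : k ∈ [[0, 4, 4, 0], [3, 1, 1, 0], [1, 3, 3, 0],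
      [2, 2, 0, 1], [1, 3, 1, 1], [2, 2, 2, 0], [2, 1, 1, 1], [1, 2, 2, 1]]) :
    ∃ q, [tab firstWord (secondWord q) 0 0, tab firstWord (secondWord q) 0 1,
      tab firstWord (secondWord q) 1 0, tab firstWord (secondWord q) 1 1] = k.map Fin.val := by
  revert k
  decide +kernel

theorem exists_secondWord {T : Fin 3 → Fin 3 → ℕ} (hT : IsTable T) :
    ∃ q : Fin 8, ∃ π : Equiv.Perm (Fin 3), π 2 = 2 ∧
      ((∀ a b, T (π a) (π b) = tab firstWord (secondWord q) a b) ∨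
        ∀ a b, T (π b) (π a) = tab firstWord (secondWord q) a b) := by
  have h0 := hT.row 0
  have h1 := hT.row 1
  have h2 := hT.col 0
  have h3 := hT.col 1
  have h4 := hT.col 2
  have h5 := hT.diag
  simp only [Fin.isValue, Fin.reduceEq, if_false, if_true] at h0 h1 h2 h3 h4
  obtain ⟨k, hk, h⟩ := exists_corner ⟨T 0 0, by omega⟩ ⟨T 0 1, by omega⟩ ⟨T 1 0, by omega⟩
    ⟨T 1 1, by omega⟩ (by simp only; omega)
  obtain ⟨q, hq⟩ := corner_secondWord k hk
  refine ⟨q, ?_⟩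
  have e0 : Equiv.swap (0 : Fin 3) 1 0 = 1 := by decide
  have e1 : Equiv.swap (0 : Fin 3) 1 1 = 0 := by decide
  rcases h with rfl | rfl | rfl | rfl <;>
    simp only [List.map_cons, List.map_nil, List.cons.injEq, and_true] at hq <;>
    obtain ⟨q0, q1, q2, q3⟩ := hq
  · exact ⟨1, rfl, Or.inl (hT.ext (isTable_secondWord q) q0.symm q1.symm q2.symm q3.symm)⟩
  · refine ⟨Equiv.swap 0 1, by decide, Or.inl (hT.swap.ext (isTable_secondWord q) ?_ ?_ ?_ ?_)⟩ <;>
      simp [*]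
  · exact ⟨1, rfl, Or.inr (hT.transpose.ext (isTable_secondWord q) q0.symm q1.symm q2.symm q3.symm)⟩
  · refine ⟨Equiv.swap 0 1, by decide,
      Or.inr (hT.swap.transpose.ext (isTable_secondWord q) ?_ ?_ ?_ ?_)⟩ <;>
      simp [*]

/-- Equal fibre sizes give a permutation carrying `g` to `f`, and the sorted rearrangement of `g` is
unique. -/
theorem eq_of_monotone_of_card_eq {n : ℕ} {f g : Fin n → ℕ} (hf : Monotone f) (hg : Monotone g)
    (h : ∀ a, (univ.filter fun i => f i = a).card = (univ.filter fun i => g i = a).card) :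
    f = g := by
  have e : ∀ a, {i // f i = a} ≃ {i // g i = a} := fun a =>
    Fintype.equivOfCardEq (by rw [Fintype.card_subtype, Fintype.card_subtype, h])
  have h1 : g ∘ Equiv.ofFiberEquiv e = f := funext fun i => Equiv.ofFiberEquiv_map e i
  have h2 : g ∘ Equiv.refl (Fin n) = g := rfl
  exact h1.symm.trans ((Tuple.unique_monotone (by rw [h1]; exact hf) (by rw [h2]; exact hg)).trans h2)

/-- Sorting the positions lexicographically by `(u, v, x)` puts the pair into its normal form and at
the same time sorts `x` inside each cell. -/
theorem exists_relabel_eq {u₀ v₀ : Fin 11 → Fin 3}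
    (hmono : Monotone fun i => 3 * (u₀ i : ℕ) + (v₀ i : ℕ))
    (h : ∀ a b, tab u v a b = tab u₀ v₀ a b) (x : Fin 11 → Fin 3) :
    ∃ e, relabel 1 e u = u₀ ∧ relabel 1 e v = v₀ ∧
      Monotone fun i => 9 * (u₀ i : ℕ) + 3 * (v₀ i : ℕ) + (relabel 1 e x i : ℕ) := by
  set e := Tuple.sort fun i => 9 * (u i : ℕ) + 3 * (v i : ℕ) + (x i : ℕ) with he
  have hm := Tuple.monotone_sort fun i => 9 * (u i : ℕ) + 3 * (v i : ℕ) + (x i : ℕ)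
  rw [← he] at hm
  have heq : (fun i => 3 * (u (e i) : ℕ) + (v (e i) : ℕ)) =
      fun i => 3 * (u₀ i : ℕ) + (v₀ i : ℕ) := by
    refine eq_of_monotone_of_card_eq (fun i j hij => ?_) hmono fun m => ?_
    · have := hm hij
      simp only [Function.comp] at this
      have h1 := (x (e i)).isLt
      have h2 := (x (e j)).isLt
      omega
    · rw [card_filter_comp_perm e fun i => 3 * (u i : ℕ) + (v i : ℕ) = m]
      by_cases hm : m < 9
      · have h1 := h ⟨m / 3, by omega⟩ ⟨m % 3, by omega⟩
        have h2 : ∀ y z : Fin 3, 3 * (y : ℕ) + (z : ℕ) = m ↔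
            y = ⟨m / 3, by omega⟩ ∧ z = ⟨m % 3, by omega⟩ := by
          intro y z
          simp only [Fin.ext_iff]
          omega
        simpa only [tab, h2] using h1
      · have h2 : ∀ y z : Fin 3, ¬ 3 * (y : ℕ) + (z : ℕ) = m := by
          intro y z
          omega
        simp only [h2]
  have h1 : ∀ i, u (e i) = u₀ i ∧ v (e i) = v₀ i := by
    intro i
    have := congrFun heq i
    simp only [Fin.ext_iff]
    omega
  have h2 : relabel 1 e u = u₀ := funext fun i => (h1 i).1
  have h3 : relabel 1 e v = v₀ := funext fun i => (h1 i).2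
  refine ⟨e, h2, h3, ?_⟩
  rw [← h2, ← h3]
  exact hm

theorem IsTight.freq_eq_four (hc : IsTight c) {k : Fin 12} (hk : freq 2 (c k) = 3) :
    freq 0 (c k) = 4 ∧ freq 1 (c k) = 4 := by
  have h := sum_freq (c k)
  rw [Fin.sum_univ_three] at h
  have h0 := hc.freq_eq k 0
  have h1 := hc.freq_eq k 1
  omega

/-- The maximum is taken over the groups of all three symbols; the symbol of the best pair is then
renamed to 2. -/
theorem IsTight.exists_max (hc : IsTight c) : ∃ c, IsTight c ∧ ∃ j k, j ≠ k ∧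
    freq 2 (c j) = 3 ∧ freq 2 (c k) = 3 ∧ ∀ j' k', j' ≠ k' → freq 2 (c j') = 3 →
      freq 2 (c k') = 3 → wt (c j') (c k') ≤ wt (c j) (c k) := by
  let S := univ.filter fun p : Fin 12 × Fin 12 × Fin 3 =>
    p.1 ≠ p.2.1 ∧ freq p.2.2 (c p.1) = 3 ∧ freq p.2.2 (c p.2.1) = 3
  have hS : S.Nonempty := by
    obtain ⟨j, hj, k, hk, hjk⟩ := one_lt_card.1
      (show 1 < (univ.filter fun k => freq 0 (c k) = 3).card from by rw [hc.card_group]; norm_num)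
    exact ⟨(j, k, 0), mem_filter.2 ⟨mem_univ _, hjk, (mem_filter.1 hj).2, (mem_filter.1 hk).2⟩⟩
  obtain ⟨⟨j, k, σ⟩, hmem, hmax⟩ := exists_max_image S (fun p => wt (c p.1) (c p.2.1)) hS
  obtain ⟨hjk, hj, hk⟩ := (mem_filter.1 hmem).2
  have hf : ∀ k, freq 2 (ESW.relabel (Equiv.swap σ 2) 1 (c k)) = freq σ (c k) := by
    intro k
    rw [freq_relabel, Equiv.symm_swap, Equiv.swap_apply_right]
  refine ⟨_, hc.relabel (Equiv.swap σ 2) 1, j, k, hjk, by rw [hf, hj], by rw [hf, hk], ?_⟩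
  intro j' k' hjk' hj' hk'
  rw [wt_relabel, wt_relabel]
  rw [hf] at hj' hk'
  exact hmax (j', k', σ) (mem_filter.2 ⟨mem_univ _, hjk', hj', hk'⟩)

theorem IsTight.exists_tab_eq (hc : IsTight c) : ∃ c, IsTight c ∧ ∃ j k q, j ≠ k ∧
    freq 2 (c j) = 3 ∧ freq 2 (c k) = 3 ∧
    (∀ a b, tab (c j) (c k) a b = tab firstWord (secondWord q) a b) ∧
    ∀ j' k', j' ≠ k' → freq 2 (c j') = 3 → freq 2 (c k') = 3 →
      wt (c j') (c k') ≤ wt firstWord (secondWord q) := by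
  obtain ⟨c, hc, j, k, hjk, hj, hk, hmax⟩ := hc.exists_max
  obtain ⟨hj0, hj1⟩ := hc.freq_eq_four hj
  obtain ⟨hk0, hk1⟩ := hc.freq_eq_four hk
  obtain ⟨q, π, hπ, h⟩ := exists_secondWord
    (isTable_tab hj0 hj1 hj hk0 hk1 hk (hc.agree_eq j k hjk))
  have hf : ∀ k, freq 2 (ESW.relabel π.symm 1 (c k)) = freq 2 (c k) := by
    intro k
    rw [freq_relabel, Equiv.symm_symm, hπ]
  have key : ∀ j k, j ≠ k → freq 2 (c j) = 3 → freq 2 (c k) = 3 →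
      (∀ j' k', j' ≠ k' → freq 2 (c j') = 3 → freq 2 (c k') = 3 →
        wt (c j') (c k') ≤ wt (c j) (c k)) →
      (∀ a b, tab (c j) (c k) (π a) (π b) = tab firstWord (secondWord q) a b) →
      ∃ c, IsTight c ∧ ∃ j k q, j ≠ k ∧ freq 2 (c j) = 3 ∧ freq 2 (c k) = 3 ∧
        (∀ a b, tab (c j) (c k) a b = tab firstWord (secondWord q) a b) ∧
        ∀ j' k', j' ≠ k' → freq 2 (c j') = 3 → freq 2 (c k') = 3 →
          wt (c j') (c k') ≤ wt firstWord (secondWord q) := by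
    intro j k hjk hj hk hmax h
    have ht : ∀ a b, tab (ESW.relabel π.symm 1 (c j)) (ESW.relabel π.symm 1 (c k)) a b =
        tab firstWord (secondWord q) a b := by
      intro a b
      rw [tab_relabel, Equiv.symm_symm, h]
    have hw : wt (c j) (c k) = wt firstWord (secondWord q) := by
      rw [← wt_relabel π.symm 1]
      simp only [wt, ht]
    refine ⟨_, hc.relabel π.symm 1, j, k, q, hjk, by rw [hf, hj], by rw [hf, hk], ht, ?_⟩
    intro j' k' hjk' hj' hk'
    rw [wt_relabel, ← hw]
    rw [hf] at hj' hk'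
    exact hmax j' k' hjk' hj' hk'
  rcases h with h | h
  · exact key j k hjk hj hk hmax h
  -- A transposed table belongs to the pair in the opposite order.
  · refine key k j hjk.symm hk hj (fun j' k' h1 h2 h3 => ?_) fun a b => ?_
    · rw [wt_swap (u := c j)]
      exact hmax j' k' h1 h2 h3
    · rw [tab_swap, h]

theorem monotone_secondWord (q : Fin 8) :
    Monotone fun i => 3 * (firstWord i : ℕ) + (secondWord q i : ℕ) := by
  intro i j
  revert i j q
  decide +kernel

theorem exists_eq_insert_of_card_eq_four {s : Finset (Fin 12)} (hs : s.card = 4) {a b : Fin 12}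
    (ha : a ∈ s) (hb : b ∈ s) (hab : a ≠ b) : ∃ y z, a ≠ y ∧ a ≠ z ∧ b ≠ y ∧ b ≠ z ∧ y ≠ z ∧
      ∀ k, k ∈ s ↔ k = a ∨ k = b ∨ k = y ∨ k = z := by
  have h1 : ((s.erase a).erase b).card = 2 := by
    rw [card_erase_of_mem (mem_erase.2 ⟨hab.symm, hb⟩), card_erase_of_mem ha, hs]
  obtain ⟨y, z, hyz, h⟩ := card_eq_two.1 h1
  have hy : y ∈ (s.erase a).erase b := by rw [h]; simp
  have hz : z ∈ (s.erase a).erase b := by rw [h]; simp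
  simp only [mem_erase] at hy hz
  refine ⟨y, z, hy.2.1.symm, hz.2.1.symm, hy.1.symm, hz.1.symm, hyz, fun k => ⟨fun hk => ?_, ?_⟩⟩
  · by_cases hka : k = a
    · exact Or.inl hka
    by_cases hkb : k = b
    · exact Or.inr (Or.inl hkb)
    have : k ∈ (s.erase a).erase b := mem_erase.2 ⟨hkb, mem_erase.2 ⟨hka, hk⟩⟩
    rw [h] at this
    simpa using Or.inr (Or.inr this)
  · rintro (rfl | rfl | rfl | rfl)
    exacts [ha, hb, hy.2.2, hz.2.2]

theorem IsTight.exists_normalized (hc : IsTight c) : ∃ c, IsTight c ∧ ∃ a b y z q,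
    a ≠ b ∧ a ≠ y ∧ a ≠ z ∧ b ≠ y ∧ b ≠ z ∧ y ≠ z ∧
    (∀ k, freq 2 (c k) = 3 ↔ k = a ∨ k = b ∨ k = y ∨ k = z) ∧
    c a = firstWord ∧ c b = secondWord q ∧
    keyOf (c a) (c b) (c y) ≤ keyOf (c a) (c b) (c z) ∧
    (Monotone fun i => 9 * (c a i : ℕ) + 3 * (c b i : ℕ) + (c y i : ℕ)) ∧
    ∀ j k, j ≠ k → freq 2 (c j) = 3 → freq 2 (c k) = 3 →
      wt (c j) (c k) ≤ wt firstWord (secondWord q) := by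
  obtain ⟨c, hc, a, b, q, hab, ha, hb, ht, hmax⟩ := hc.exists_tab_eq
  obtain ⟨y, z, h1, h2, h3, h4, h5, h6, h7⟩ : ∃ y z, a ≠ y ∧ a ≠ z ∧ b ≠ y ∧ b ≠ z ∧ y ≠ z ∧
      (∀ k, freq 2 (c k) = 3 ↔ k = a ∨ k = b ∨ k = y ∨ k = z) ∧
      keyOf (c a) (c b) (c y) ≤ keyOf (c a) (c b) (c z) := by
    obtain ⟨y, z, h1, h2, h3, h4, h5, h6⟩ := exists_eq_insert_of_card_eq_four (hc.card_group 2)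
      (mem_filter.2 ⟨mem_univ _, ha⟩) (mem_filter.2 ⟨mem_univ _, hb⟩) hab
    simp only [mem_filter, mem_univ, true_and] at h6
    rcases le_total (keyOf (c a) (c b) (c y)) (keyOf (c a) (c b) (c z)) with h | h
    · exact ⟨y, z, h1, h2, h3, h4, h5, h6, h⟩
    · exact ⟨z, y, h2, h1, h4, h3, h5.symm, fun k => by rw [h6, or_comm (a := k = y)], h⟩
  -- The key ignores permutations of positions, so sorting by `y` keeps the order of `y` and `z`
  -- already chosen.
  obtain ⟨e, he1, he2, he3⟩ := exists_relabel_eq (monotone_secondWord q) ht (c y)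
  have hf : ∀ k, freq 2 (ESW.relabel 1 e (c k)) = freq 2 (c k) := fun k => freq_relabel 1 e (c k) 2
  refine ⟨_, hc.relabel 1 e, a, b, y, z, q, hab, h1, h2, h3, h4, h5, fun k => by rw [hf, h6],
    he1, he2, by rwa [keyOf_relabel, keyOf_relabel], by simpa only [he1, he2] using he3, ?_⟩
  intro j k hjk hj hk
  rw [wt_relabel]
  rw [hf] at hj hk
  exact hmax j k hjk hj hk

theorem checkPair_eq_false_of_isTight (hc : IsTight c) :
    ∃ q, checkPair (code firstWord) (code (secondWord q)) (wt firstWord (secondWord q)) =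
      false := by
  obtain ⟨c, hc, a, b, y, z, q, hab, h1, h2, h3, h4, h5, hG, ha, hb, hkey, hmono, hmax⟩ :=
    hc.exists_normalized
  refine ⟨q, ?_⟩
  have hfreq : ∀ k (s : Fin 3), ((range 11).filter fun i => natWord (c k) i = s).card =
      freq s (c k) := by
    intro k s
    rw [card_range_filter, freq]
    simp only [natWord_coe, Fin.val_inj]
  have hfreq2 : ∀ k, ((range 11).filter fun i => natWord (c k) i = 2).card = freq 2 (c k) :=
    fun k => hfreq k 2
  have := checkPair_eq_false (w := fun k => natWord (c k)) (x := fun k => code (c k))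
    (fun k => rfl) (fun k => natWord_lt (c k)) (fun i hi s hs => ?_) (fun k s hs => ?_)
    (fun j k hjk => ?_) hab h1 h2 h3 h4 h5 (fun k => by rw [hfreq2, hG])
    (W := wt firstWord (secondWord q)) (fun j k hjk hj hk => ?_) ?_ ?_
  · rwa [ha, hb] at this
  · rw [← hc.colCount_eq ⟨i, hi⟩ ⟨s, hs⟩, colCount]
    simp only [natWord, hi, dif_pos, Fin.ext_iff]
  · have h := hfreq k ⟨s, hs⟩
    simp only at h
    rw [h]
    rcases hc.freq_eq k ⟨s, hs⟩ with h | h <;> rw [h]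
    norm_num
  · rw [← hc.agree_eq j k hjk, card_range_filter, agree]
    simp only [natWord_coe, Fin.val_inj]
  · rw [weight_code]
    rw [hfreq2] at hj hk
    exact hmax j k hjk hj hk
  · rwa [key_code, key_code]
  · exact sorted_code hmono

end ThreeEleven

/-! ### Evaluation of the eight searches. -/

section ThreeEleven

theorem code_firstWord : code firstWord = 362879242849282038339853381083848511761 := by decide +kernel

theorem code_secondWord (q : Fin 8) : code (secondWord q) =
    (![362879242849282033302816187717648449536,
      88593565169377793281033797948735761,
      361633091603233750229832576920504565761,
      88593565168093310755118431699206161,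
      340370635967533555551583212684731023361,
      340370635967534840016819527606529490961,
      88270314266244055299116307901906961,
      340365444938326830154632801757166632961] : Fin 8 → ℕ) q := by
  revert q
  decide +kernel

theorem wt_secondWord (q : Fin 8) :
    wt firstWord (secondWord q) = (![41, 29, 25, 23, 21, 21, 17, 15] : Fin 8 → ℕ) q := by
  revert q
  decide +kernel

set_option maxHeartbeats 4000000 in
set_option maxRecDepth 1000000 in
theorem checkPair_secondWord :
    checkPair (nat_lit 362879242849282038339853381083848511761)
      (nat_lit 362879242849282033302816187717648449536) (nat_lit 41) = true ∧
    checkPair (nat_lit 362879242849282038339853381083848511761)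
      (nat_lit 88593565169377793281033797948735761) (nat_lit 29) = true ∧
    checkPair (nat_lit 362879242849282038339853381083848511761)
      (nat_lit 361633091603233750229832576920504565761) (nat_lit 25) = true ∧
    checkPair (nat_lit 362879242849282038339853381083848511761)
      (nat_lit 88593565168093310755118431699206161) (nat_lit 23) = true ∧
    checkPair (nat_lit 362879242849282038339853381083848511761)
      (nat_lit 340370635967533555551583212684731023361) (nat_lit 21) = true ∧
    checkPair (nat_lit 362879242849282038339853381083848511761)
      (nat_lit 340370635967534840016819527606529490961) (nat_lit 21) = true ∧
    checkPair (nat_lit 362879242849282038339853381083848511761)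
      (nat_lit 88270314266244055299116307901906961) (nat_lit 17) = true ∧
    checkPair (nat_lit 362879242849282038339853381083848511761)
      (nat_lit 340365444938326830154632801757166632961) (nat_lit 15) = true := by
  refine ⟨?_, ?_, ?_, ?_, ?_, ?_, ?_, ?_⟩
  · decide +kernel
  · decide +kernel
  · decide +kernel
  · decide +kernel
  · decide +kernel
  · decide +kernel
  · decide +kernel
  · decide +kernel

theorem no_family_three_eleven (c : Fin 12 → Fin 11 → Fin 3) : ¬ IsFamily 3 c := by
  intro hc
  obtain ⟨q, hq⟩ := checkPair_eq_false_of_isTight hc.isTight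
  rw [code_firstWord, code_secondWord, wt_secondWord] at hq
  obtain ⟨h0, h1, h2, h3, h4, h5, h6, h7⟩ := checkPair_secondWord
  revert hq
  rw [imp_false, Bool.not_eq_false]
  fin_cases q
  exacts [h0, h1, h2, h3, h4, h5, h6, h7]

theorem A_three_eleven : A 3 11 8 = 11 :=
  A_eq_of (by norm_num) no_family_three_eleven _ isESWC_code_three_eleven.1
    isESWC_code_three_eleven.2

end ThreeEleven

/-! ### Words of length 7 over five symbols as octal numbers. -/

section BlockCodes

/-- The code of the partial word `f` on the set `S` of positions: the symbol `s` in position `i`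
is represented by the octal digit number `7 s + i`. -/
def bcode (S : Finset ℕ) (f : ℕ → ℕ) : ℕ := ∑ i ∈ S, 8 ^ (7 * f i + i)

variable {S T : Finset ℕ} {f g : ℕ → ℕ}

theorem bcode_eq_sum_two_pow (hS : S ⊆ range 7) :
    bcode S f = ∑ e ∈ S.image (fun i => 3 * (7 * f i + i)), 2 ^ e := by
  rw [sum_image, bcode]
  · refine sum_congr rfl fun i _ => ?_
    rw [pow_mul]
    norm_num
  · intro i hi j hj hij
    have h1 := mem_range.1 (hS hi)
    have h2 := mem_range.1 (hS hj)
    simp only at hij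
    omega

theorem land_bcode (hS : S ⊆ range 7) (hT : T ⊆ range 7) :
    bcode S f &&& bcode T g = bcode ((S ∩ T).filter fun i => f i = g i) f := by
  rw [bcode_eq_sum_two_pow hS, bcode_eq_sum_two_pow hT, land_sum_two_pow, bcode_eq_sum_two_pow]
  · refine sum_congr ?_ fun _ _ => rfl
    ext e
    simp only [mem_inter, mem_image, mem_filter]
    constructor
    · rintro ⟨⟨i, hi, rfl⟩, j, hj, hij⟩
      have h1 := mem_range.1 (hS hi)
      have h2 := mem_range.1 (hT hj)
      obtain rfl : j = i := by omega
      exact ⟨j, ⟨⟨hi, hj⟩, by omega⟩, rfl⟩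
    · rintro ⟨i, ⟨⟨hi, hj⟩, hij⟩, rfl⟩
      exact ⟨⟨i, hi, rfl⟩, i, hj, by rw [hij]⟩
  · exact fun i hi => hS (mem_inter.1 (mem_filter.1 hi).1).1

theorem bcode_modEq : bcode S f ≡ S.card [MOD 7] := by
  rw [bcode, card_eq_sum_ones]
  refine Nat.ModEq.sum fun i _ => ?_
  have : 8 ≡ 1 [MOD 7] := rfl
  simpa using this.pow (7 * f i + i)

/-- The number of agreements of two words, given by their codes. -/
def bagr (x y : ℕ) : ℕ := Nat.mod (Nat.land x y) (nat_lit 7)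

/-- Digit sums are taken modulo 7, so full agreement in seven positions must be excluded. -/
theorem bagr_bcode (hS : S ⊆ range 7) (hT : T ⊆ range 7)
    (h : ((S ∩ T).filter fun i => f i = g i).card < 7) :
    bagr (bcode S f) (bcode T g) = ((S ∩ T).filter fun i => f i = g i).card := by
  have h1 : bagr (bcode S f) (bcode T g) = (bcode S f &&& bcode T g) % 7 := rfl
  rw [h1, land_bcode hS hT, bcode_modEq, Nat.mod_eq_of_lt h]

end BlockCodes

/-! ### The search for fifteen words containing a fixed Fano plane. -/

section SevenCheck

/-- Whether the code `z` has at most `b` agreements with each of the codes in `xs`. -/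
noncomputable def agreeLe (b : ℕ) (xs : List ℕ) (z : ℕ) : Bool :=
  List.rec (motive := fun _ => Bool) true (fun x _ ih => Bool.rec false ih
    (Nat.ble (Nat.mod (Nat.land x z) (nat_lit 7)) b)) xs

noncomputable def extendWord (b y : ℕ) (opts : List (ℕ × List ℕ)) :
    List ℕ → (List ℕ → Bool) → Bool :=
  List.rec (motive := fun _ => List ℕ → (List ℕ → Bool) → Bool) (fun acc k => k acc)
    (fun a _ ih acc k => push (agreeLe b a.2) (Nat.add y a.1) acc fun acc => ih acc k) opts

noncomputable def extendWords (b : ℕ) (opts : List (ℕ × List ℕ)) (L : List ℕ) :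
    List ℕ → (List ℕ → Bool) → Bool :=
  List.rec (motive := fun _ => List ℕ → (List ℕ → Bool) → Bool) (fun acc k => k acc)
    (fun y _ ih acc k => extendWord b y opts acc fun acc => ih acc k) L

/-- Extends the partial words with codes in `L` by further positions with the given options, as
long as they have at most `b` agreements with the given codes. -/
noncomputable def generateWords (b : ℕ) (cols : List (List (ℕ × List ℕ))) :
    List ℕ → (List ℕ → Bool) → Bool :=
  List.rec (motive := fun _ => List ℕ → (List ℕ → Bool) → Bool) (fun L k => k L)
    (fun opts _ ih L k => extendWords b opts L [] fun L' => ih L' k) cols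

/-- The powers of `16` that represent the symbols `0` to `4` in the seven positions. -/
def symbolPowers : List (List (ℕ × List ℕ)) :=
  [[(nat_lit 1, [nat_lit 5071995088179498156132948508673]),
    (nat_lit 2097152, [nat_lit 89286727566065877489001955392]),
    (nat_lit 4398046511104, [nat_lit 714293820519303652273207378432]),
    (nat_lit 9223372036854775808, [nat_lit 5714331221350538756155718504448]),
    (nat_lit 19342813113834066795298816,
      [nat_lit 5149849906314083035418040762368, nat_lit 633999386022437269516618825728,
       nat_lit 11160840945758235235880796168])],
   [(nat_lit 8, [nat_lit 11160840945758235235880796168]),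
    (nat_lit 16777216, [nat_lit 714293820519303652273207378432]),
    (nat_lit 35184372088832, [nat_lit 5714331221350538756155718504448]),
    (nat_lit 73786976294838206464, [nat_lit 5149849906314083035418040762368]),
    (nat_lit 154742504910672534362390528,
      [nat_lit 633999386022437269516618825728, nat_lit 5071995088179498156132948508673,
       nat_lit 89286727566065877489001955392])],
   [(nat_lit 64, [nat_lit 89286727566065877489001955392]),
    (nat_lit 134217728, [nat_lit 5714331221350538756155718504448]),
    (nat_lit 281474976710656, [nat_lit 5149849906314083035418040762368]),
    (nat_lit 590295810358705651712, [nat_lit 633999386022437269516618825728]),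
    (nat_lit 1237940039285380274899124224,
      [nat_lit 5071995088179498156132948508673, nat_lit 11160840945758235235880796168,
       nat_lit 714293820519303652273207378432])],
   [(nat_lit 512, [nat_lit 714293820519303652273207378432]),
    (nat_lit 1073741824, [nat_lit 5149849906314083035418040762368]),
    (nat_lit 2251799813685248, [nat_lit 633999386022437269516618825728]),
    (nat_lit 4722366482869645213696, [nat_lit 5071995088179498156132948508673]),
    (nat_lit 9903520314283042199192993792,
      [nat_lit 11160840945758235235880796168, nat_lit 89286727566065877489001955392,
       nat_lit 5714331221350538756155718504448])],
   [(nat_lit 4096, [nat_lit 5714331221350538756155718504448]),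
    (nat_lit 8589934592, [nat_lit 633999386022437269516618825728]),
    (nat_lit 18014398509481984, [nat_lit 5071995088179498156132948508673]),
    (nat_lit 37778931862957161709568, [nat_lit 11160840945758235235880796168]),
    (nat_lit 79228162514264337593543950336,
      [nat_lit 5149849906314083035418040762368, nat_lit 89286727566065877489001955392,
       nat_lit 714293820519303652273207378432])],
   [(nat_lit 32768, [nat_lit 5149849906314083035418040762368]),
    (nat_lit 68719476736, [nat_lit 5071995088179498156132948508673]),
    (nat_lit 144115188075855872, [nat_lit 11160840945758235235880796168]),
    (nat_lit 302231454903657293676544, [nat_lit 89286727566065877489001955392]),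
    (nat_lit 633825300114114700748351602688,
      [nat_lit 633999386022437269516618825728, nat_lit 714293820519303652273207378432,
       nat_lit 5714331221350538756155718504448])],
   [(nat_lit 262144, [nat_lit 633999386022437269516618825728]),
    (nat_lit 549755813888, [nat_lit 11160840945758235235880796168]),
    (nat_lit 1152921504606846976, [nat_lit 89286727566065877489001955392]),
    (nat_lit 2417851639229258349412352, [nat_lit 714293820519303652273207378432]),
    (nat_lit 5070602400912917605986812821504,
      [nat_lit 5149849906314083035418040762368, nat_lit 5071995088179498156132948508673,
       nat_lit 5714331221350538756155718504448])]]

/-- The codes of the points of the Fano plane. -/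
def pointCodes : List ℕ :=
  [nat_lit 5149849906314083035418040762368, nat_lit 633999386022437269516618825728,
   nat_lit 5071995088179498156132948508673, nat_lit 11160840945758235235880796168,
   nat_lit 89286727566065877489001955392, nat_lit 714293820519303652273207378432,
   nat_lit 5714331221350538756155718504448]

/-- Whether the code `z` has exactly one agreement with each of the codes in `xs`. -/
noncomputable def agreeOnce (xs : List ℕ) (z : ℕ) : Bool :=
  List.rec (motive := fun _ => Bool) true (fun x _ ih => Bool.rec false ih
    (Nat.beq (Nat.mod (Nat.land x z) (nat_lit 7)) (nat_lit 1))) xs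

/-- Whether the code `z` has one or two agreements with each of the codes in `xs`. -/
noncomputable def agreeTwice (xs : List ℕ) (z : ℕ) : Bool :=
  List.rec (motive := fun _ => Bool) true (fun x _ ih => Bool.rec false ih
    -- `(k + 1) / 2 = 1` holds exactly for `k = 1` and `k = 2`.
    (Nat.beq (Nat.div (Nat.add (Nat.mod (Nat.land x z) (nat_lit 7)) (nat_lit 1)) (nat_lit 2))
      (nat_lit 1))) xs

/-- Whether `p` holds for every entry of the list together with the remainder of the list. -/
noncomputable def checkTails (p : ℕ → List ℕ → Bool) (l : List ℕ) : Bool :=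
  List.rec (motive := fun _ => Bool) true (fun x tl ih => Bool.rec false (delay ih) (p x tl)) l

/-- Runs over all choices of two words from each of the lists in `Ls` such that different words
agree exactly once. -/
noncomputable def choosePairs (leaf : List ℕ → Bool) (Ls : List (List ℕ)) : List ℕ → Bool :=
  List.rec (motive := fun _ => List ℕ → Bool) leaf
    (fun L _ ih acc => checkTails (fun x tl =>
      checkList (fun y => ih (y :: x :: acc)) (sift (agreeOnce [x]) tl))
      (sift (agreeOnce acc) L)) Ls

noncomputable def siftAll (p : ℕ → Bool) (Ls : List (List ℕ)) : List (List ℕ) :=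
  List.rec (motive := fun _ => List (List ℕ)) [] (fun L _ ih => sift p L :: ih) Ls

/-- The entries of the list that satisfy `p`, in reversed order, followed by `acc`. -/
noncomputable def collect (p : ℕ → Bool) (l : List ℕ) : List ℕ → (List ℕ → Bool) → Bool :=
  List.rec (motive := fun _ => List ℕ → (List ℕ → Bool) → Bool) (fun acc k => k acc)
    (fun y _ ih acc k => Bool.rec (delay (ih acc k)) (delay (ih (y :: acc) k)) (p y)) l

/-- Refutes the existence of `n` pairwise disjoint words, one from each list. -/
noncomputable def noTransversal (n : ℕ) : List (List ℕ) → Bool :=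
  Nat.rec (motive := fun _ => List (List ℕ) → Bool) (fun _ => false)
    (fun _ ih Ls => List.rec (motive := fun _ => Bool) false
      (fun L Ls' _ => checkList (fun s =>
        ih (siftAll (fun z => Nat.beq (Nat.land s z) (nat_lit 0)) Ls')) L) Ls) n

/-- The sublists of the codes that contain the given powers. -/
noncomputable def splitBy (ms : List ℕ) (L : List ℕ) : List (List ℕ) :=
  List.rec (motive := fun _ => List (List ℕ)) []
    (fun m _ ih => sift (fun z => Nat.beq (Nat.land z m) m) L :: ih) ms

/-- `choosePairs` selects the eight words off the plane, two for each of the symbols 0 to 3 in the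
first position (symbol 4 is used up by a line). `noTransversal` then looks for five disjoint words,
one per first symbol, that agree once or twice with everything chosen; they stand for the constant
words. -/
noncomputable def checkSeven : Bool :=
  generateWords (nat_lit 1) symbolPowers [nat_lit 0] fun X =>
  generateWords (nat_lit 2) symbolPowers [nat_lit 0] fun Y =>
  collect (agreeTwice pointCodes) Y [] fun Y =>
  choosePairs (fun acc => collect (agreeTwice acc) Y [] fun Y =>
    noTransversal (nat_lit 5) (splitBy
      [nat_lit 19342813113834066795298816, nat_lit 1, nat_lit 2097152, nat_lit 4398046511104,
   nat_lit 9223372036854775808] Y))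
    (splitBy [nat_lit 1, nat_lit 2097152, nat_lit 4398046511104, nat_lit 9223372036854775808] (sift (agreeOnce pointCodes) X)) []

/-- The block of the Fano plane with lines `{i, i + 1, i + 3}` that contains the point `p` in
position `i`: the line (number `4`) or one of the four points off the line. -/
def blockOf (p i : ℕ) : ℕ := [4, 4, 0, 4, 1, 2, 3].getD ((p + 7 - i) % 7) 0

theorem pointCodes_eq : pointCodes = (List.range 7).map fun p => bcode (range 7) (blockOf p) := by
  decide +kernel

/-- Each option is a power of 8 together with the points having that symbol in that position, the
only points whose agreement count the new entry increases. -/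
theorem symbolPowers_eq : symbolPowers = (List.range 7).map fun i => (List.range 5).map fun s =>
    (8 ^ (7 * s + i), ((List.range 7).filter fun p => blockOf p i = s).map fun p =>
      bcode (range 7) (blockOf p)) := by
  decide +kernel

theorem bagr_range {f g : ℕ → ℕ} (h : ((range 7).filter fun i => f i = g i).card < 7) :
    bagr (bcode (range 7) f) (bcode (range 7) g) = ((range 7).filter fun i => f i = g i).card := by
  have := bagr_bcode (S := range 7) (T := range 7) (f := f) (g := g) (Subset.refl _)
    (Subset.refl _) (by rwa [inter_self])
  rwa [inter_self] at this

theorem agreeLe_eq_true {b : ℕ} {xs : List ℕ} {z : ℕ} (h : ∀ x ∈ xs, bagr x z ≤ b) :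
    agreeLe b xs z = true := by
  induction xs with
  | nil => rfl
  | cons x xs ih =>
    have heq : agreeLe b (x :: xs) z = Bool.rec false (agreeLe b xs z)
      (Nat.ble (bagr x z) b) := rfl
    rw [heq, ble_iff.2 (h x List.mem_cons_self), ih fun y hy => h y (List.mem_cons_of_mem _ hy)]

theorem agreeOnce_eq_true {xs : List ℕ} {z : ℕ} (h : ∀ x ∈ xs, bagr x z = 1) :
    agreeOnce xs z = true := by
  induction xs with
  | nil => rfl
  | cons x xs ih =>
    have heq : agreeOnce (x :: xs) z = Bool.rec false (agreeOnce xs z)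
      (Nat.beq (bagr x z) 1) := rfl
    rw [heq, beq_iff.2 (h x List.mem_cons_self), ih fun y hy => h y (List.mem_cons_of_mem _ hy)]

theorem agreeTwice_eq_true {xs : List ℕ} {z : ℕ} (h : ∀ x ∈ xs, bagr x z = 1 ∨ bagr x z = 2) :
    agreeTwice xs z = true := by
  induction xs with
  | nil => rfl
  | cons x xs ih =>
    have heq : agreeTwice (x :: xs) z = Bool.rec false (agreeTwice xs z)
      (Nat.beq ((bagr x z + 1) / 2) 1) := rfl
    have hx : (bagr x z + 1) / 2 = 1 := by
      have := h x List.mem_cons_self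
      omega
    rw [heq, beq_iff.2 hx, ih fun y hy => h y (List.mem_cons_of_mem _ hy)]

theorem extendWord_spec (b y : ℕ) (opts : List (ℕ × List ℕ)) : ∀ acc : List ℕ, ∃ L',
    (∀ k, extendWord b y opts acc k = k L') ∧ (∀ z ∈ acc, z ∈ L') ∧
      ∀ a ∈ opts, agreeLe b a.2 (y + a.1) = true → y + a.1 ∈ L' := by
  induction opts with
  | nil => exact fun acc => ⟨acc, fun _ => rfl, fun _ h => h, by simp⟩
  | cons a opts ih =>
    intro acc
    obtain ⟨L1, h1, h1', h1''⟩ := push_spec (agreeLe b a.2) (y + a.1) acc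
    obtain ⟨L2, h2, h2', h2''⟩ := ih L1
    refine ⟨L2, fun k => ?_, fun z hz => h2' z (h1' z hz), fun a' ha' h => ?_⟩
    · have : extendWord b y (a :: opts) acc k = push (agreeLe b a.2) (y + a.1) acc fun acc =>
        extendWord b y opts acc k := rfl
      rw [this, h1, h2]
    · rcases List.mem_cons.1 ha' with rfl | ha'
      · exact h2' _ (h1'' h)
      · exact h2'' a' ha' h

theorem extendWords_spec (b : ℕ) (opts : List (ℕ × List ℕ)) (L : List ℕ) : ∀ acc : List ℕ, ∃ L',
    (∀ k, extendWords b opts L acc k = k L') ∧ (∀ z ∈ acc, z ∈ L') ∧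
      ∀ y ∈ L, ∀ a ∈ opts, agreeLe b a.2 (y + a.1) = true → y + a.1 ∈ L' := by
  induction L with
  | nil => exact fun acc => ⟨acc, fun _ => rfl, fun _ h => h, by simp⟩
  | cons y L ih =>
    intro acc
    obtain ⟨L1, h1, h1', h1''⟩ := extendWord_spec b y opts acc
    obtain ⟨L2, h2, h2', h2''⟩ := ih L1
    refine ⟨L2, fun k => ?_, fun z hz => h2' z (h1' z hz), fun y' hy' a ha h => ?_⟩
    · have : extendWords b opts (y :: L) acc k = extendWord b y opts acc fun acc =>
        extendWords b opts L acc k := rfl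
      rw [this, h1, h2]
    · rcases List.mem_cons.1 hy' with rfl | hy'
      · exact h2' _ (h1'' a ha h)
      · exact h2'' y' hy' a ha h

theorem bcode_range_succ (f : ℕ → ℕ) (n : ℕ) :
    bcode (range (n + 1)) f = bcode (range n) f + 8 ^ (7 * f n + n) := sum_range_succ _ _

theorem generateWords_spec (b : ℕ) (cols : List (List (ℕ × List ℕ))) : ∀ (j : ℕ) (L : List ℕ),
    ∃ L', (∀ k, generateWords b cols L k = k L') ∧
      ∀ f : ℕ → ℕ, bcode (range j) f ∈ L →
        (∀ i (hi : i < cols.length), ∃ a ∈ cols[i], a.1 = 8 ^ (7 * f (j + i) + (j + i)) ∧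
          agreeLe b a.2 (bcode (range (j + i + 1)) f) = true) →
        bcode (range (j + cols.length)) f ∈ L' := by
  induction cols with
  | nil => exact fun j L => ⟨L, fun _ => rfl, fun f h _ => h⟩
  | cons opts cols ih =>
    intro j L
    obtain ⟨L1, h1, -, h1'⟩ := extendWords_spec b opts L []
    obtain ⟨L', h2, h2'⟩ := ih (j + 1) L1
    refine ⟨L', fun k => ?_, fun f hL h => ?_⟩
    · have : generateWords b (opts :: cols) L k = extendWords b opts L [] fun L' =>
        generateWords b cols L' k := rfl
      rw [this, h1, h2]
    · have h3 := h2' f (by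
        obtain ⟨a, ha, ha1, ha2⟩ := h 0 (by simp)
        rw [bcode_range_succ] at ha2 ⊢
        simp only [add_zero] at ha1 ha2
        rw [← ha1] at ha2 ⊢
        exact h1' _ hL a ha ha2) (fun i hi => by
        have h4 := h (i + 1) (by simpa using hi)
        rw [List.getElem_cons_succ] at h4
        rwa [show j + 1 + i = j + (i + 1) by ring])
      rwa [List.length_cons, show j + (cols.length + 1) = j + 1 + cols.length by ring]

theorem exists_generateWords (b : ℕ) : ∃ L', (∀ k, generateWords b symbolPowers [nat_lit 0] k =
    k L') ∧ ∀ f : ℕ → ℕ, (∀ i, f i < 5) →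
      (∀ p < 7, ((range 7).filter fun i => blockOf p i = f i).card ≤ b) → b < 7 →
      bcode (range 7) f ∈ L' := by
  obtain ⟨L', h1, h2⟩ := generateWords_spec b symbolPowers 0 [nat_lit 0]
  refine ⟨L', h1, fun f hf hb hb7 => h2 f (List.mem_singleton.2 rfl) fun i hi => ?_⟩
  simp only [symbolPowers_eq, List.length_map, List.length_range, List.getElem_map,
    List.getElem_range, zero_add] at hi ⊢
  refine ⟨_, List.mem_map.2 ⟨f i, List.mem_range.2 (hf i), rfl⟩, rfl, agreeLe_eq_true ?_⟩
  intro x hx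
  simp only [List.mem_map, List.mem_filter, List.mem_range] at hx
  obtain ⟨p, ⟨hp, -⟩, rfl⟩ := hx
  have hsub : range (i + 1) ⊆ range 7 := range_subset_range.2 hi
  have hle : ((range 7 ∩ range (i + 1)).filter fun i => blockOf p i = f i).card ≤ b :=
    (card_le_card (filter_subset_filter _ inter_subset_left)).trans (hb p hp)
  rw [bagr_bcode (Subset.refl _) hsub (hle.trans_lt hb7)]
  exact hle

/-- Whichever of the two entries comes first has the other in its tail. -/
theorem checkTails_spec {p : ℕ → List ℕ → Bool} {l : List ℕ} (h : checkTails p l = true) {x y : ℕ}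
    (hx : x ∈ l) (hy : y ∈ l) (hxy : x ≠ y) : ∃ tl, (y ∈ tl ∧ p x tl = true) ∨
      (x ∈ tl ∧ p y tl = true) := by
  induction l with
  | nil => exact absurd hx List.not_mem_nil
  | cons z l ih =>
    have heq : checkTails p (z :: l) = Bool.rec false (checkTails p l) (p z l) := rfl
    rw [heq] at h
    cases hz : p z l with
    | false =>
      rw [hz] at h
      exact absurd h Bool.false_ne_true
    | true =>
      rw [hz] at h
      rcases List.mem_cons.1 hx with rfl | hx'
      · rcases List.mem_cons.1 hy with rfl | hy'
        · exact absurd rfl hxy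
        · exact ⟨l, Or.inl ⟨hy', hz⟩⟩
      · rcases List.mem_cons.1 hy with rfl | hy'
        · exact ⟨l, Or.inr ⟨hx', hz⟩⟩
        · exact ih h hx' hy'

/-- No word satisfying `P` lies in two of the lists, so words taken from different lists are
distinct and pass the test of agreeing once. -/
theorem choosePairs_spec {P : ℕ → Prop} (hP : ∀ x y, P x → P y → x ≠ y → bagr x y = 1)
    {leaf : List ℕ → Bool} {Ls : List (List ℕ)} :
    ∀ {acc : List ℕ}, Ls.Pairwise (fun L L' => ∀ z, P z → z ∈ L → z ∉ L') →
      (∀ L ∈ Ls, ∃ x ∈ L, ∃ y ∈ L, x ≠ y ∧ P x ∧ P y) → (∀ x ∈ acc, P x) →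
      (∀ L ∈ Ls, ∀ z ∈ acc, z ∉ L) →
      choosePairs leaf Ls acc = true → ∃ acc', (∀ x ∈ acc', P x) ∧ leaf acc' = true := by
  induction Ls with
  | nil => exact fun {acc} _ _ hacc _ h => ⟨acc, hacc, h⟩
  | cons L Ls ih =>
    intro acc hpw hL hacc hdis h
    have heq : choosePairs leaf (L :: Ls) acc = checkTails (fun x tl =>
      checkList (fun y => choosePairs leaf Ls (y :: x :: acc)) (sift (agreeOnce [x]) tl))
      (sift (agreeOnce acc) L) := rfl
    rw [heq] at h
    obtain ⟨hpw1, hpw2⟩ := List.pairwise_cons.1 hpw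
    obtain ⟨x, hx, y, hy, hxy, hPx, hPy⟩ := hL L List.mem_cons_self
    have hsift : ∀ z ∈ L, P z → z ∈ sift (agreeOnce acc) L := fun z hz hPz =>
      mem_sift.2 ⟨hz, agreeOnce_eq_true fun w hw => hP w z (hacc w hw) hPz
        fun hwz => hdis L List.mem_cons_self w hw (hwz ▸ hz)⟩
    have key : ∀ x y, x ∈ L → y ∈ L → x ≠ y → P x → P y → (∃ tl, y ∈ tl ∧
        checkList (fun y => choosePairs leaf Ls (y :: x :: acc)) (sift (agreeOnce [x]) tl) = true) →
        ∃ acc', (∀ x ∈ acc', P x) ∧ leaf acc' = true := by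
      rintro x y hx hy hxy hPx hPy ⟨tl, hytl, htl⟩
      have h1 := checkList_mem htl y (mem_sift.2 ⟨hytl, agreeOnce_eq_true fun w hw => by
        rw [List.mem_singleton.1 hw]
        exact hP x y hPx hPy hxy⟩)
      refine ih hpw2 (fun L' hL' => hL L' (List.mem_cons_of_mem _ hL')) ?_ ?_ h1
      · intro w hw
        rcases List.mem_cons.1 hw with rfl | hw
        · exact hPy
        rcases List.mem_cons.1 hw with rfl | hw
        · exact hPx
        · exact hacc w hw
      · intro L' hL' w hw hwL'
        rcases List.mem_cons.1 hw with rfl | hw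
        · exact hpw1 L' hL' _ hPy hy hwL'
        rcases List.mem_cons.1 hw with rfl | hw
        · exact hpw1 L' hL' _ hPx hx hwL'
        · exact hdis L' (List.mem_cons_of_mem _ hL') w hw hwL'
    obtain ⟨tl, ⟨h1, h2⟩ | ⟨h1, h2⟩⟩ :=
      checkTails_spec h (hsift x hx hPx) (hsift y hy hPy) hxy
    · exact key x y hx hy hxy hPx hPy ⟨tl, h1, h2⟩
    · exact key y x hy hx hxy.symm hPy hPx ⟨tl, h1, h2⟩

theorem siftAll_eq (p : ℕ → Bool) (Ls : List (List ℕ)) : siftAll p Ls = Ls.map (sift p) := by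
  induction Ls with
  | nil => rfl
  | cons L Ls ih =>
    rw [List.map_cons, ← ih]
    rfl

theorem collect_spec (p : ℕ → Bool) (l : List ℕ) : ∀ acc : List ℕ, ∃ L',
    (∀ k, collect p l acc k = k L') ∧ ∀ z, z ∈ acc ∨ (z ∈ l ∧ p z = true) → z ∈ L' := by
  induction l with
  | nil => exact fun acc => ⟨acc, fun _ => rfl, by simp⟩
  | cons y l ih =>
    intro acc
    have heq : ∀ k, collect p (y :: l) acc k =
      Bool.rec (collect p l acc k) (collect p l (y :: acc) k) (p y) := fun _ => rfl
    cases hy : p y with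
    | false =>
      obtain ⟨L', h1, h2⟩ := ih acc
      refine ⟨L', fun k => by rw [heq, hy, h1], fun z hz => h2 z ?_⟩
      rcases hz with hz | ⟨hz, hpz⟩
      · exact Or.inl hz
      rcases List.mem_cons.1 hz with rfl | hz
      · rw [hy] at hpz
        exact absurd hpz Bool.false_ne_true
      · exact Or.inr ⟨hz, hpz⟩
    | true =>
      obtain ⟨L', h1, h2⟩ := ih (y :: acc)
      refine ⟨L', fun k => by rw [heq, hy, h1], fun z hz => h2 z ?_⟩
      rcases hz with hz | ⟨hz, hpz⟩
      · exact Or.inl (List.mem_cons_of_mem _ hz)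
      rcases List.mem_cons.1 hz with rfl | hz
      · exact Or.inl List.mem_cons_self
      · exact Or.inr ⟨hz, hpz⟩

theorem noTransversal_eq_false {n : ℕ} : ∀ {Ls : List (List ℕ)} {zs : List ℕ},
    zs.Pairwise (fun x y => Nat.land x y = 0) → List.Forall₂ (fun z L => z ∈ L) zs Ls →
    Ls.length = n → noTransversal n Ls = false := by
  induction n with
  | zero => exact fun _ _ _ => rfl
  | succ n ih =>
    intro Ls zs hpw hf hn
    cases hf with
    | nil => exact absurd hn (by simp)
    | @cons z L zs Ls hz hf =>
      obtain ⟨h1, h2⟩ := List.pairwise_cons.1 hpw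
      have heq : noTransversal (n + 1) (L :: Ls) = checkList (fun s =>
        noTransversal n (siftAll (fun z => Nat.beq (Nat.land s z) (nat_lit 0)) Ls)) L := rfl
      rw [heq, ← Bool.not_eq_true]
      intro h
      have h3 := checkList_mem h z hz
      rw [siftAll_eq, ih h2 ?_ (by simpa using hn)] at h3
      · exact Bool.false_ne_true h3
      · rw [List.forall₂_map_right_iff]
        refine List.Forall₂.imp ?_ ((List.forall₂_and_left _ _).2 ⟨h1, hf⟩)
        exact fun a L ⟨ha, hL⟩ => mem_sift.2 ⟨hL, beq_iff.2 ha⟩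

theorem splitBy_eq (ms L : List ℕ) :
    splitBy ms L = ms.map fun m => sift (fun z => Nat.beq (Nat.land z m) m) L := by
  induction ms with
  | nil => rfl
  | cons m ms ih =>
    rw [List.map_cons, ← ih]
    rfl

theorem land_bcode_pow {f : ℕ → ℕ} (j : ℕ) :
    Nat.land (bcode (range 7) f) (8 ^ (7 * j)) = if f 0 = j then 8 ^ (7 * j) else 0 := by
  have h1 : 8 ^ (7 * j) = bcode {0} fun _ => j := by simp [bcode]
  have h2 : Nat.land (bcode (range 7) f) (8 ^ (7 * j)) =
      bcode (range 7) f &&& bcode {0} fun _ => j := by rw [h1]; rfl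
  rw [h2, land_bcode (Subset.refl _) (by simp)]
  have h3 : range 7 ∩ {0} = {0} := by decide
  rw [h3, filter_singleton]
  split
  · next h => simp [bcode, h]
  · next h => simp [bcode]

theorem mem_sift_pow {f : ℕ → ℕ} {j : ℕ} {L : List ℕ} :
    bcode (range 7) f ∈ sift (fun z => Nat.beq (Nat.land z (8 ^ (7 * j))) (8 ^ (7 * j))) L ↔
      bcode (range 7) f ∈ L ∧ f 0 = j := by
  rw [mem_sift, beq_iff, land_bcode_pow]
  refine and_congr_right fun _ => ?_
  split
  · next h => simp [h]
  · next h => simpa [h] using (pow_pos (by norm_num : 0 < 8) (7 * j)).ne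

/-- `P` describes the words off the plane and `σ j` the renamed constant words; together they form a
branch that the search cannot refute. -/
theorem checkSeven_eq_false {P : (ℕ → ℕ) → Prop} {σ : ℕ → ℕ → ℕ}
    (hP : ∀ t, P t → ∀ i, t i < 5)
    (hPF : ∀ t, P t → ∀ p < 7, ((range 7).filter fun i => blockOf p i = t i).card = 1)
    (hPP : ∀ t t', P t → P t' → t ≠ t' → ((range 7).filter fun i => t i = t' i).card = 1)
    (hP0 : ∀ j < 4, ∃ t t', P t ∧ P t' ∧ t ≠ t' ∧ t 0 = j ∧ t' 0 = j)
    (hσ : ∀ j i, σ j i < 5)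
    (hσF : ∀ j < 5, ∀ p < 7, ((range 7).filter fun i => blockOf p i = σ j i).card = 1 ∨
      ((range 7).filter fun i => blockOf p i = σ j i).card = 2)
    (hσP : ∀ j < 5, ∀ t, P t → ((range 7).filter fun i => t i = σ j i).card = 1 ∨
      ((range 7).filter fun i => t i = σ j i).card = 2)
    (hσσ : ∀ j < 5, ∀ k < 5, j ≠ k → ∀ i < 7, σ j i ≠ σ k i)
    (hσ0 : ∀ j < 5, σ j 0 = j) : checkSeven = false := by
  rw [← Bool.not_eq_true]
  intro h
  unfold checkSeven at h
  obtain ⟨X, hX, hXmem⟩ := exists_generateWords 1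
  obtain ⟨Y, hY, hYmem⟩ := exists_generateWords 2
  obtain ⟨Y', hY', hYmem'⟩ := collect_spec (agreeTwice pointCodes) Y []
  rw [hX, hY, hY'] at h
  have hone : ∀ {f g : ℕ → ℕ}, ((range 7).filter fun i => f i = g i).card = 1 →
      bagr (bcode (range 7) f) (bcode (range 7) g) = 1 := by
    intro f g hfg
    rw [bagr_range (by omega), hfg]
  have htwo : ∀ {f g : ℕ → ℕ}, ((range 7).filter fun i => f i = g i).card = 1 ∨
      ((range 7).filter fun i => f i = g i).card = 2 →
      bagr (bcode (range 7) f) (bcode (range 7) g) = 1 ∨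
      bagr (bcode (range 7) f) (bcode (range 7) g) = 2 := by
    intro f g hfg
    rw [bagr_range (by omega)]
    exact hfg
  -- Seven agreements vanish modulo 7, so a code is told apart from the codes it agrees with once.
  have hself : ∀ f : ℕ → ℕ, bagr (bcode (range 7) f) (bcode (range 7) f) = 0 := by
    intro f
    have h1 : bagr (bcode (range 7) f) (bcode (range 7) f) =
      (bcode (range 7) f &&& bcode (range 7) f) % 7 := rfl
    rw [h1, Nat.and_self, bcode_modEq, card_range]
  have hmemX : ∀ t, P t → bcode (range 7) t ∈ sift (agreeOnce pointCodes) X := by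
    intro t ht
    refine mem_sift.2 ⟨hXmem t (hP t ht) (fun p hp => (hPF t ht p hp).le) (by norm_num),
      agreeOnce_eq_true fun x hx => ?_⟩
    rw [pointCodes_eq, List.mem_map] at hx
    obtain ⟨p, hp, rfl⟩ := hx
    exact hone (hPF t ht p (List.mem_range.1 hp))
  have hmemY : ∀ j < 5, bcode (range 7) (σ j) ∈ Y' := by
    intro j hj
    refine hYmem' _ (Or.inr ⟨hYmem (σ j) (hσ j) (fun p hp => ?_) (by norm_num),
      agreeTwice_eq_true fun x hx => ?_⟩)
    · have := hσF j hj p hp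
      omega
    · rw [pointCodes_eq, List.mem_map] at hx
      obtain ⟨p, hp, rfl⟩ := hx
      exact htwo (hσF j hj p (List.mem_range.1 hp))
  have hpow : ∀ L : List ℕ, splitBy [nat_lit 1, nat_lit 2097152, nat_lit 4398046511104,
      nat_lit 9223372036854775808] L = [0, 1, 2, 3].map fun j =>
        sift (fun z => Nat.beq (Nat.land z (8 ^ (7 * j))) (8 ^ (7 * j))) L := by
    intro L
    rw [splitBy_eq, show [nat_lit 1, nat_lit 2097152, nat_lit 4398046511104,
      nat_lit 9223372036854775808] = [0, 1, 2, 3].map fun j => 8 ^ (7 * j) by decide +kernel,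
      List.map_map]
    rfl
  have hpow' : ∀ L : List ℕ, splitBy [nat_lit 19342813113834066795298816, nat_lit 1,
      nat_lit 2097152, nat_lit 4398046511104, nat_lit 9223372036854775808] L =
        [4, 0, 1, 2, 3].map fun j =>
        sift (fun z => Nat.beq (Nat.land z (8 ^ (7 * j))) (8 ^ (7 * j))) L := by
    intro L
    rw [splitBy_eq, show [nat_lit 19342813113834066795298816, nat_lit 1, nat_lit 2097152,
      nat_lit 4398046511104, nat_lit 9223372036854775808] =
      [4, 0, 1, 2, 3].map fun j => 8 ^ (7 * j) by decide +kernel, List.map_map]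
    rfl
  rw [hpow] at h
  obtain ⟨acc, hacc, hleaf⟩ := choosePairs_spec
    (P := fun x => ∃ t, P t ∧ x = bcode (range 7) t) (by
      rintro _ _ ⟨t, ht, rfl⟩ ⟨t', ht', rfl⟩ hne
      exact hone (hPP t t' ht ht' fun h => hne (h ▸ rfl))) (by
      rw [List.pairwise_map]
      refine List.Pairwise.imp (R := (· ≠ ·)) ?_ (by decide)
      rintro j k hjk _ ⟨t, ht, rfl⟩ h1 h2
      exact hjk ((mem_sift_pow.1 h1).2.symm.trans (mem_sift_pow.1 h2).2)) (by
      intro L hL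
      obtain ⟨j, hj, rfl⟩ := List.mem_map.1 hL
      have hj4 : j < 4 := by
        simp only [List.mem_cons, List.not_mem_nil, or_false] at hj
        omega
      obtain ⟨t, t', ht, ht', hne, h0, h0'⟩ := hP0 j hj4
      refine ⟨_, mem_sift_pow.2 ⟨hmemX t ht, h0⟩, _, mem_sift_pow.2 ⟨hmemX t' ht', h0'⟩,
        fun heq => ?_, ⟨t, ht, rfl⟩, t', ht', rfl⟩
      have h1 := hone (hPP t t' ht ht' hne)
      rw [← heq, hself] at h1
      exact absurd h1 (by norm_num)) (by simp) (by simp) h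
  obtain ⟨Z, hZ, hZmem⟩ := collect_spec (agreeTwice acc) Y' []
  have hmemZ : ∀ j < 5, bcode (range 7) (σ j) ∈ Z := by
    intro j hj
    refine hZmem _ (Or.inr ⟨hmemY j hj, agreeTwice_eq_true fun x hx => ?_⟩)
    obtain ⟨t, ht, rfl⟩ := hacc x hx
    exact htwo (hσP j hj t ht)
  rw [hZ, hpow', noTransversal_eq_false
    (zs := [4, 0, 1, 2, 3].map fun j => bcode (range 7) (σ j))] at hleaf
  · exact Bool.false_ne_true hleaf
  · rw [List.pairwise_map]
    refine List.Pairwise.imp_of_mem (R := (· ≠ ·)) ?_ (by decide)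
    intro j k hj hk hjk
    have hj5 : j < 5 := by
      simp only [List.mem_cons, List.not_mem_nil, or_false] at hj
      omega
    have hk5 : k < 5 := by
      simp only [List.mem_cons, List.not_mem_nil, or_false] at hk
      omega
    change bcode (range 7) (σ j) &&& bcode (range 7) (σ k) = 0
    rw [land_bcode (Subset.refl _) (Subset.refl _), filter_false_of_mem, bcode, sum_empty]
    intro i hi
    exact hσσ j hj5 k hk5 hjk i (by simpa using hi)
  · rw [List.forall₂_map_left_iff, List.forall₂_map_right_iff, List.forall₂_same]
    intro j hj
    have hj5 : j < 5 := by
      simp only [List.mem_cons, List.not_mem_nil, or_false] at hj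
      omega
    exact mem_sift_pow.2 ⟨hmemZ j hj5, hσ0 j hj5⟩
  · rfl

end SevenCheck

/-! ### A Gauss sum over the field with two elements. -/

section GaussSum

/-- The Gauss sum of a quadratic form with a totally singular subspace of half the dimension. -/
theorem gauss_sum_eq_card {V X : Type*} [AddCommGroup V] [Fintype V] [DecidableEq V]
    [AddCommGroup X] [Fintype X] (L : X →+ V) {S : V → ℤ} {B : V → V → ℤ}
    (hS : ∀ v w, S (v + w) = S v * S w * B v w) (hB : ∀ v w w', B v (w + w') = B v w * B v w')
    (hB1 : ∀ v w, B v w = 1 ∨ B v w = -1) (hB0 : ∀ w, w ≠ 0 → ∑ v, B v w = 0)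
    (hSL : ∀ x, S (L x) = 1) (hL : Function.Injective L)
    (hcard : Fintype.card X ^ 2 = Fintype.card V) : ∑ v, S v = Fintype.card X := by
  have hBzero : ∀ v, B v 0 = 1 := by
    intro v
    have h := hB v 0 0
    rw [add_zero] at h
    rcases hB1 v 0 with h' | h' <;> rw [h'] at h ⊢
    norm_num at h
  -- The inner sum is a character sum over `X`: it is `|X|` for a trivial character and 0 otherwise.
  have hN0 : ∀ v, 0 ≤ ∑ x, B v (L x) := by
    intro v
    by_cases h : ∀ x, B v (L x) = 1
    · simp [h]
    · push Not at h
      obtain ⟨x₀, hx₀⟩ := h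
      have h1 : ∑ x, B v (L x) = -∑ x, B v (L x) := by
        conv_lhs => rw [← Equiv.sum_comp (Equiv.addRight x₀)]
        rw [← sum_neg_distrib]
        refine sum_congr rfl fun x _ => ?_
        rw [Equiv.coe_addRight, map_add, hB, (hB1 v (L x₀)).resolve_left hx₀, mul_neg_one]
      omega
  have hBL : ∀ y x, B (L y) (L x) = 1 := by
    intro y x
    have h := hS (L y) (L x)
    rw [← map_add, hSL, hSL, hSL, one_mul, one_mul] at h
    exact h.symm
  have htotal : ∑ v, ∑ x, B v (L x) = (Fintype.card X : ℤ) ^ 2 := by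
    rw [sum_comm, sum_eq_single 0]
    · simp only [map_zero, hBzero, sum_const, card_univ]
      rw [← hcard]
      simp
    · exact fun x _ hx => hB0 _ fun h => hx (hL (by rw [h, map_zero]))
    · exact fun h => absurd (mem_univ _) h
  have himage : ∀ F : V → ℤ, ∑ v ∈ univ.image L, F v = ∑ x, F (L x) := fun F =>
    sum_image fun _ _ _ _ h => hL h
  have hpart : ∑ v ∈ univ.image L, ∑ x, B v (L x) = (Fintype.card X : ℤ) ^ 2 := by
    rw [himage]
    simp [hBL, sq]
  -- The image of `L` already accounts for the whole total `|X|²`, so it is its own orthogonal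
  -- complement.
  have hout : ∀ v ∈ (univ.image L)ᶜ, ∑ x, B v (L x) = 0 := by
    have h := sum_add_sum_compl (univ.image L) fun v => ∑ x, B v (L x)
    rw [htotal, hpart, add_eq_left] at h
    exact (sum_eq_zero_iff_of_nonneg fun v _ => hN0 v).1 h
  -- Averaging `S` over translates by the image of `L` kills all terms outside the image, where `S`
  -- is 1.
  have hmain : (Fintype.card X : ℤ) * ∑ v, S v = (Fintype.card X : ℤ) * Fintype.card X := by
    calc (Fintype.card X : ℤ) * ∑ v, S v = ∑ x : X, ∑ v, S v := by simp
      _ = ∑ x, ∑ v, S (v + L x) :=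
        sum_congr rfl fun x _ => (Equiv.sum_comp (Equiv.addRight (L x)) S).symm
      _ = ∑ v, S v * ∑ x, B v (L x) := by
        rw [sum_comm]
        refine sum_congr rfl fun v _ => ?_
        rw [mul_sum]
        refine sum_congr rfl fun x _ => ?_
        rw [hS, hSL, mul_one]
      _ = ∑ v ∈ univ.image L, S v * ∑ x, B v (L x) := by
        rw [← sum_add_sum_compl (univ.image L), add_eq_left]
        exact sum_eq_zero fun v hv => by rw [hout v hv, mul_zero]
      _ = _ := by
        rw [himage]
        simp [hBL, hSL]
  have hpos : (Fintype.card X : ℤ) ≠ 0 := by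
    have : 0 < Fintype.card X := Fintype.card_pos_iff.2 ⟨0⟩
    omega
  exact mul_left_cancel₀ hpos hmain

/-- The vectors of even weight and length five, given by their last four coordinates. -/
def parityExtend (e : Fin 4 → ZMod 2) : Fin 5 → ZMod 2 := Fin.cons (∑ s, e s) e

def evenWeight (e : Fin 4 → ZMod 2) : ℕ := (univ.filter fun s => parityExtend e s = 1).card

/-- Half the weight modulo 2 is a quadratic form on the even vectors; its polar form is the dot
product, whose sign is `pairSign`. -/
def halfSign (e : Fin 4 → ZMod 2) : ℤ := (-1) ^ (evenWeight e / 2)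

def pairSign (e f : Fin 4 → ZMod 2) : ℤ :=
  (-1) ^ (univ.filter fun s => parityExtend e s = 1 ∧ parityExtend f s = 1).card

theorem even_evenWeight (e : Fin 4 → ZMod 2) : Even (evenWeight e) := by
  revert e
  decide +kernel

theorem halfSign_add (e f : Fin 4 → ZMod 2) :
    halfSign (e + f) = halfSign e * halfSign f * pairSign e f := by
  revert e f
  decide +kernel

theorem pairSign_add (e f g : Fin 4 → ZMod 2) :
    pairSign e (f + g) = pairSign e f * pairSign e g := by
  revert e f g
  decide +kernel

theorem pairSign_eq (e f : Fin 4 → ZMod 2) : pairSign e f = 1 ∨ pairSign e f = -1 :=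
  neg_one_pow_eq_or ℤ _

theorem sum_pairSign (f : Fin 4 → ZMod 2) (hf : f ≠ 0) : ∑ e, pairSign e f = 0 := by
  revert f
  decide +kernel

/-- There are 1, 10 and 5 vectors of weight 0, 2 and 4, giving `1 - 10 + 5`. The negative sign shows
that the form is elliptic. -/
theorem sum_halfSign : ∑ e, halfSign e = -4 := by decide +kernel

/-- A totally singular linear map from `F₂¹⁴` to the seventh power of the space of even vectors
of length five is not injective. -/
theorem not_injective_of_halfSign (L : (Fin 14 → ZMod 2) →+ (Fin 7 → Fin 4 → ZMod 2))
    (hL : ∀ x, ∏ i, halfSign (L x i) = 1) : ¬ Function.Injective L := by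
  intro hinj
  have h := gauss_sum_eq_card L (S := fun v => ∏ i, halfSign (v i))
    (B := fun v w => ∏ i, pairSign (v i) (w i))
    (fun v w => by simp only [Pi.add_apply, halfSign_add, prod_mul_distrib])
    (fun v w w' => by
      simp only [← prod_mul_distrib]
      exact prod_congr rfl fun i _ => pairSign_add _ _ _)
    (fun v w => by
      refine prod_induction _ (fun z : ℤ => z = 1 ∨ z = -1) ?_ (Or.inl rfl)
        fun i _ => pairSign_eq _ _
      rintro a b (rfl | rfl) (rfl | rfl) <;> simp)
    (fun w hw => by
      obtain ⟨i, hi⟩ := Function.ne_iff.1 hw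
      have h1 := prod_univ_sum (fun _ : Fin 7 => (univ : Finset (Fin 4 → ZMod 2)))
        (fun i e => pairSign e (w i))
      rw [Fintype.piFinset_univ] at h1
      rw [← h1]
      exact prod_eq_zero (mem_univ i) (sum_pairSign _ hi))
    hL hinj (by
      simp only [Fintype.card_fun, ZMod.card, Fintype.card_fin]
      norm_num)
  -- The sum over seven copies is `(-4) ^ 7`, which is negative, yet it would have to be a
  -- cardinality.
  rw [← Fintype.sum_pow, sum_halfSign] at h
  have h2 : (0 : ℤ) ≤ Fintype.card (Fin 14 → ZMod 2) := Nat.cast_nonneg _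
  rw [← h] at h2
  norm_num at h2

end GaussSum

/-! ### A set of words meeting every triple evenly. -/

section EvenSubset

/-- Double counting of the agreements of a subset of a family of words. -/
theorem sum_sum_agree_subset {M n q : ℕ} (c : Fin M → Fin n → Fin q) (T : Finset (Fin M)) :
    ∑ j ∈ T, ∑ k ∈ T, agree (c j) (c k) =
      ∑ i, ∑ σ, (T.filter fun k => c k i = σ).card ^ 2 := by
  have h1 : ∀ i : Fin n, ∀ σ : Fin q, (T.filter fun k => c k i = σ).card ^ 2 =
      ∑ j ∈ T, ∑ k ∈ T, if c j i = σ ∧ c k i = σ then 1 else 0 := by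
    intro i σ
    rw [sq, card_filter, sum_mul_sum]
    refine sum_congr rfl fun j _ => sum_congr rfl fun k _ => ?_
    by_cases h : c j i = σ <;> by_cases h' : c k i = σ <;> simp [h, h']
  have h2 : ∀ j k : Fin M, agree (c j) (c k) =
      ∑ i, ∑ σ, if c j i = σ ∧ c k i = σ then 1 else 0 := by
    intro j k
    rw [agree_eq_sum]
    refine sum_congr rfl fun i _ => ?_
    by_cases h : c j i = c k i
    · simp [h]
    · rw [if_neg h]
      symm
      refine sum_eq_zero fun σ _ => if_neg ?_
      rintro ⟨rfl, h'⟩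
      exact h h'.symm
  simp only [h1, h2]
  calc _ = ∑ j ∈ T, ∑ i, ∑ k ∈ T, ∑ σ, (if c j i = σ ∧ c k i = σ then 1 else 0) :=
        sum_congr rfl fun j _ => sum_comm
    _ = ∑ i, ∑ j ∈ T, ∑ k ∈ T, ∑ σ, (if c j i = σ ∧ c k i = σ then 1 else 0) := sum_comm
    _ = ∑ i, ∑ j ∈ T, ∑ σ, ∑ k ∈ T, (if c j i = σ ∧ c k i = σ then 1 else 0) :=
        sum_congr rfl fun i _ => sum_congr rfl fun j _ => sum_comm
    _ = _ := sum_congr rfl fun i _ => sum_comm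

/-- A family of `15` words of length `7` over five symbols attaining the Plotkin bound. -/
structure IsKirkman (c : Fin 15 → Fin 7 → Fin 5) : Prop where
  freq_eq : ∀ k σ, freq σ (c k) = 1 ∨ freq σ (c k) = 2
  colCount_eq : ∀ i σ, colCount c i σ = 3
  agree_eq : ∀ j k, j ≠ k → agree (c j) (c k) = 1

theorem IsFamily.isKirkman {c : Fin 15 → Fin 7 → Fin 5} (hc : IsFamily 1 c) : IsKirkman c := by
  obtain ⟨h1, h2⟩ := tight_family (q := 5) (m := 3) hc (by norm_num)
  refine ⟨fun k σ => ?_, h1, h2⟩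
  have := hc.equitable k σ
  rwa [Nat.ceilDiv_eq_add_pred_div] at this

variable {c : Fin 15 → Fin 7 → Fin 5}

/-- Each word of `T` agrees seven times with itself and once with each other word of `T`. -/
theorem IsKirkman.sum_sq (hc : IsKirkman c) (T : Finset (Fin 15)) :
    ∑ i, ∑ σ, (T.filter fun k => c k i = σ).card ^ 2 = T.card * (T.card + 6) := by
  rw [← sum_sum_agree_subset]
  have h : ∀ j ∈ T, ∑ k ∈ T, agree (c j) (c k) = T.card + 6 := by
    intro j hj
    rw [← add_sum_erase T _ hj, agree_self, sum_congr rfl fun k hk =>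
      hc.agree_eq j k (ne_of_mem_erase hk).symm, sum_const, card_erase_of_mem hj]
    have := card_pos.2 ⟨j, hj⟩
    rw [smul_eq_mul]
    omega
  rw [sum_congr rfl h, sum_const, smul_eq_mul]

/-- The vector of odd symbols in each position, for the set of words with indicator function `x`. -/
def parities (c : Fin 15 → Fin 7 → Fin 5) : (Fin 14 → ZMod 2) →+ (Fin 7 → Fin 4 → ZMod 2) :=
  AddMonoidHom.mk'
    (fun x i s => ∑ k, (Fin.cons (∑ l, x l) x : Fin 15 → ZMod 2) k * if c k i = s.succ then 1 else 0)
    (by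
      intro x y
      ext i s
      simp only [Pi.add_apply, ← sum_add_distrib, ← add_mul]
      refine sum_congr rfl fun k _ => ?_
      congr 1
      refine Fin.cases ?_ (fun l => ?_) k
      · simp [sum_add_distrib]
      · simp)

/-- The set of words with indicator function `x`. -/
def wordSet (x : Fin 14 → ZMod 2) : Finset (Fin 15) :=
  univ.filter fun k => (Fin.cons (∑ l, x l) x : Fin 15 → ZMod 2) k = 1

theorem cons_eq_ite (x : Fin 14 → ZMod 2) (k : Fin 15) :
    (Fin.cons (∑ l, x l) x : Fin 15 → ZMod 2) k = if k ∈ wordSet x then 1 else 0 := by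
  have h : ∀ a : ZMod 2, a = if a = 1 then 1 else 0 := by decide
  rw [h ((Fin.cons (∑ l, x l) x : Fin 15 → ZMod 2) k)]
  simp [wordSet]

theorem even_card_wordSet (x : Fin 14 → ZMod 2) : Even (wordSet x).card := by
  rw [← ZMod.natCast_eq_zero_iff_even]
  have h : ((wordSet x).card : ZMod 2) = ∑ k, (Fin.cons (∑ l, x l) x : Fin 15 → ZMod 2) k := by
    simp [cons_eq_ite]
  rw [h, Fin.sum_univ_succ]
  simp only [Fin.cons_zero, Fin.cons_succ]
  exact CharTwo.add_self_eq_zero _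

/-- Only symbol 0 needs an argument: the set is even, so the five parities in a position add up to
0. -/
theorem parityExtend_parities (x : Fin 14 → ZMod 2) (i : Fin 7) (s : Fin 5) :
    parityExtend (parities c x i) s = (((wordSet x).filter fun k => c k i = s).card : ZMod 2) := by
  have hsucc : ∀ s : Fin 4, parities c x i s =
      (((wordSet x).filter fun k => c k i = s.succ).card : ZMod 2) := by
    intro s
    have : parities c x i s = ∑ k, (Fin.cons (∑ l, x l) x : Fin 15 → ZMod 2) k *
      if c k i = s.succ then 1 else 0 := rfl
    rw [this]
    simp only [cons_eq_ite, card_filter, Nat.cast_sum]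
    rw [← sum_filter_add_sum_filter_not univ (fun k => k ∈ wordSet x)]
    have h2 : ∑ k with k ∉ wordSet x, ((if k ∈ wordSet x then 1 else 0) *
      (if c k i = s.succ then 1 else 0) : ZMod 2) = 0 :=
      sum_eq_zero fun k hk => by rw [if_neg (mem_filter.1 hk).2, zero_mul]
    rw [h2, add_zero]
    refine sum_congr (by ext; simp) fun k hk => ?_
    rw [if_pos hk]
    simp
  refine Fin.cases ?_ (fun s => ?_) s
  · have h1 : parityExtend (parities c x i) 0 = ∑ s, parities c x i s := rfl
    rw [h1]
    simp only [hsucc]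
    have h2 : (wordSet x).card = ∑ s, ((wordSet x).filter fun k => c k i = s).card :=
      card_eq_sum_card_fiberwise fun _ _ => mem_univ _
    rw [Fin.sum_univ_succ] at h2
    have h3 := congrArg (Nat.cast : ℕ → ZMod 2) h2
    rw [(ZMod.natCast_eq_zero_iff_even).2 (even_card_wordSet x), Nat.cast_add, Nat.cast_sum] at h3
    exact (CharTwo.add_eq_zero.1 h3.symm).symm
  · exact hsucc s

theorem sq_modEq_mod_two (n : ℕ) : n ^ 2 ≡ n % 2 [MOD 4] := by
  unfold Nat.ModEq
  rcases Nat.even_or_odd' n with ⟨m, rfl | rfl⟩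
  · have h1 : (2 * m) ^ 2 = 4 * (m * m) := by ring
    omega
  · have h1 : (2 * m + 1) ^ 2 = 4 * (m * m + m) + 1 := by ring
    omega

/-- Squares are congruent to parities modulo 4, so the total weight is congruent to `|T|(|T| + 6)`,
which is divisible by 4 for even `|T|`. Hence the image of `parities` is totally singular. -/
theorem IsKirkman.prod_halfSign (hc : IsKirkman c) (x : Fin 14 → ZMod 2) :
    ∏ i, halfSign (parities c x i) = 1 := by
  have h1 : ∀ i, evenWeight (parities c x i) =
      ∑ s, ((wordSet x).filter fun k => c k i = s).card % 2 := by
    intro i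
    rw [evenWeight, card_filter]
    refine sum_congr rfl fun s _ => ?_
    rw [parityExtend_parities]
    rcases Nat.mod_two_eq_zero_or_one ((wordSet x).filter fun k => c k i = s).card with h | h
    · rw [h, (ZMod.natCast_eq_zero_iff_even).2 (Nat.even_iff.2 h)]
      rfl
    · rw [h, (ZMod.natCast_eq_one_iff_odd).2 (Nat.odd_iff.2 h)]
      rfl
  have h2 : ∑ i, evenWeight (parities c x i) ≡ 0 [MOD 4] := by
    have h3 : ∑ i, evenWeight (parities c x i) ≡ (wordSet x).card * ((wordSet x).card + 6)
        [MOD 4] := by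
      rw [← hc.sum_sq]
      simp only [h1]
      exact Nat.ModEq.sum fun i _ => Nat.ModEq.sum fun s _ => (sq_modEq_mod_two _).symm
    refine h3.trans ?_
    obtain ⟨m, hm⟩ := even_card_wordSet x
    rw [hm]
    refine (Nat.modEq_zero_iff_dvd).2 ⟨m * (m + 3), by ring⟩
  have h4 : ∑ i, evenWeight (parities c x i) = 2 * ∑ i, evenWeight (parities c x i) / 2 := by
    rw [mul_sum]
    refine sum_congr rfl fun i _ => ?_
    have := Nat.even_iff.1 (even_evenWeight (parities c x i))
    omega
  simp only [halfSign]
  rw [prod_pow_eq_pow_sum]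
  refine Even.neg_one_pow ?_
  rw [Nat.even_iff]
  unfold Nat.ModEq at h2
  omega

theorem IsKirkman.exists_even_subset (hc : IsKirkman c) : ∃ T : Finset (Fin 15), T.Nonempty ∧
    Even T.card ∧ ∀ i σ, Even (T.filter fun k => c k i = σ).card := by
  have h := not_injective_of_halfSign (parities c) hc.prod_halfSign
  rw [injective_iff_map_eq_zero] at h
  push Not at h
  obtain ⟨x, hx, hx0⟩ := h
  refine ⟨wordSet x, ?_, even_card_wordSet x, fun i σ => ?_⟩
  · obtain ⟨l, hl⟩ := Function.ne_iff.1 hx0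
    have h2 : ∀ a : ZMod 2, a ≠ 0 → a = 1 := by decide
    exact ⟨l.succ, mem_filter.2 ⟨mem_univ _, by rw [Fin.cons_succ]; exact h2 _ hl⟩⟩
  · rw [← ZMod.natCast_eq_zero_iff_even, ← parityExtend_parities, hx]
    refine Fin.cases ?_ (fun s => ?_) σ
    · simp [parityExtend]
    · simp [parityExtend]

end EvenSubset

/-! ### The Fano plane inside the family. -/

section Fano

/-- The Fano plane is the only Steiner triple system on seven points: `m` maps two points to the
third point of their line. -/
theorem exists_fano_labelling {α : Type*} [Fintype α] [DecidableEq α] (hα : Fintype.card α = 7)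
    (m : α → α → α) (hm : ∀ a b, a ≠ b → m a b ≠ a ∧ m a b ≠ b ∧ m b a = m a b ∧ m a (m a b) = b) :
    ∃ P : Fin 7 → α, Function.Bijective P ∧ ∀ i, m (P i) (P (i + 1)) = P (i + 3) := by
  obtain ⟨p0, p1, h01⟩ := Fintype.exists_pair_of_one_lt_card (show 1 < Fintype.card α by omega)
  obtain ⟨p3, h3⟩ : ∃ p3, m p0 p1 = p3 := ⟨_, rfl⟩
  obtain ⟨p2, hp2⟩ : ∃ p2, p2 ∉ ({p0, p1, p3} : Finset α) := by
    by_contra! h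
    have h1 : (univ : Finset α) ⊆ {p0, p1, p3} := fun x _ => h x
    have h2 := card_le_card h1
    rw [card_univ, hα] at h2
    have h3 := card_le_three (a := p0) (b := p1) (c := p3)
    omega
  simp only [mem_insert, mem_singleton, not_or] at hp2
  obtain ⟨h20, h21, h23⟩ := hp2
  -- The names are dictated by the lines `{i, i + 1, i + 3}` modulo 7: `{1, 2, 4}`, then `{6, 0, 2}`
  -- and `{4, 5, 0}`.
  obtain ⟨p4, h4⟩ : ∃ p4, m p1 p2 = p4 := ⟨_, rfl⟩
  obtain ⟨p6, h6⟩ : ∃ p6, m p0 p2 = p6 := ⟨_, rfl⟩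
  have hne : ∀ a b, a ≠ b → m a b ≠ a ∧ m a b ≠ b := fun a b h => ⟨(hm a b h).1, (hm a b h).2.1⟩
  have hcomm : ∀ a b, a ≠ b → m b a = m a b := fun a b h => (hm a b h).2.2.1
  have hinv : ∀ a b, a ≠ b → m a (m a b) = b := fun a b h => (hm a b h).2.2.2
  have h30 : p3 ≠ p0 := by grind
  have h31 : p3 ≠ p1 := by grind
  have h40 : p4 ≠ p0 := by grind
  have h41 : p4 ≠ p1 := by grind
  have h42 : p4 ≠ p2 := by grind
  have h43 : p4 ≠ p3 := by grind
  have h60 : p6 ≠ p0 := by grind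
  have h61 : p6 ≠ p1 := by grind
  have h62 : p6 ≠ p2 := by grind
  have h63 : p6 ≠ p3 := by grind
  have h64 : p6 ≠ p4 := by grind
  obtain ⟨p5, h5⟩ : ∃ p5, m p0 p4 = p5 := ⟨_, rfl⟩
  have h50 : p5 ≠ p0 := by grind
  have h51 : p5 ≠ p1 := by grind
  have h52 : p5 ≠ p2 := by grind
  have h53 : p5 ≠ p3 := by grind
  have h54 : p5 ≠ p4 := by grind
  have h56 : p5 ≠ p6 := by grind
  have hinj : Function.Injective ![p0, p1, p2, p3, p4, p5, p6] := by
    rw [← List.nodup_ofFn]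
    simp only [List.ofFn_succ, List.ofFn_zero]
    simp
    grind
  have hbij : Function.Bijective ![p0, p1, p2, p3, p4, p5, p6] :=
    (Fintype.bijective_iff_injective_and_card _).2 ⟨hinj, by rw [hα, Fintype.card_fin]⟩
  have hall : ∀ y, y = p0 ∨ y = p1 ∨ y = p2 ∨ y = p3 ∨ y = p4 ∨ y = p5 ∨ y = p6 := by
    intro y
    obtain ⟨i, rfl⟩ := hbij.2 y
    fin_cases i <;> simp
  have e24 : m p2 p4 = p1 := by grind
  have e26 : m p2 p6 = p0 := by grind
  have e45 : m p4 p5 = p0 := by grind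
  have e06 : m p0 p6 = p2 := by grind
  have e05 : m p0 p5 = p4 := by grind
  have e03 : m p0 p3 = p1 := by grind
  have e13 : m p1 p3 = p0 := by grind
  have e14 : m p1 p4 = p2 := by grind
  -- The last three lines follow by elimination among the seven points.
  have e235 : m p2 p3 = p5 := by
    have := hall (m p2 p3)
    grind
  have e346 : m p3 p4 = p6 := by
    have := hall (m p3 p4)
    grind
  have e561 : m p5 p6 = p1 := by
    have := hall (m p5 p6)
    grind
  refine ⟨_, hbij, fun i => ?_⟩
  fin_cases i
  exacts [h3, h4, e235, e346, e45, e561, (hcomm p0 p6 h60.symm).trans e06]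

variable {c : Fin 15 → Fin 7 → Fin 5}

theorem exists_eq_of_agree_eq_one {q n : ℕ} {u v : Fin n → Fin q} (h : agree u v = 1) :
    ∃ i, u i = v i ∧ ∀ j, u j = v j → j = i := by
  obtain ⟨i, hi⟩ := card_eq_one.1 h
  have hmem : ∀ j, u j = v j ↔ j = i := fun j => by
    simpa using congrArg (j ∈ ·) hi
  exact ⟨i, (hmem i).2 rfl, fun j => (hmem j).1⟩

/-- An even set `T` meets each triple in 0 or 2 words, so squares of the counts are twice the counts
and `|T|(|T| + 6) = 14 |T|`. Thus `|T| = 8`, and the complement meets each triple in 1 or 3 words.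
-/
theorem IsKirkman.exists_complement (hc : IsKirkman c) : ∃ F : Finset (Fin 15), F.card = 7 ∧
    ∀ i σ, (F.filter fun k => c k i = σ).card = 1 ∨ (F.filter fun k => c k i = σ).card = 3 := by
  obtain ⟨T, ⟨k₀, hk₀⟩, heven, hT⟩ := hc.exists_even_subset
  have hadd : ∀ i σ, (T.filter fun k => c k i = σ).card + (Tᶜ.filter fun k => c k i = σ).card =
      3 := by
    intro i σ
    rw [← hc.colCount_eq i σ, colCount, ← card_union_of_disjoint
      (disjoint_filter_filter disjoint_compl_right), ← filter_union, union_compl]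
  have hcases : ∀ i σ, (T.filter fun k => c k i = σ).card = 0 ∨
      (T.filter fun k => c k i = σ).card = 2 := by
    intro i σ
    have h1 := hadd i σ
    have h2 := Nat.even_iff.1 (hT i σ)
    omega
  have hsum : ∀ i, ∑ σ, (T.filter fun k => c k i = σ).card = T.card := fun i =>
    (card_eq_sum_card_fiberwise fun _ _ => mem_univ _).symm
  have hsq := hc.sum_sq T
  have hsq' : ∀ i σ, (T.filter fun k => c k i = σ).card ^ 2 =
      2 * (T.filter fun k => c k i = σ).card := by
    intro i σ
    rcases hcases i σ with h | h <;> rw [h] <;> norm_num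
  simp only [hsq', ← mul_sum, hsum] at hsq
  simp only [sum_const, card_univ, Fintype.card_fin, smul_eq_mul] at hsq
  have hpos : 0 < T.card := card_pos.2 ⟨k₀, hk₀⟩
  have h8 : T.card = 8 := by
    have : T.card * (T.card + 6) = T.card * 14 := by linarith
    have := Nat.eq_of_mul_eq_mul_left hpos this
    omega
  refine ⟨Tᶜ, by rw [card_compl, h8, Fintype.card_fin], fun i σ => ?_⟩
  have h1 := hadd i σ
  have h2 := hcases i σ
  omega

theorem exists_third {F : Finset (Fin 15)} {i : Fin 7}
    (h : ∀ σ, (F.filter fun k => c k i = σ).card = 1 ∨ (F.filter fun k => c k i = σ).card = 3)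
    {a b : Fin 15} (ha : a ∈ F) (hb : b ∈ F) (hab : a ≠ b) (hi : c a i = c b i) :
    ∃ d ∈ F, d ≠ a ∧ d ≠ b ∧ c d i = c a i ∧
      ∀ k ∈ F, c k i = c a i → k = a ∨ k = b ∨ k = d := by
  have hA : a ∈ F.filter fun k => c k i = c a i := mem_filter.2 ⟨ha, rfl⟩
  have hB : b ∈ F.filter fun k => c k i = c a i := mem_filter.2 ⟨hb, hi.symm⟩
  have h3 : (F.filter fun k => c k i = c a i).card = 3 :=
    (h (c a i)).resolve_left (one_lt_card.2 ⟨a, hA, b, hB, hab⟩).ne'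
  have h1 : (((F.filter fun k => c k i = c a i).erase a).erase b).card = 1 := by
    rw [card_erase_of_mem (mem_erase.2 ⟨hab.symm, hB⟩), card_erase_of_mem hA, h3]
  obtain ⟨d, hd⟩ := card_eq_one.1 h1
  have hmem : ∀ k, (k ≠ b ∧ k ≠ a ∧ k ∈ F ∧ c k i = c a i) ↔ k = d := fun k => by
    simpa using congrArg (k ∈ ·) hd
  obtain ⟨hdb, hda, hdF, hdi⟩ := (hmem d).2 rfl
  refine ⟨d, hdF, hda, hdb, hdi, fun k hk hki => ?_⟩
  by_cases hka : k = a
  · exact Or.inl hka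
  by_cases hkb : k = b
  · exact Or.inr (Or.inl hkb)
  · exact Or.inr (Or.inr ((hmem k).1 ⟨hkb, hka, hk, hki⟩))

/-- In each position, at most one symbol occurs three times in `F`. -/
theorem eq_of_card_eq_three {F : Finset (Fin 15)} (hF : F.card = 7) {i : Fin 7}
    (h : ∀ σ, (F.filter fun k => c k i = σ).card = 1 ∨ (F.filter fun k => c k i = σ).card = 3)
    {σ τ : Fin 5} (hσ : (F.filter fun k => c k i = σ).card = 3)
    (hτ : (F.filter fun k => c k i = τ).card = 3) : σ = τ := by
  by_contra hne
  have hsum : ∑ ρ, (F.filter fun k => c k i = ρ).card = 7 :=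
    hF ▸ (card_eq_sum_card_fiberwise fun _ _ => mem_univ _).symm
  rw [← add_sum_erase univ _ (mem_univ σ), ← add_sum_erase _ _
    (mem_erase.2 ⟨fun h => hne h.symm, mem_univ τ⟩), hσ, hτ] at hsum
  have hle : ((univ.erase σ).erase τ).card • 1 ≤
      ∑ ρ ∈ (univ.erase σ).erase τ, (F.filter fun k => c k i = ρ).card :=
    card_nsmul_le_sum _ _ _ fun ρ _ => by
      have := h ρ
      omega
  rw [card_erase_of_mem (mem_erase.2 ⟨fun h => hne h.symm, mem_univ τ⟩),
    card_erase_of_mem (mem_univ σ), card_univ, Fintype.card_fin] at hle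
  simp only [smul_eq_mul] at hle
  omega

/-- There are words `f 0, …, f 6` of the family and an order `e` of the positions such that, in
position `e i`, the words `f i`, `f (i + 1)`, `f (i + 3)` have one symbol and the other four words
the other four symbols. -/
theorem IsKirkman.exists_labelling (hc : IsKirkman c) : ∃ (f : Fin 7 → Fin 15) (e : Fin 7 → Fin 7),
    Function.Injective f ∧ Function.Injective e ∧
    (∀ i p p', c (f p) (e i) = c (f p') (e i) ↔ blockOf p i = blockOf p' i) ∧
    ∀ i σ, ∃ p, c (f p) i = σ := by
  obtain ⟨F, hF, h⟩ := hc.exists_complement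
  have hthird : ∀ a b : F, a ≠ b → ∃ d : F, d ≠ a ∧ d ≠ b ∧ ∃ i, c a i = c b i ∧ c d i = c a i ∧
      ∀ k ∈ F, c k i = c a i → k = a ∨ k = b ∨ k = d := by
    intro a b hab
    have hab' : (a : Fin 15) ≠ b := fun h => hab (Subtype.ext h)
    obtain ⟨i, hi, -⟩ := exists_eq_of_agree_eq_one (hc.agree_eq a b hab')
    obtain ⟨d, hd, h1, h2, h3, h4⟩ := exists_third (h i) a.2 b.2 hab' hi
    exact ⟨⟨d, hd⟩, fun h => h1 (congrArg Subtype.val h), fun h => h2 (congrArg Subtype.val h), i,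
      hi, h3, h4⟩
  have hunique : ∀ a b : F, a ≠ b → ∀ i j, c a i = c b i → c a j = c b j → i = j := by
    intro a b hab i j hi hj
    obtain ⟨k, -, hk⟩ := exists_eq_of_agree_eq_one
      (hc.agree_eq a b fun h => hab (Subtype.ext h))
    rw [hk i hi, hk j hj]
  -- The value on equal arguments is arbitrary; it makes the third point a total operation.
  have htotal : ∀ a b : F, ∃ d : F, a ≠ b → d ≠ a ∧ d ≠ b ∧ ∃ i, c a i = c b i ∧ c d i = c a i ∧
      ∀ k ∈ F, c k i = c a i → k = a ∨ k = b ∨ k = d := by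
    intro a b
    by_cases hab : a = b
    · exact ⟨a, fun h => absurd hab h⟩
    · obtain ⟨d, hd⟩ := hthird a b hab
      exact ⟨d, fun _ => hd⟩
  choose m hm using htotal
  have huniq : ∀ a b d : F, a ≠ b → d ≠ a → d ≠ b → ∀ i, c a i = c b i → c d i = c a i →
      m a b = d := by
    intro a b d hab hda hdb i hi hdi
    obtain ⟨-, -, j, hj, hmj, hall⟩ := hm a b hab
    obtain rfl := hunique a b hab i j hi hj
    rcases hall d d.2 hdi with h | h | h
    · exact absurd (Subtype.ext h) hda
    · exact absurd (Subtype.ext h) hdb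
    · exact (Subtype.ext h).symm
  obtain ⟨P, hP, hPm⟩ := exists_fano_labelling (α := F) (by simpa using hF) m (by
    intro a b hab
    obtain ⟨h1, h2, i, h3, h4, -⟩ := hm a b hab
    exact ⟨h1, h2, huniq b a _ hab.symm h2 h1 i h3.symm (h4.trans h3),
      huniq a _ b h1.symm hab.symm h2.symm i h4.symm h3.symm⟩)
  have hadd : ∀ i : Fin 7, i ≠ i + 1 := by decide
  have hline : ∀ i : Fin 7, ∃ j, c (P i) j = c (P (i + 1)) j ∧ c (P (i + 3)) j = c (P i) j ∧
      ∀ p, c (P p) j = c (P i) j → p = i ∨ p = i + 1 ∨ p = i + 3 := by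
    intro i
    obtain ⟨-, -, j, h1, h2, h3⟩ := hm (P i) (P (i + 1)) (hP.1.ne (hadd i))
    rw [hPm] at h2 h3
    refine ⟨j, h1, h2, fun p hp => ?_⟩
    rcases h3 (P p) (P p).2 hp with h | h | h
    · exact Or.inl (hP.1 (Subtype.ext h))
    · exact Or.inr (Or.inl (hP.1 (Subtype.ext h)))
    · exact Or.inr (Or.inr (hP.1 (Subtype.ext h)))
  choose e he1 he2 he3 using hline
  have hthree : ∀ a b : F, a ≠ b → ∀ i, c a i = c b i →
      (F.filter fun k => c k i = c a i).card = 3 := by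
    intro a b hab i hi
    have hA : (a : Fin 15) ∈ F.filter fun k => c k i = c a i := mem_filter.2 ⟨a.2, rfl⟩
    have hB : (b : Fin 15) ∈ F.filter fun k => c k i = c a i := mem_filter.2 ⟨b.2, hi.symm⟩
    have hab' : (a : Fin 15) ≠ b := fun h => hab (Subtype.ext h)
    exact (h i (c a i)).resolve_left (one_lt_card.2 ⟨_, hA, _, hB, hab'⟩).ne'
  -- A position has only one symbol repeated inside the plane, so any two agreeing words lie on its
  -- line.
  have hsame : ∀ i p p', p ≠ p' → c (P p) (e i) = c (P p') (e i) →
      c (P p) (e i) = c (P i) (e i) := by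
    intro i p p' hpp hi
    exact eq_of_card_eq_three hF (h (e i)) (hthree (P p) (P p') (hP.1.ne hpp) (e i) hi)
      (hthree (P i) (P (i + 1)) (hP.1.ne (hadd i)) (e i) (he1 i))
  have hblock : ∀ i p p' : Fin 7, blockOf p i = blockOf p' i ↔ p = p' ∨
      ((p = i ∨ p = i + 1 ∨ p = i + 3) ∧ (p' = i ∨ p' = i + 1 ∨ p' = i + 3)) := by
    decide +kernel
  have hon : ∀ i p, (p = i ∨ p = i + 1 ∨ p = i + 3) → c (P p) (e i) = c (P i) (e i) := by
    rintro i p (rfl | rfl | rfl)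
    exacts [rfl, (he1 i).symm, he2 i]
  refine ⟨fun p => P p, e, fun p p' h => hP.1 (Subtype.ext h), ?_, ?_, ?_⟩
  · intro i j hij
    by_contra hne
    -- If `e i = e j`, then `j`, `j + 1` and `j + 3` all lie on the line of `i`, which forces `i =
    -- j`.
    have h1 := he1 j
    rw [← hij] at h1
    have h2 := hsame i j (j + 1) (hadd j) h1
    have h3 := he3 i j h2
    have h4 := he3 i (j + 1) (h1.symm.trans h2)
    have h5 := he3 i (j + 3) (by rw [hij, he2 j, ← hij]; exact h2)
    revert h3 h4 h5 hne
    clear h1 h2 hij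
    revert i j
    decide +kernel
  · intro i p p'
    rw [hblock]
    constructor
    · intro hpp
      by_cases hne : p = p'
      · exact Or.inl hne
      · exact Or.inr ⟨he3 i p (hsame i p p' hne hpp),
          he3 i p' (hpp.symm.trans (hsame i p p' hne hpp))⟩
    · rintro (rfl | ⟨h1, h2⟩)
      · rfl
      · exact (hon i p h1).trans (hon i p' h2).symm
  · intro i σ
    have hpos : 0 < (F.filter fun k => c k i = σ).card := by
      have := h i σ
      omega
    obtain ⟨k, hk⟩ := card_pos.1 hpos
    obtain ⟨hkF, hki⟩ := mem_filter.1 hk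
    obtain ⟨p, hp⟩ := hP.2 ⟨k, hkF⟩
    exact ⟨p, (congrArg (fun z : F => c z i) hp).trans hki⟩

end Fano

/-! ### Fifteen words of length 7 over five symbols. -/

section FiveSeven

variable {c : Fin 15 → Fin 7 → Fin 5}

/-- Renaming the symbols separately in each position turns the plane into `blockOf` and keeps all
agreements. Constant words are no longer constant afterwards, but they stay pairwise disjoint, and
the agreement of a word with one of them is still a symbol frequency. -/
theorem IsKirkman.checkSeven_eq_false (hc : IsKirkman c) : checkSeven = false := by
  obtain ⟨f, e, -, he, hblock, hsurj⟩ := hc.exists_labelling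
  choose g hg using fun i σ => hsurj (e i) σ
  let b : Fin 7 → Fin 5 → ℕ := fun i σ => blockOf (g i σ) i
  have hb : ∀ i p, b i (c (f p) (e i)) = blockOf p i := fun i p => (hblock i _ _).1 (hg i _)
  have hbinj : ∀ i, Function.Injective (b i) := by
    intro i σ τ h
    have := (hblock i _ _).2 h
    rwa [hg, hg] at this
  have hblock5 : ∀ p i : Fin 7, blockOf p i < 5 := by decide +kernel
  have hb5 : ∀ i σ, b i σ < 5 := fun i σ => hblock5 _ _
  let w : (Fin 7 → Fin 5) → ℕ → ℕ := fun u i => if h : i < 7 then b ⟨i, h⟩ (u (e ⟨i, h⟩)) else 0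
  have hwi : ∀ (u : Fin 7 → Fin 5) (i : Fin 7), w u i = b i (u (e i)) := fun u i => dif_pos i.2
  have hw5 : ∀ u i, w u i < 5 := by
    intro u i
    -- Outside the seven positions the default value 0 keeps the symbols below 5.
    by_cases h : i < 7
    · exact (hwi u ⟨i, h⟩).trans_lt (hb5 _ _)
    · exact (dif_neg h).trans_lt (by norm_num)
  have hcard : ∀ u v : ℕ → ℕ, ((range 7).filter fun i => u i = v i).card =
      (univ.filter fun i : Fin 7 => u i = v i).card := by
    intro u v
    rw [card_filter_fin 7 fun i => u i = v i, Nat.count_eq_card_filter_range]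
  have hagree : ∀ u v, ((range 7).filter fun i => w u i = w v i).card = agree u v := by
    intro u v
    rw [hcard, agree, ← card_filter_comp_perm
      (Equiv.ofBijective e (Finite.injective_iff_bijective.1 he)) fun i => u i = v i]
    refine congrArg card (filter_congr fun i _ => ?_)
    rw [hwi, hwi, (hbinj i).eq_iff]
    rfl
  have hpoint : ∀ (p : Fin 7) (u : Fin 7 → Fin 5),
      ((range 7).filter fun i => blockOf p i = w u i).card = agree (c (f p)) u := by
    intro p u
    rw [← hagree, hcard, hcard]
    refine congrArg card (filter_congr fun i _ => ?_)
    rw [hwi (c (f p)), hb]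
  have hfreq : ∀ k s, agree (c k) (fun _ => s) = 1 ∨ agree (c k) (fun _ => s) = 2 := hc.freq_eq
  have hself : ∀ j k, w (c j) ≠ w (c k) → j ≠ k := by
    rintro j k h rfl
    exact h rfl
  have hne : ∀ j k, j ≠ k → w (c j) ≠ w (c k) := by
    intro j k hjk h
    have h1 := hagree (c j) (c k)
    rw [hc.agree_eq j k hjk, h] at h1
    simp at h1
  have hfirst : ∀ j : Fin 5, ∃ p : Fin 7, blockOf p 0 = j := by decide +kernel
  have honce : ∀ p p' : Fin 7, blockOf p 0 < 4 → blockOf p' 0 = blockOf p 0 → p' = p := by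
    decide +kernel
  have hsymbol : ∀ j < 5, ∃ s, b 0 s = j := fun j hj => by
    obtain ⟨p, hp⟩ := hfirst ⟨j, hj⟩
    exact ⟨c (f p) (e 0), (hb 0 p).trans hp⟩
  have hsymbol' : ∀ j, ∃ s, j < 5 → b 0 s = j := fun j => by
    by_cases hj : j < 5
    · obtain ⟨s, hs⟩ := hsymbol j hj
      exact ⟨s, fun _ => hs⟩
    · exact ⟨0, fun h => absurd h hj⟩
  choose s hs using hsymbol'
  refine ESW.checkSeven_eq_false (P := fun t => ∃ k, (∀ p, f p ≠ k) ∧ t = w (c k))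
    (σ := fun j => w fun _ => s j) ?_ ?_ ?_ ?_ (fun j i => hw5 (fun _ => s j) i) ?_ ?_ ?_ ?_
  · rintro _ ⟨k, -, rfl⟩
    exact hw5 _
  · rintro _ ⟨k, hk, rfl⟩ p hp
    exact (hpoint ⟨p, hp⟩ (c k)).trans (hc.agree_eq _ _ (hk _))
  · rintro _ _ ⟨j, -, rfl⟩ ⟨k, -, rfl⟩ h
    exact (hagree _ _).trans (hc.agree_eq j k (hself j k h))
  · intro j hj
    obtain ⟨p, hp⟩ := hfirst ⟨j, by omega⟩
    have hpj : blockOf p 0 = j := hp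
    -- A symbol below 4 occurs in a single word of the plane at this position and in three words
    -- altogether, which leaves two words off the plane.
    have h3 : ((univ.filter fun k => c k (e 0) = c (f p) (e 0)).erase (f p)).card = 2 := by
      have hmem : f p ∈ univ.filter fun k => c k (e 0) = c (f p) (e 0) :=
        mem_filter.2 ⟨mem_univ _, rfl⟩
      rw [card_erase_of_mem hmem]
      exact congrArg (· - 1) (hc.colCount_eq (e 0) (c (f p) (e 0)))
    obtain ⟨k, hk, k', hk', hkk⟩ := one_lt_card.1 (h3 ▸ Nat.one_lt_two)
    have hmem : ∀ k ∈ (univ.filter fun k => c k (e 0) = c (f p) (e 0)).erase (f p),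
        (∀ p', f p' ≠ k) ∧ w (c k) 0 = j := by
      intro k hk
      obtain ⟨hkp, hk⟩ := mem_erase.1 hk
      have hk0 : c k (e 0) = c (f p) (e 0) := (mem_filter.1 hk).2
      refine ⟨?_, ?_⟩
      · rintro p' rfl
        have h1 := (hblock 0 p' p).1 hk0
        exact hkp (congrArg f (honce p p' (by rw [hpj]; exact hj) h1))
      · have h1 := hwi (c k) 0
        rw [hk0, hb] at h1
        exact h1.trans hpj
    exact ⟨_, _, ⟨k, (hmem k hk).1, rfl⟩, ⟨k', (hmem k' hk').1, rfl⟩, hne k k' hkk,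
      (hmem k hk).2, (hmem k' hk').2⟩
  · intro j _ p hp
    have h := hpoint ⟨p, hp⟩ fun _ => s j
    simp only at h
    rw [h]
    exact hfreq _ _
  · rintro j _ _ ⟨k, -, rfl⟩
    exact (hfreq k (s j)).imp (hagree (c k) fun _ => s j).trans (hagree (c k) fun _ => s j).trans
  · intro j hj k hk hjk i hi h
    have h1 := hwi (fun _ => s j) ⟨i, hi⟩
    have h2 := hwi (fun _ => s k) ⟨i, hi⟩
    have h3 : s j = s k := hbinj ⟨i, hi⟩ (h1.symm.trans (h.trans h2))
    have h4 := hs j hj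
    rw [h3, hs k hk] at h4
    exact hjk h4.symm
  · intro j hj
    exact (hwi (fun _ => s j) 0).trans (hs j hj)

set_option maxRecDepth 1000000 in
set_option maxHeartbeats 4000000 in
theorem checkSeven_eq_true : checkSeven = true := by decide +kernel

theorem no_family_five_seven (c : Fin 15 → Fin 7 → Fin 5) : ¬ IsFamily 1 c := fun hc =>
  Bool.false_ne_true (hc.isKirkman.checkSeven_eq_false.symm.trans checkSeven_eq_true)

theorem A_five_seven : A 5 7 6 = 14 :=
  A_eq_of (by norm_num) no_family_five_seven _ isESWC_code_five_seven.1 isESWC_code_five_seven.2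

end FiveSeven

end ESW

theorem mainTheorem9 :
    ESW.A 2 3 2 = 3 ∧ ESW.A 2 5 3 = 4 ∧ ESW.A 2 7 4 = 7 ∧
    ESW.A 3 3 2 = 6 ∧ ESW.A 3 4 3 = 6 ∧ ESW.A 3 11 8 = 11 ∧
    ESW.A 4 5 4 = 12 ∧ ESW.A 5 7 6 = 14 ∧ ESW.A 6 9 8 = 14 :=
  ⟨ESW.A_two_three, ESW.A_two_five, ESW.A_two_seven, ESW.A_three_three, ESW.A_three_four,
    ESW.A_three_eleven, ESW.A_four_five, ESW.A_five_seven, ESW.A_six_nine⟩
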